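/- **Conventions.** Let $(M_p)_{p\ge 0}$, $(N_q)_{q\ge 0}$ be sequences of positive numbers, monotonically increasing to infinity, with $M_0=N_0=1$, with $M_p^{1/p}$, $N_p^{1/p}$ bounded below by a positive constant, and such that both satisfy (each condition being written for $M$) - (M.1) $M_p^2\le M_{p-1}M_{p+1}$ for $p\ge1$; - (M.2) there are $A,H>0$ with $M_{p+q}\le A H^{p+q}M_pM_q$ for all $p,q\ge 0$. Condition $\{N.1\}$: there are $A,H>0$ with $p!^{1/2}\le AH^pM_p$ for all $p$. Condition $(N.1)$: for every $H>0$ there is $A>0$ with $p!^{1/2}\le AH^pM_p$ for all $p$. $\mathcal S^{N_q}_{M_p}(\mathbb R^d)$ (resp. $\Sigma^{N_q}_{M_p}(\mathbb R^d)$) is the space of all $f\in C^\infty(\mathbb R^d)$ such that for some (resp. all) $A,B>0$ there is $C$ with $$\sup_x|x^\alpha\partial^\beta f(x)|\le C A^{|\alpha|}M_{|\alpha|}B^{|\beta|}N_{|\beta|}\quad\text{for all }\alpha,\beta\in\mathbb N_0^d .$$ $\mathcal S^{N_q,M_p}_{M_p,N_q}(\mathbb R^{2d})$ (resp. $\Sigma^{N_q,M_p}_{M_p,N_q}(\mathbb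 R^{2d})$) is the space of all $F\in C^\infty(\mathbb R^{2d})$ such that for some (resp. all) $A,B>0$ there is $C$ with $$\sup_{x,\omega}|x^{\alpha_1}\omega^{\alpha_2}\partial_x^{\beta_1}\partial_\omega^{\beta_2}F(x,\omega)|\le C A^{|\alpha_1+\alpha_2|}M_{|\alpha_1|}N_{|\alpha_2|}B^{|\beta_1+\beta_2|}N_{|\beta_1|}M_{|\beta_2|}$$ for all multi-indices. The dual of $\mathcal S$ consists of the linear functionals that are bounded with respect to the norm with parameters $A,B$ (the least $C$ above) for all $A,B>0$, and carries the projective limit topology of the dual normed spaces; the dual of $\Sigma$ consists of the linear functionals that are bounded with respect to the norm for some $A,B>0$, and carries the locally convex inductive limit topology of the dual normed spaces. A test function $f$ is identified with the functional $\varphi\mapsto\int f\varphi$. For $f,g\in L^2(\mathbb R^d)$ and $x,\omega\in\mathbb R^d$ put $$R_gf(x,\omega)=\int e^{4\pi i\omega(t-x)}f(2x-t)\overline{g(t)}\,dt,\qquad V_gf(x,\omega)=\int e^{-2\pi i t\omega}f(t)\overline{g(t-x)}\,dt,$$ $$W(f,g)(x,\omega)=\int e^{-2\pi i\omega t}f(x+\tfrac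 t2)\overline{g(x-\tfrac t2)}\,dt,\qquad A(f,g)(x,\omega)=\int e^{-2\pi i\omega t}f(t+\tfrac x2)\overline{g(t-\tfrac x2)}\,dt .$$ **Theorem.** Let $M_p$ and $N_q$ be as above and both satisfy $\{N.1\}$, and let $TFR(f,g)$ be any one of $R_gf$, $V_gf$, $W(f,g)$, $A(f,g)$. 1. If $f,g\in\mathcal S^{N_q}_{M_p}(\mathbb R^d)$, then $TFR(f,g)\in\mathcal S^{N_q,M_p}_{M_p,N_q}(\mathbb R^{2d})$. 2. The map $TFR$ of part 1 extends uniquely to a continuous map $$(\mathcal S^{N_q}_{M_p})'(\mathbb R^d)\times(\mathcal S^{N_q}_{M_p})'(\mathbb R^d)\to(\mathcal S^{N_q,M_p}_{M_p,N_q})'(\mathbb R^{2d}).$$ 3. Conversely, let $f,g$ both be nonzero, and let either $f,g\in(\mathcal S^{N_q}_{M_p})'(\mathbb R^d)$, with $TFR(f,g)$ understood as the extension in part 2, or $f,g\in L^2(\mathbb R^d)$, with $TFR(f,g)$ given by the integrals. If $TFR(f,g)\in\mathcal S^{N_q,M_p}_{M_p,N_q}(\mathbb R^{2d})$, then $f,g\in\mathcal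 S^{N_q}_{M_p}(\mathbb R^d)$ (for $f,g\in L^2$: after modification on a null set). If both sequences satisfy $(N.1)$ instead of $\{N.1\}$, then 1, 2 and 3 hold with $\Sigma$ in place of $\mathcal S$ throughout. -/

import Mathlib

open MeasureTheory Filter Topology
open scoped ContDiff

noncomputable section

namespace GelfandShilov

/-! ## Weight sequences -/

/-- A sequence of positive numbers, monotonically increasing to infinity, with `M 0 = 1`,
`(M p)^(1/p)` bounded below by a positive constant, and satisfying (M.1) and (M.2). -/
structure WeightSeq where
  /-- the terms of the sequence -/
  M : ℕ → ℝ
  pos : ∀ p, 0 < M p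
  mono : Monotone M
  tendsto : Tendsto M atTop atTop
  zero : M 0 = 1
  root_bdd_below : ∃ c : ℝ, 0 < c ∧ ∀ p, c ^ p ≤ M p
  /-- condition (M.1): logarithmic convexity -/
  M1 : ∀ p, M (p + 1) ^ 2 ≤ M p * M (p + 2)
  /-- condition (M.2): stability under ultradifferential operators -/
  M2 : ∃ A H : ℝ, 0 < A ∧ 0 < H ∧ ∀ p q, M (p + q) ≤ A * H ^ (p + q) * (M p * M q)

/-- Roumieu type (inductive limit, the spaces `𝒮`) or Beurling type (projective limit, the
spaces `Σ`). -/
inductive GSType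
  | roumieu
  | beurling

/-- "For some `A, B > 0`" in the Roumieu case, "for all `A, B > 0`" in the Beurling case. -/
def GSType.quant : GSType → (ℝ → ℝ → Prop) → Prop
  | .roumieu, P => ∃ A : ℝ, 0 < A ∧ ∃ B : ℝ, 0 < B ∧ P A B
  | .beurling, P => ∀ A : ℝ, 0 < A → ∀ B : ℝ, 0 < B → P A B

/-- The opposite quantifier: "for all `A, B > 0`" in the Roumieu case, "for some `A, B > 0`" in
the Beurling case. -/
def GSType.coquant : GSType → (ℝ → ℝ → Prop) → Prop
  | .roumieu, P => ∀ A : ℝ, 0 < A → ∀ B : ℝ, 0 < B → P A B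
  | .beurling, P => ∃ A : ℝ, 0 < A ∧ ∃ B : ℝ, 0 < B ∧ P A B

/-- The nontriviality condition: `{N.1}` in the Roumieu case (for some `A, H > 0`,
`p!^{1/2} ≤ A H^p M_p` for all `p`), and `(N.1)` in the Beurling case (for every `H > 0` there is
such an `A > 0`). -/
def WeightSeq.Nontrivial (M : WeightSeq) : GSType → Prop
  | .roumieu => ∃ A H : ℝ, 0 < A ∧ 0 < H ∧ ∀ p : ℕ, √(p.factorial : ℝ) ≤ A * H ^ p * M.M p
  | .beurling => ∀ H : ℝ, 0 < H → ∃ A : ℝ, 0 < A ∧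
      ∀ p : ℕ, √(p.factorial : ℝ) ≤ A * H ^ p * M.M p

/-! ## Gelfand-Shilov estimates

`E` is a real vector space with a basis `b`, giving coordinates `x i = b.repr x i` and partial
derivatives along `b i`. Multi-indices are functions `ι → ℕ`. -/

section Generic

variable {ι : Type} [Fintype ι] {E : Type} [NormedAddCommGroup E] [NormedSpace ℝ E]

/-- The monomial `x ^ α`. -/
def monomial (b : Module.Basis ι ℝ E) (α : ι → ℕ) (x : E) : ℝ := ∏ i, b.repr x i ^ α i

/-- The derivative of `f` in the direction `v`. -/
def dirDeriv (v : E) (f : E → ℂ) : E → ℂ := fun x => fderiv ℝ f x v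

/-- The iterated partial derivative `∂ ^ β f`: each `∂_i` is applied `β i` times (for smooth `f`
the order is irrelevant). -/
def iterDeriv (b : Module.Basis ι ℝ E) (β : ι → ℕ) (f : E → ℂ) : E → ℂ :=
  (Finset.univ : Finset ι).toList.foldr (fun i F => (dirDeriv (b i))^[β i] F) f

/-- Positive weights on multi-indices. -/
abbrev MultiWeight (ι : Type) : Type := {w : (ι → ℕ) → ℝ // ∀ α, 0 < w α}

/-- `f` is smooth and
`sup_x |x^α ∂^β f(x)| ≤ C A^|α| m(α) B^|β| n(β)` for all `α, β`; that is, `f` lies in the normed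
space `𝒮_{m,A}^{n,B}` and its norm there is at most `C`. -/
def Bound (b : Module.Basis ι ℝ E) (m n : MultiWeight ι) (A B C : ℝ) (f : E → ℂ) : Prop :=
  ContDiff ℝ ∞ f ∧ ∀ (α β : ι → ℕ) (x : E),
    |monomial b α x| * ‖iterDeriv b β f x‖
      ≤ C * (A ^ (∑ i, α i) * m.1 α * (B ^ (∑ i, β i) * n.1 β))

variable {b : Module.Basis ι ℝ E} {m n : MultiWeight ι}

lemma contDiff_dirDeriv (v : E) {f : E → ℂ} (hf : ContDiff ℝ ∞ f) :
    ContDiff ℝ ∞ (dirDeriv v f) :=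
  (hf.fderiv_right (m := ∞) (by simp)).clm_apply contDiff_const

lemma contDiff_dirDeriv_iterate (v : E) (k : ℕ) {f : E → ℂ} (hf : ContDiff ℝ ∞ f) :
    ContDiff ℝ ∞ ((dirDeriv v)^[k] f) := by
  induction k with
  | zero => simpa using hf
  | succ k ih => rw [Function.iterate_succ_apply']; exact contDiff_dirDeriv v ih

lemma dirDeriv_iterate_lin (v : E) (k : ℕ) (a : ℂ) {f g : E → ℂ} (hf : ContDiff ℝ ∞ f)
    (hg : ContDiff ℝ ∞ g) :
    (dirDeriv v)^[k] (a • f + g) = a • (dirDeriv v)^[k] f + (dirDeriv v)^[k] g := by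
  induction k with
  | zero => rfl
  | succ k ih =>
    simp only [Function.iterate_succ_apply', ih]
    have h1 := (contDiff_dirDeriv_iterate v k hf).differentiable (by simp)
    have h2 := (contDiff_dirDeriv_iterate v k hg).differentiable (by simp)
    funext x
    simp only [dirDeriv]
    rw [fderiv_add ((h1 x).const_smul a) (h2 x), fderiv_const_smul (h1 x)]
    rfl

lemma iterDeriv_lin (β : ι → ℕ) (a : ℂ) {f g : E → ℂ} (hf : ContDiff ℝ ∞ f)
    (hg : ContDiff ℝ ∞ g) :
    iterDeriv b β (a • f + g) = a • iterDeriv b β f + iterDeriv b β g := by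
  unfold iterDeriv
  suffices h : ∀ l : List ι, ∀ f g : E → ℂ, ContDiff ℝ ∞ f → ContDiff ℝ ∞ g →
      ContDiff ℝ ∞ (l.foldr (fun i F => (dirDeriv (b i))^[β i] F) f) ∧
      l.foldr (fun i F => (dirDeriv (b i))^[β i] F) (a • f + g) =
        a • l.foldr (fun i F => (dirDeriv (b i))^[β i] F) f +
          l.foldr (fun i F => (dirDeriv (b i))^[β i] F) g from (h _ f g hf hg).2
  intro l
  induction l with
  | nil => intro f g hf hg; exact ⟨hf, rfl⟩
  | cons i l ih =>
    intro f g hf hg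
    simp only [List.foldr_cons]
    refine ⟨contDiff_dirDeriv_iterate _ _ (ih f g hf hg).1, ?_⟩
    rw [(ih f g hf hg).2, dirDeriv_iterate_lin _ _ _ (ih f g hf hg).1 (ih g f hg hf).1]

lemma Bound.lin {A B C D : ℝ} (a : ℂ) {f g : E → ℂ} (hf : Bound b m n A B C f)
    (hg : Bound b m n A B D g) : Bound b m n A B (‖a‖ * C + D) (a • f + g) := by
  refine ⟨(contDiff_const.smul hf.1).add hg.1, fun α β x => ?_⟩
  rw [iterDeriv_lin β a hf.1 hg.1]
  have h1 := hf.2 α β x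
  have h2 := hg.2 α β x
  have h3 : ‖(a • iterDeriv b β f + iterDeriv b β g) x‖
      ≤ ‖a‖ * ‖iterDeriv b β f x‖ + ‖iterDeriv b β g x‖ := by
    simpa using norm_add_le (a * iterDeriv b β f x) (iterDeriv b β g x)
  have h4 := mul_le_mul_of_nonneg_left h3 (abs_nonneg (monomial b α x))
  have h5 := mul_le_mul_of_nonneg_left h1 (norm_nonneg a)
  nlinarith

lemma Bound.zero (A B : ℝ) : Bound b m n A B 0 (0 : E → ℂ) := by
  refine ⟨contDiff_const, fun α β x => ?_⟩
  have h := iterDeriv_lin (b := b) β (-1) (f := (0 : E → ℂ)) (g := 0) contDiff_const contDiff_const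
  have h' : iterDeriv b β (0 : E → ℂ) = 0 := by simpa using h
  simp [h']

lemma Bound.nonneg {A B C : ℝ} (hA : 0 < A) (hB : 0 < B) {f : E → ℂ} (hf : Bound b m n A B C f) :
    0 ≤ C := by
  have h := (by positivity : (0 : ℝ) ≤ _).trans (hf.2 0 0 0)
  have h1 := m.2 0
  have h2 := n.2 0
  exact nonneg_of_mul_nonneg_left h (by positivity)

lemma Bound.mono {A B A' B' C : ℝ} (hA : 0 < A) (hB : 0 < B) (hAA : A ≤ A') (hBB : B ≤ B')
    {f : E → ℂ} (hf : Bound b m n A B C f) : Bound b m n A' B' C f := by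
  refine ⟨hf.1, fun α β x => (hf.2 α β x).trans ?_⟩
  have h0 := hf.nonneg hA hB
  have h1 := m.2 α
  have h2 := n.2 β
  have hA' : 0 < A' := hA.trans_le hAA
  have hB' : 0 < B' := hB.trans_le hBB
  gcongr

/-- The Gelfand-Shilov space: smooth functions `f` such that for some (Roumieu) or for all
(Beurling) `A, B > 0` there is `C` with `|x^α ∂^β f(x)| ≤ C A^|α| m(α) B^|β| n(β)`.
Scalar parameters `A, B` give the same limits as vectors of parameters. -/
def Space (c : GSType) (b : Module.Basis ι ℝ E) (m n : MultiWeight ι) : Submodule ℂ (E → ℂ) where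
  carrier := {f | c.quant fun A B => ∃ C, Bound b m n A B C f}
  zero_mem' := by
    cases c
    · exact ⟨1, one_pos, 1, one_pos, 0, Bound.zero 1 1⟩
    · exact fun A _ B _ => ⟨0, Bound.zero A B⟩
  add_mem' := by
    intro f g hf hg
    cases c
    · obtain ⟨A, hA, B, hB, C, hf⟩ := hf
      obtain ⟨A', hA', B', hB', C', hg⟩ := hg
      refine ⟨max A A', lt_max_of_lt_left hA, max B B', lt_max_of_lt_left hB, ‖(1 : ℂ)‖ * C + C', ?_⟩
      simpa using (hf.mono hA hB (le_max_left A A') (le_max_left B B')).lin 1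
        (hg.mono hA' hB' (le_max_right A A') (le_max_right B B'))
    · intro A hA B hB
      obtain ⟨C, hC⟩ := hf A hA B hB
      obtain ⟨D, hD⟩ := hg A hA B hB
      exact ⟨‖(1 : ℂ)‖ * C + D, by simpa using hC.lin 1 hD⟩
  smul_mem' := by
    intro a f hf
    cases c
    · obtain ⟨A, hA, B, hB, C, hf⟩ := hf
      exact ⟨A, hA, B, hB, ‖a‖ * C + 0, by simpa using hf.lin a (Bound.zero A B)⟩
    · intro A hA B hB
      obtain ⟨C, hC⟩ := hf A hA B hB
      exact ⟨‖a‖ * C + 0, by simpa using hC.lin a (Bound.zero A B)⟩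

/-! ## The dual space -/

/-- `|u(φ)| ≤ K` for all test functions `φ` in the unit ball of `𝒮_{m,A}^{n,B}`: the norm of `u` in
the dual of the normed space with parameters `A, B` is at most `K`. -/
def DualBound {c : GSType} (u : Space c b m n →ₗ[ℂ] ℂ) (A B K : ℝ) : Prop :=
  ∀ φ : Space c b m n, Bound b m n A B 1 (φ : E → ℂ) → ‖u φ‖ ≤ K

/-- Continuous linear functionals: those that are bounded for all (Roumieu) or for some
(Beurling) of the norms with parameters `A, B > 0`. -/
def dualSubmodule (c : GSType) (b : Module.Basis ι ℝ E) (m n : MultiWeight ι) :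
    Submodule ℂ (Space c b m n →ₗ[ℂ] ℂ) where
  carrier := {u | c.coquant fun A B => ∃ K, DualBound u A B K}
  zero_mem' := by
    cases c
    · exact fun A _ B _ => ⟨0, fun φ _ => by simp⟩
    · exact ⟨1, one_pos, 1, one_pos, 0, fun φ _ => by simp⟩
  add_mem' := by
    intro u v hu hv
    cases c
    · intro A hA B hB
      obtain ⟨K, hK⟩ := hu A hA B hB
      obtain ⟨L, hL⟩ := hv A hA B hB
      exact ⟨K + L, fun φ h => (norm_add_le _ _).trans (add_le_add (hK φ h) (hL φ h))⟩
    · obtain ⟨A, hA, B, hB, K, hK⟩ := hu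
      obtain ⟨A', hA', B', hB', L, hL⟩ := hv
      refine ⟨min A A', lt_min hA hA', min B B', lt_min hB hB', K + L, fun φ h => ?_⟩
      have h1 := h.mono (lt_min hA hA') (lt_min hB hB') (min_le_left A A') (min_le_left B B')
      have h2 := h.mono (lt_min hA hA') (lt_min hB hB') (min_le_right A A') (min_le_right B B')
      exact (norm_add_le _ _).trans (add_le_add (hK φ h1) (hL φ h2))
  smul_mem' := by
    intro a u hu
    have key : ∀ {A B K : ℝ}, DualBound u A B K → DualBound (a • u) A B (‖a‖ * K) := by
      intro A B K hK φ h
      simpa using mul_le_mul_of_nonneg_left (hK φ h) (norm_nonneg a)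
    cases c
    · intro A hA B hB
      obtain ⟨K, hK⟩ := hu A hA B hB
      exact ⟨_, key hK⟩
    · obtain ⟨A, hA, B, hB, K, hK⟩ := hu
      exact ⟨A, hA, B, hB, _, key hK⟩

/-- The dual space (ultradistributions of Roumieu or Beurling type). -/
def Dual (c : GSType) (b : Module.Basis ι ℝ E) (m n : MultiWeight ι) : Type :=
  dualSubmodule c b m n

instance (c : GSType) : AddCommGroup (Dual c b m n) :=
  inferInstanceAs (AddCommGroup (dualSubmodule c b m n))

instance (c : GSType) : Module ℂ (Dual c b m n) :=
  inferInstanceAs (Module ℂ (dualSubmodule c b m n))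

/-- The linear functional underlying an element of the dual space. -/
def Dual.lin {c : GSType} (u : Dual c b m n) : Space c b m n →ₗ[ℂ] ℂ := u.1

/-- The seminorms on the dual that are continuous for the limit topology of the dual normed
spaces.
Roumieu (projective limit): `q` is dominated by a multiple of one of the dual norms.
Beurling (locally convex inductive limit): for every `A, B > 0`, the restriction of `q` to the
normed space of functionals with finite `(A, B)`-dual norm is dominated by a multiple of that
norm. -/
def IsDualSeminorm {c : GSType} (q : Seminorm ℂ (Dual c b m n)) : Prop :=
  c.quant fun A B => ∃ K : ℝ, ∀ u : Dual c b m n, DualBound u.lin A B 1 → q u ≤ K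

/-- The family of all these seminorms. -/
def dualSeminorms (c : GSType) (b : Module.Basis ι ℝ E) (m n : MultiWeight ι) :
    SeminormFamily ℂ (Dual c b m n) {q : Seminorm ℂ (Dual c b m n) // IsDualSeminorm q} :=
  fun q => q.1

/-- The limit topology on the dual: projective limit (Roumieu) or locally convex inductive limit
(Beurling) of the duals of the normed spaces with parameters `A, B > 0`. -/
instance (c : GSType) : TopologicalSpace (Dual c b m n) :=
  (dualSeminorms c b m n).moduleFilterBasis.topology

lemma withSeminorms_dual (c : GSType) : WithSeminorms (dualSeminorms c b m n) := ⟨rfl⟩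

/-! ### Functions as functionals -/

lemma exists_bound {c : GSType} (f : Space c b m n) :
    ∃ A > 0, ∃ B > 0, ∃ C, Bound b m n A B C (f : E → ℂ) := by
  obtain ⟨f, hf⟩ := f
  cases c
  · exact hf
  · exact ⟨1, one_pos, 1, one_pos, hf 1 one_pos 1 one_pos⟩

lemma iterDeriv_zero (f : E → ℂ) : iterDeriv b 0 f = f := by
  unfold iterDeriv
  induction (Finset.univ : Finset ι).toList with
  | nil => rfl
  | cons i l ih => simp

lemma Bound.norm_le {A B C : ℝ} {f : E → ℂ} (hf : Bound b m n A B C f) (x : E) :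
    ‖f x‖ ≤ C * (m.1 0 * n.1 0) := by
  simpa [monomial, iterDeriv_zero] using hf.2 0 0 x

lemma integrable_of_mem [MeasureSpace E] [BorelSpace E] [FiniteDimensional ℝ E]
    [(volume : Measure E).IsAddHaarMeasure] {c : GSType} (f : Space c b m n) :
    Integrable (f : E → ℂ) := by
  classical
  obtain ⟨A, hA, B, hB, C, hf⟩ := exists_bound f
  have hcont : Continuous (f : E → ℂ) := hf.1.continuous
  set k := (volume : Measure E).integrablePower with hk
  have h1 : ∀ i, ∃ D, ∀ x, |b.repr x i| ^ (k + 1) * ‖(f : E → ℂ) x‖ ≤ D := by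
    intro i
    refine ⟨C * (A ^ (∑ j, (Pi.single i (k + 1) : ι → ℕ) j) * m.1 (Pi.single i (k + 1)) *
      (B ^ (∑ j, (0 : ι → ℕ) j) * n.1 0)), fun x => ?_⟩
    have := hf.2 (Pi.single i (k + 1)) 0 x
    rw [iterDeriv_zero] at this
    have hm : monomial b (Pi.single i (k + 1)) x = b.repr x i ^ (k + 1) := by
      unfold monomial
      rw [Finset.prod_eq_single i]
      · simp
      · intro j _ hj; simp [Pi.single_eq_of_ne hj]
      · simp
    rw [hm, abs_pow] at this
    exact this
  choose D hD using h1
  have hx : ∀ x : E, ‖x‖ ≤ ∑ i, |b.repr x i| * ‖b i‖ := by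
    intro x
    conv_lhs => rw [← b.sum_repr x]
    refine (norm_sum_le _ _).trans (Finset.sum_le_sum fun i _ => ?_)
    rw [norm_smul, Real.norm_eq_abs]
  have h2 : ∀ x, ‖x‖ ^ (k + 1) * ‖(f : E → ℂ) x‖ ≤
      (Fintype.card ι : ℝ) ^ k * ∑ i, ‖b i‖ ^ (k + 1) * D i := by
    intro x
    have h3 : ‖x‖ ^ (k + 1) ≤
        (Fintype.card ι : ℝ) ^ k * ∑ i, (|b.repr x i| * ‖b i‖) ^ (k + 1) := by
      refine (pow_le_pow_left₀ (norm_nonneg x) (hx x) _).trans ?_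
      simpa using pow_sum_le_card_mul_sum_pow (s := (Finset.univ : Finset ι))
        (f := fun i => |b.repr x i| * ‖b i‖) (fun i _ => by positivity) k
    refine (mul_le_mul_of_nonneg_right h3 (norm_nonneg _)).trans ?_
    rw [mul_assoc, Finset.sum_mul]
    refine mul_le_mul_of_nonneg_left (Finset.sum_le_sum fun i _ => ?_) (by positivity)
    rw [mul_pow, mul_comm (|b.repr x i| ^ (k + 1)), mul_assoc]
    exact mul_le_mul_of_nonneg_left (hD i x) (by positivity)
  have hb : ∀ x, ‖(f : E → ℂ) x‖ ≤ C * (m.1 0 * n.1 0) := hf.norm_le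
  have h4 : ∀ x, ‖x‖ ^ (0 + k) * ‖(f : E → ℂ) x‖ ≤ C * (m.1 0 * n.1 0) +
      (Fintype.card ι : ℝ) ^ k * ∑ i, ‖b i‖ ^ (k + 1) * D i := by
    intro x
    have h5 := h2 x
    have h6 := hb x
    have h7 : 0 ≤ ‖x‖ ^ (k + 1) * ‖(f : E → ℂ) x‖ := by positivity
    have h8 : ‖x‖ ^ (0 + k) ≤ 1 + ‖x‖ ^ (k + 1) := by
      rw [zero_add]
      rcases le_total ‖x‖ 1 with h | h
      · have := pow_le_one₀ (n := k) (norm_nonneg x) h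
        have : 0 ≤ ‖x‖ ^ (k + 1) := by positivity
        linarith
      · have := pow_le_pow_right₀ h (Nat.le_succ k)
        simp only [Nat.succ_eq_add_one] at this
        linarith
    have h9 := mul_le_mul_of_nonneg_right h8 (norm_nonneg ((f : E → ℂ) x))
    nlinarith
  have hint := integrable_of_le_of_pow_mul_le (μ := (volume : Measure E)) (k := 0) hb h4
    hcont.aestronglyMeasurable
  simp only [pow_zero, one_mul] at hint
  exact (integrable_norm_iff hcont.aestronglyMeasurable).1 hint

lemma integrable_mul [MeasureSpace E] [BorelSpace E] [FiniteDimensional ℝ E]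
    [(volume : Measure E).IsAddHaarMeasure] {c : GSType} (f φ : Space c b m n) :
    Integrable (fun x => (f : E → ℂ) x * (φ : E → ℂ) x) := by
  obtain ⟨A, hA, B, hB, C, hφ⟩ := exists_bound φ
  exact (integrable_of_mem f).mul_bdd (c := C * (m.1 0 * n.1 0)) hφ.1.continuous.aestronglyMeasurable
    (Eventually.of_forall hφ.norm_le)

/-- The canonical embedding of test functions in the dual: `f` acts by `φ ↦ ∫ f φ`. -/
def toDual [MeasureSpace E] [BorelSpace E] [FiniteDimensional ℝ E]
    [(volume : Measure E).IsAddHaarMeasure] {c : GSType} (f : Space c b m n) : Dual c b m n :=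
  ⟨{ toFun := fun φ => ∫ x, (f : E → ℂ) x * (φ : E → ℂ) x
     map_add' := by
       intro φ ψ
       rw [← integral_add (integrable_mul f φ) (integrable_mul f ψ)]
       simp [mul_add]
     map_smul' := by
       intro a φ
       rw [RingHom.id_apply, smul_eq_mul, ← integral_const_mul]
       congr 1
       funext x
       simp only [Submodule.coe_smul, Pi.smul_apply, smul_eq_mul]
       ring },
   by
    have key : ∀ A B : ℝ, ∀ φ : Space c b m n, Bound b m n A B 1 (φ : E → ℂ) →
        ‖∫ x, (f : E → ℂ) x * (φ : E → ℂ) x‖ ≤ ∫ x, ‖(f : E → ℂ) x‖ * (1 * (m.1 0 * n.1 0)) := by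
      intro A B φ h
      refine (norm_integral_le_integral_norm _).trans (integral_mono (integrable_mul f φ).norm
        ((integrable_of_mem f).norm.mul_const _) fun x => ?_)
      simp only [norm_mul]
      exact mul_le_mul_of_nonneg_left (h.norm_le x) (norm_nonneg _)
    cases c
    · exact fun A _ B _ => ⟨_, key A B⟩
    · exact ⟨1, one_pos, 1, one_pos, _, key 1 1⟩⟩

end Generic

/-! ## The spaces on `ℝ^d` and `ℝ^{2d}` -/

/-- `ℝ^d`. -/
abbrev Rn (d : ℕ) : Type := EuclideanSpace ℝ (Fin d)

instance (d : ℕ) : (volume : Measure (Rn d × Rn d)).IsAddHaarMeasure :=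
  inferInstanceAs ((volume : Measure (Rn d)).prod (volume : Measure (Rn d))).IsAddHaarMeasure

/-- The standard basis of `ℝ^d`. -/
def stdBasis (d : ℕ) : Module.Basis (Fin d) ℝ (Rn d) := (EuclideanSpace.basisFun (Fin d) ℝ).toBasis

/-- The standard basis of `ℝ^{2d} = ℝ^d × ℝ^d`; `Sum.inl i` is the coordinate `x_i` and `Sum.inr i`
is the coordinate `ω_i`. -/
def stdBasis₂ (d : ℕ) : Module.Basis (Fin d ⊕ Fin d) ℝ (Rn d × Rn d) :=
  (stdBasis d).prod (stdBasis d)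

/-- The weight `M_{|α|}`. -/
def weight (d : ℕ) (M : WeightSeq) : MultiWeight (Fin d) :=
  ⟨fun α => M.M (∑ i, α i), fun _ => M.pos _⟩

/-- The weight `M_{|α₁|} M'_{|α₂|}` for a multi-index `(α₁, α₂)` on `ℝ^{2d}`. -/
def weight₂ (d : ℕ) (M M' : WeightSeq) : MultiWeight (Fin d ⊕ Fin d) :=
  ⟨fun α => M.M (∑ i, α (.inl i)) * M'.M (∑ i, α (.inr i)), fun _ => mul_pos (M.pos _) (M'.pos _)⟩

/-- `𝒮^N_M(ℝ^d)` (Roumieu) or `Σ^N_M(ℝ^d)` (Beurling). -/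
abbrev GS (c : GSType) (d : ℕ) (M N : WeightSeq) : Submodule ℂ (Rn d → ℂ) :=
  Space c (stdBasis d) (weight d M) (weight d N)

/-- `𝒮^{N,N'}_{M,M'}(ℝ^{2d})` (Roumieu) or `Σ^{N,N'}_{M,M'}(ℝ^{2d})` (Beurling): decay in `x` is
measured by `M`, decay in `ω` by `M'`, derivatives in `x` by `N` and derivatives in `ω` by `N'`. -/
abbrev GS₂ (c : GSType) (d : ℕ) (M M' N N' : WeightSeq) : Submodule ℂ (Rn d × Rn d → ℂ) :=
  Space c (stdBasis₂ d) (weight₂ d M M') (weight₂ d N N')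

/-- The dual of `GS c d M N`. -/
abbrev GSDual (c : GSType) (d : ℕ) (M N : WeightSeq) : Type :=
  Dual c (stdBasis d) (weight d M) (weight d N)

/-- The dual of `GS₂ c d M M' N N'`. -/
abbrev GSDual₂ (c : GSType) (d : ℕ) (M M' N N' : WeightSeq) : Type :=
  Dual c (stdBasis₂ d) (weight₂ d M M') (weight₂ d N N')

/-! ## Time-frequency representations -/

/-- The four time-frequency representations. -/
inductive TFRKind
  | grossmannRoyer
  | shortTimeFourier
  | crossWigner
  | crossAmbiguity

/-- `e^{2π i s}`. -/
def expi (s : ℝ) : ℂ := Complex.exp (2 * Real.pi * Complex.I * s)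

/-- The time-frequency representations of `f` and `g`, as functions of `z = (x, ω)`:
`R_g f`, `V_g f`, `W(f,g)` and `A(f,g)`. -/
def TFR {d : ℕ} : TFRKind → (Rn d → ℂ) → (Rn d → ℂ) → Rn d × Rn d → ℂ
  | .grossmannRoyer, f, g, z =>
      ∫ t, expi (2 * inner ℝ z.2 (t - z.1)) * f ((2 : ℝ) • z.1 - t) * starRingEnd ℂ (g t)
  | .shortTimeFourier, f, g, z =>
      ∫ t, expi (-inner ℝ z.2 t) * f t * starRingEnd ℂ (g (t - z.1))
  | .crossWigner, f, g, z =>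
      ∫ t, expi (-inner ℝ z.2 t) * f (z.1 + (1 / 2 : ℝ) • t) *
        starRingEnd ℂ (g (z.1 - (1 / 2 : ℝ) • t))
  | .crossAmbiguity, f, g, z =>
      ∫ t, expi (-inner ℝ z.2 t) * f (t + (1 / 2 : ℝ) • z.1) *
        starRingEnd ℂ (g (t - (1 / 2 : ℝ) • z.1))

/-- `T` extends the representation `TFR k` from test functions to ultradistributions. -/
def Extends (c : GSType) (d : ℕ) (M N : WeightSeq) (k : TFRKind)
    (T : GSDual c d M N × GSDual c d M N → GSDual₂ c d M N N M) : Prop :=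
  ∀ f g : GS c d M N, ∃ F : GS₂ c d M N N M,
    (F : Rn d × Rn d → ℂ) = TFR k (f : Rn d → ℂ) (g : Rn d → ℂ) ∧
      T (toDual f, toDual g) = toDual F

end GelfandShilov

end

/-!
# Time-frequency representations on Gelfand-Shilov spaces

*Estimates in terms of words.* A word is a composition of elementary operators `x_i` and `∂_i` in any
order. The conditions on `x^α ∂^β f` that define a Gelfand-Shilov space are equivalent to estimates
for all words, with one parameter `A` instead of two, each operator being of one of two types: those
of the first type are counted by `M` and those of the second by `N` (`WBound`, `mem_space_iff`). To
see this one moves the derivatives to the right. Each contraction of a derivative with its coordinate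
removes one operator of either type and costs a factorial, and `k!` is dominated by `M k * N k` up to
a geometric factor by the nontriviality conditions (`norm_act_nrm_le`, `factorial_le`). Estimates
for words are transported by every operator that intertwines elementary operators with combinations
of elementary operators of the same type (`WBound.transfer`), because (M.2) absorbs boundedly many
additional operators. This applies to linear changes of variables and to the partial Fourier
transform, which interchanges the types in the second variable. Since there is only one parameter, the
Roumieu and the Beurling case are handled together by the quantifier `GSType.Tame`.

*Test functions.* Up to a constant, each of the four representations is the partial Fourier
transform of `f ⊗ conj g` composed with an invertible linear map (`TFR_eq`), so it preserves the
estimates (`TFR_mem`).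

*Functionals.* The representation of a pair of functionals is `f ⊗ conj g` applied to the transpose of
that linear map (`tfrDual`). The tensor product is formed by applying `conj g` in the second
variable, which gives a test function of the first one by Taylor's formula with remainders estimated
in the norms (`pair_mem`). On square integrable functions, in particular on test functions, this
agrees with the integral whenever the latter is a test function (`tfrDual_l2Dual`). Joint
continuity holds because each continuous seminorm of the representation is dominated by a product of
continuous seminorms of `f` and `g` (`exists_seminorm_mul_le`). Uniqueness holds because test
functions are dense in the dual (`exists_tendsto_toDual`): the operators
`φ ↦ ∫ Γ(ε x, s) φ(x - ε s) ds`, with `Γ` a Gaussian on `ℝ^{2d}`, converge to the identity at the rate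
`ε` in the scale of norms, and a functional composed with such an operator is given by a test
function, as functionals commute with integrals over a parameter (`Dual.ev_marg`).

*The converse.* If the representation of `f` and `g` is a test function, Fourier inversion shows that
`f ⊗ conj g` is given by a test function (`exists_tensor_eq`). Applying it to `φ ⊗ ψ` with one of the
factors fixed recovers multiples of `f` and `conj g`, and these are nonzero multiples for a suitable
choice of the fixed factor (`exists_eq_toDual`). For square integrable functions the same argument
applies to the functionals they define, since test functions separate square integrable functions:
modulated Gaussians are test functions and the Fourier transform is injective
(`ae_eq_zero_of_forall_mem`).
-/

noncomputable section

set_option linter.unusedSectionVars false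
set_option linter.unnecessarySeqFocus false

namespace GelfandShilov

/-! ### Weight sequences -/

namespace WeightSeq

variable (M N : WeightSeq)

lemma one_le (p : ℕ) : 1 ≤ M.M p := by
  rw [← M.zero]; exact M.mono (Nat.zero_le p)

lemma ratio_mono : Monotone fun p => M.M (p + 1) / M.M p := by
  refine monotone_nat_of_le_succ fun p => ?_
  rw [div_le_div_iff₀ (M.pos _) (M.pos _)]
  have := M.M1 p
  nlinarith

/-- Logarithmic convexity and `M 0 = 1` make `M` supermultiplicative. -/
lemma mul_le_add (p q : ℕ) : M.M p * M.M q ≤ M.M (p + q) := by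
  induction p with
  | zero => simp [M.zero]
  | succ p ih =>
    have h1 : M.M (p + 1) = M.M p * (M.M (p + 1) / M.M p) := by
      field_simp [(M.pos p).ne']
    have h2 : M.M (p + 1 + q) = M.M (p + q) * (M.M (p + q + 1) / M.M (p + q)) := by
      rw [show p + 1 + q = p + q + 1 by ring]
      field_simp [(M.pos (p + q)).ne']
    have h3 := M.ratio_mono (Nat.le_add_right p q)
    rw [h1, h2]
    have h4 : 0 < M.M (p + 1) / M.M p := div_pos (M.pos _) (M.pos _)
    calc M.M p * (M.M (p + 1) / M.M p) * M.M q
        = M.M p * M.M q * (M.M (p + 1) / M.M p) := by ring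
      _ ≤ M.M (p + q) * (M.M (p + q + 1) / M.M (p + q)) :=
        mul_le_mul ih h3 h4.le (M.pos _).le

/-- (M.2) with constants at least `1`. -/
lemma exists_add_le : ∃ K H : ℝ, 1 ≤ K ∧ 1 ≤ H ∧
    ∀ p q, M.M (p + q) ≤ K * H ^ (p + q) * (M.M p * M.M q) := by
  obtain ⟨A, H, hA, hH, h⟩ := M.M2
  refine ⟨max 1 A, max 1 H, le_max_left _ _, le_max_left _ _, fun p q => (h p q).trans ?_⟩
  have := mul_pos (M.pos p) (M.pos q)
  have h1 : A ≤ max 1 A := le_max_right _ _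
  have h2 : H ≤ max 1 H := le_max_right _ _
  gcongr

end WeightSeq

/-- The quantifier structure of continuity between two scales of normed spaces indexed by one
parameter: "for all `A` there is `A'`" for inductive limits (Roumieu) and "for all `A'` there is
`A`" for projective limits (Beurling), `A` being the parameter of the source. -/
def GSType.Tame : GSType → (ℝ → ℝ → Prop) → Prop
  | .roumieu, R => ∀ A : ℝ, 0 < A → ∃ A' : ℝ, 0 < A' ∧ R A A'
  | .beurling, R => ∀ A' : ℝ, 0 < A' → ∃ A : ℝ, 0 < A ∧ R A A'

/-- One-parameter version of `GSType.quant`. -/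
def GSType.quant₁ : GSType → (ℝ → Prop) → Prop
  | .roumieu, P => ∃ A : ℝ, 0 < A ∧ P A
  | .beurling, P => ∀ A : ℝ, 0 < A → P A

/-- One-parameter version of `GSType.coquant`. -/
def GSType.coquant₁ : GSType → (ℝ → Prop) → Prop
  | .roumieu, P => ∀ A : ℝ, 0 < A → P A
  | .beurling, P => ∃ A : ℝ, 0 < A ∧ P A

namespace GSType

variable {c : GSType}

lemma tame_of_linear {R : ℝ → ℝ → Prop} {κ : ℝ} (hκ : 0 < κ) (h : ∀ A, 0 < A → R A (κ * A)) :
    c.Tame R := by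
  cases c
  · exact fun A hA => ⟨κ * A, by positivity, h A hA⟩
  · refine fun A' hA' => ⟨A' / κ, by positivity, ?_⟩
    have := h (A' / κ) (by positivity)
    rwa [mul_div_cancel₀ _ hκ.ne'] at this

lemma Tame.quant₁ {R : ℝ → ℝ → Prop} (hR : c.Tame R) {P Q : ℝ → Prop} (hP : c.quant₁ P)
    (h : ∀ A A', 0 < A → 0 < A' → R A A' → P A → Q A') : c.quant₁ Q := by
  cases c
  · obtain ⟨A, hA, hP⟩ := hP
    obtain ⟨A', hA', h1⟩ := hR A hA
    exact ⟨A', hA', h _ _ hA hA' h1 hP⟩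
  · intro A' hA'
    obtain ⟨A, hA, h1⟩ := hR A' hA'
    exact h _ _ hA hA' h1 (hP A hA)

lemma Tame.coquant₁ {R : ℝ → ℝ → Prop} (hR : c.Tame R) {P Q : ℝ → Prop} (hP : c.coquant₁ P)
    (h : ∀ A A', 0 < A → 0 < A' → R A A' → P A' → Q A) : c.coquant₁ Q := by
  cases c
  · intro A hA
    obtain ⟨A', hA', h1⟩ := hR A hA
    exact h _ _ hA hA' h1 (hP A' hA')
  · obtain ⟨A', hA', hP⟩ := hP
    obtain ⟨A, hA, h1⟩ := hR A' hA'
    exact ⟨A, hA, h _ _ hA hA' h1 hP⟩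

lemma quant₁.and_coquant₁ {P Q : ℝ → Prop} (hP : c.quant₁ P) (hQ : c.coquant₁ Q) :
    ∃ A, 0 < A ∧ P A ∧ Q A := by
  cases c
  · obtain ⟨A, hA, hP⟩ := hP
    exact ⟨A, hA, hP, hQ A hA⟩
  · obtain ⟨A, hA, hQ⟩ := hQ
    exact ⟨A, hA, hP A hA, hQ⟩

lemma quant₁.and {P Q : ℝ → Prop} (hP : c.quant₁ P) (hQ : c.quant₁ Q)
    (hPm : ∀ A A', 0 < A → A ≤ A' → P A → P A') (hQm : ∀ A A', 0 < A → A ≤ A' → Q A → Q A') :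
    c.quant₁ fun A => P A ∧ Q A := by
  cases c
  · obtain ⟨A, hA, hP⟩ := hP
    obtain ⟨B, hB, hQ⟩ := hQ
    exact ⟨max A B, lt_max_of_lt_left hA, hPm _ _ hA (le_max_left _ _) hP,
      hQm _ _ hB (le_max_right _ _) hQ⟩
  · exact fun A hA => ⟨hP A hA, hQ A hA⟩

lemma coquant₁.and {P Q : ℝ → Prop} (hP : c.coquant₁ P) (hQ : c.coquant₁ Q)
    (hPm : ∀ A A', 0 < A → A ≤ A' → P A' → P A) (hQm : ∀ A A', 0 < A → A ≤ A' → Q A' → Q A) :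
    c.coquant₁ fun A => P A ∧ Q A := by
  cases c
  · exact fun A hA => ⟨hP A hA, hQ A hA⟩
  · obtain ⟨A, hA, hP⟩ := hP
    obtain ⟨B, hB, hQ⟩ := hQ
    exact ⟨min A B, lt_min hA hB, hPm _ _ (lt_min hA hB) (min_le_left _ _) hP,
      hQm _ _ (lt_min hA hB) (min_le_right _ _) hQ⟩

lemma quant₁.imp {P Q : ℝ → Prop} (hP : c.quant₁ P) (h : ∀ A, 0 < A → P A → Q A) :
    c.quant₁ Q := by
  cases c
  · obtain ⟨A, hA, hP⟩ := hP
    exact ⟨A, hA, h A hA hP⟩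
  · exact fun A hA => h A hA (hP A hA)

lemma coquant₁.imp {P Q : ℝ → Prop} (hP : c.coquant₁ P) (h : ∀ A, 0 < A → P A → Q A) :
    c.coquant₁ Q := by
  cases c
  · exact fun A hA => h A hA (hP A hA)
  · obtain ⟨A, hA, hP⟩ := hP
    exact ⟨A, hA, h A hA hP⟩

lemma quant_iff_quant₁ {P : ℝ → ℝ → Prop}
    (hP : ∀ A A' B B', 0 < A → 0 < B → A ≤ A' → B ≤ B' → P A B → P A' B') :
    c.quant P ↔ c.quant₁ fun A => P A A := by
  cases c
  · constructor
    · rintro ⟨A, hA, B, hB, h⟩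
      exact ⟨max A B, lt_max_of_lt_left hA, hP _ _ _ _ hA hB (le_max_left _ _) (le_max_right _ _) h⟩
    · rintro ⟨A, hA, h⟩
      exact ⟨A, hA, A, hA, h⟩
  · constructor
    · exact fun h A hA => h A hA A hA
    · exact fun h A hA B hB => hP _ _ _ _ (lt_min hA hB) (lt_min hA hB) (min_le_left _ _)
        (min_le_right _ _) (h (min A B) (lt_min hA hB))

lemma coquant_iff_coquant₁ {P : ℝ → ℝ → Prop}
    (hP : ∀ A A' B B', 0 < A → 0 < B → A ≤ A' → B ≤ B' → P A' B' → P A B) :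
    c.coquant P ↔ c.coquant₁ fun A => P A A := by
  cases c
  · constructor
    · exact fun h A hA => h A hA A hA
    · exact fun h A hA B hB => hP _ _ _ _ hA hB (le_max_left _ _) (le_max_right _ _)
        (h (max A B) (lt_max_of_lt_left hA))
  · constructor
    · rintro ⟨A, hA, B, hB, h⟩
      exact ⟨min A B, lt_min hA hB, hP _ _ _ _ (lt_min hA hB) (lt_min hA hB) (min_le_left _ _)
        (min_le_right _ _) h⟩
    · rintro ⟨A, hA, h⟩
      exact ⟨A, hA, A, hA, h⟩

end GSType

/-- In the presence of the nontriviality conditions `k!` is dominated by `M k * N k` up to a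
geometric factor `h ^ k`, with `h` as small as desired in the Beurling case. -/
lemma factorial_le {c : GSType} {M N : WeightSeq} (hM : M.Nontrivial c) (hN : N.Nontrivial c) :
    c.quant₁ fun h => ∃ D, 0 < D ∧ ∀ k : ℕ, (k.factorial : ℝ) ≤ D * h ^ k * (M.M k * N.M k) := by
  have key : ∀ A H B L : ℝ, 0 < A → 0 < H → 0 < B → 0 < L →
      (∀ p : ℕ, √(p.factorial : ℝ) ≤ A * H ^ p * M.M p) →
      (∀ p : ℕ, √(p.factorial : ℝ) ≤ B * L ^ p * N.M p) →
      ∀ k : ℕ, (k.factorial : ℝ) ≤ A * B * (H * L) ^ k * (M.M k * N.M k) := by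
    intro A H B L hA hH hB hL h1 h2 k
    have hk : (k.factorial : ℝ) = √(k.factorial : ℝ) * √(k.factorial : ℝ) :=
      (Real.mul_self_sqrt (by positivity)).symm
    rw [hk]
    have := M.pos k
    refine (mul_le_mul (h1 k) (h2 k) (Real.sqrt_nonneg _) (by positivity)).trans (le_of_eq ?_)
    rw [mul_pow]; ring
  cases c
  · obtain ⟨A, H, hA, hH, h1⟩ := hM
    obtain ⟨B, L, hB, hL, h2⟩ := hN
    exact ⟨H * L, by positivity, A * B, by positivity, key A H B L hA hH hB hL h1 h2⟩
  · intro h hh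
    obtain ⟨A, hA, h1⟩ := hM (√h) (by positivity)
    obtain ⟨B, hB, h2⟩ := hN (√h) (by positivity)
    refine ⟨A * B, by positivity, ?_⟩
    have := key A (√h) B (√h) hA (by positivity) hB (by positivity) h1 h2
    rwa [Real.mul_self_sqrt hh.le] at this

/-- The weight `A^(p+q) M_p N_q` of a product of `p` operators of the first type and `q` operators
of the second type. -/
def wtc (M N : WeightSeq) (A : ℝ) (p q : ℕ) : ℝ := A ^ (p + q) * (M.M p * N.M q)

section wtc

variable {M N : WeightSeq} {A A' : ℝ}

lemma wtc_pos (hA : 0 < A) (p q : ℕ) : 0 < wtc M N A p q := by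
  have := M.pos p
  have := N.pos q
  unfold wtc; positivity

lemma wtc_zero : wtc M N A 0 0 = 1 := by simp [wtc, M.zero, N.zero]

lemma wtc_mono (hA : 0 < A) (h : A ≤ A') (p q : ℕ) : wtc M N A p q ≤ wtc M N A' p q := by
  have := mul_pos (M.pos p) (N.pos q)
  unfold wtc; gcongr

lemma wtc_smul (κ : ℝ) (p q : ℕ) : wtc M N (κ * A) p q = κ ^ (p + q) * wtc M N A p q := by
  unfold wtc; rw [mul_pow]; ring

lemma wtc_mul_le (hA : 0 < A) (p q p' q' : ℕ) :
    wtc M N A p q * wtc M N A p' q' ≤ wtc M N A (p + p') (q + q') := by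
  have h1 := M.mul_le_add p p'
  have h2 := N.mul_le_add q q'
  have h3 := M.pos (p + p')
  have h4 := mul_pos (N.pos q) (N.pos q')
  calc wtc M N A p q * wtc M N A p' q'
      = A ^ (p + p' + (q + q')) * ((M.M p * M.M p') * (N.M q * N.M q')) := by
        unfold wtc; rw [show p + p' + (q + q') = (p + q) + (p' + q') by ring, pow_add]; ring
    _ ≤ _ := by unfold wtc; gcongr

variable (M N)

/-- (M.2) bounds the weight of a composite by the product of the weights. -/
lemma exists_wtc_add_le : ∃ K κ : ℝ, 1 ≤ K ∧ 1 ≤ κ ∧ ∀ A, 0 < A → ∀ p q p' q',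
    wtc M N A (p + p') (q + q') ≤ K * (wtc M N (κ * A) p q * wtc M N (κ * A) p' q') := by
  obtain ⟨K, H, hK, hH, h1⟩ := M.exists_add_le
  obtain ⟨L, J, hL, hJ, h2⟩ := N.exists_add_le
  refine ⟨K * L, H * J, one_le_mul_of_one_le_of_one_le hK hL,
    one_le_mul_of_one_le_of_one_le hH hJ, fun A hA p q p' q' => ?_⟩
  have e1 := M.pos p
  have e2 := M.pos p'
  have e3 := N.pos q
  have e4 := N.pos q'
  have e5 := N.pos (q + q')
  have h3 : H ^ (p + p') ≤ H ^ (p + p' + (q + q')) := pow_le_pow_right₀ hH (by omega)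
  have h4 : J ^ (q + q') ≤ J ^ (p + p' + (q + q')) := pow_le_pow_right₀ hJ (by omega)
  calc wtc M N A (p + p') (q + q')
      ≤ A ^ (p + p' + (q + q')) * ((K * H ^ (p + p' + (q + q')) * (M.M p * M.M p')) *
          (L * J ^ (p + p' + (q + q')) * (N.M q * N.M q'))) := by
        unfold wtc
        refine mul_le_mul_of_nonneg_left (mul_le_mul ((h1 p p').trans ?_) ((h2 q q').trans ?_)
          e5.le (by positivity)) (by positivity)
        · gcongr
        · gcongr
    _ = _ := by
        unfold wtc
        rw [show p + p' + (q + q') = (p + q) + (p' + q') by ring]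
        simp only [mul_pow, pow_add]; ring

/-- A bounded number of additional operators only costs a change of the parameter. -/
lemma exists_wtc_add_le_of_le : ∃ κ : ℝ, 1 ≤ κ ∧ ∀ A, 0 < A → ∀ n : ℕ, ∃ K : ℝ, 1 ≤ K ∧
    ∀ p q p' q', p + q ≤ n → wtc M N A (p + p') (q + q') ≤ K * wtc M N (κ * A) p' q' := by
  obtain ⟨K, κ, hK, hκ, h⟩ := exists_wtc_add_le M N
  refine ⟨κ, hκ, fun A hA n => ?_⟩
  have hB : 0 < κ * A := by positivity
  refine ⟨K * ((max 1 (κ * A)) ^ n * (M.M n * N.M n)), ?_, fun p q p' q' hpq => ?_⟩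
  · exact one_le_mul_of_one_le_of_one_le hK (one_le_mul_of_one_le_of_one_le
      (one_le_pow₀ (le_max_left _ _)) (one_le_mul_of_one_le_of_one_le (M.one_le n) (N.one_le n)))
  · refine (h A hA p q p' q').trans ?_
    rw [mul_assoc K]
    refine mul_le_mul_of_nonneg_left (mul_le_mul_of_nonneg_right ?_ (wtc_pos hB _ _).le)
      (by positivity)
    unfold wtc
    have h1 : (κ * A) ^ (p + q) ≤ max 1 (κ * A) ^ n :=
      (pow_le_pow_left₀ hB.le (le_max_right _ _) _).trans (pow_le_pow_right₀ (le_max_left _ _) hpq)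
    have h2 := M.mono (show p ≤ n by omega)
    have h3 := N.mono (show q ≤ n by omega)
    have e1 := M.pos p
    have e2 := N.pos q
    have e3 := M.pos n
    gcongr

end wtc

/-! ### Words in the coordinate and derivative operators -/

section Words

variable {ι : Type} [Fintype ι] {E : Type} [NormedAddCommGroup E] [NormedSpace ℝ E]

/-- The elementary operators: `Sum.inl i` is multiplication by the coordinate `x_i` and
`Sum.inr i` is the derivative in the direction `b i`. -/
def op (b : Module.Basis ι ℝ E) : ι ⊕ ι → (E → ℂ) → E → ℂ
  | .inl i, f => fun x => (b.repr x i : ℂ) * f x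
  | .inr i, f => dirDeriv (b i) f

/-- The composition of elementary operators given by a word; the last letter acts first. -/
def act (b : Module.Basis ι ℝ E) (l : List (ι ⊕ ι)) (f : E → ℂ) : E → ℂ :=
  l.foldr (op b) f

variable {b : Module.Basis ι ℝ E}

@[simp] lemma act_nil (f : E → ℂ) : act b [] f = f := rfl

@[simp] lemma act_cons (s : ι ⊕ ι) (l : List (ι ⊕ ι)) (f : E → ℂ) :
    act b (s :: l) f = op b s (act b l f) := rfl

lemma act_append (l m : List (ι ⊕ ι)) (f : E → ℂ) : act b (l ++ m) f = act b l (act b m f) := by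
  simp [act, List.foldr_append]

variable (b) in
/-- The coordinate functional of a basis as a continuous linear map. -/
def coordL (i : ι) : E →L[ℝ] ℝ :=
  haveI := Module.Finite.of_basis b
  (b.coord i).toContinuousLinearMap

@[simp] lemma coordL_apply (i : ι) (x : E) : coordL b i x = b.repr x i := rfl

lemma contDiff_coord (i : ι) : ContDiff ℝ ∞ fun x => ((b.repr x i : ℝ) : ℂ) :=
  Complex.ofRealCLM.contDiff.comp (coordL b i).contDiff

lemma contDiff_op (s : ι ⊕ ι) {f : E → ℂ} (hf : ContDiff ℝ ∞ f) : ContDiff ℝ ∞ (op b s f) := by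
  cases s with
  | inl i => exact (contDiff_coord i).mul hf
  | inr i => exact contDiff_dirDeriv _ hf

lemma contDiff_act (l : List (ι ⊕ ι)) {f : E → ℂ} (hf : ContDiff ℝ ∞ f) :
    ContDiff ℝ ∞ (act b l f) := by
  induction l with
  | nil => exact hf
  | cons s l ih => exact contDiff_op s ih

lemma op_add (s : ι ⊕ ι) {f g : E → ℂ} (hf : ContDiff ℝ ∞ f) (hg : ContDiff ℝ ∞ g) :
    op b s (f + g) = op b s f + op b s g := by
  funext x
  cases s with
  | inl i => simp [op, mul_add]
  | inr i =>
    simp only [op, dirDeriv, Pi.add_apply]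
    rw [fderiv_add (hf.differentiable (by simp) x) (hg.differentiable (by simp) x)]
    rfl

lemma op_smul (s : ι ⊕ ι) (a : ℂ) {f : E → ℂ} (hf : ContDiff ℝ ∞ f) :
    op b s (a • f) = a • op b s f := by
  funext x
  cases s with
  | inl i => simp only [op, Pi.smul_apply, smul_eq_mul]; ring
  | inr i =>
    simp only [op, dirDeriv, Pi.smul_apply]
    rw [fderiv_const_smul (hf.differentiable (by simp) x)]
    rfl

lemma act_add (l : List (ι ⊕ ι)) {f g : E → ℂ} (hf : ContDiff ℝ ∞ f) (hg : ContDiff ℝ ∞ g) :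
    act b l (f + g) = act b l f + act b l g := by
  induction l with
  | nil => rfl
  | cons s l ih => simp only [act_cons, ih, op_add s (contDiff_act l hf) (contDiff_act l hg)]

lemma act_smul (l : List (ι ⊕ ι)) (a : ℂ) {f : E → ℂ} (hf : ContDiff ℝ ∞ f) :
    act b l (a • f) = a • act b l f := by
  induction l with
  | nil => rfl
  | cons s l ih => simp only [act_cons, ih, op_smul s a (contDiff_act l hf)]

lemma contDiff_sum' {κ : Type*} (s : Finset κ) {f : κ → E → ℂ} (hf : ∀ k ∈ s, ContDiff ℝ ∞ (f k)) :
    ContDiff ℝ ∞ (∑ k ∈ s, f k) := by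
  have := ContDiff.sum (𝕜 := ℝ) (n := ∞) (f := f) (s := s) hf
  convert this using 1
  funext x; simp

lemma act_zero (l : List (ι ⊕ ι)) : act b l (0 : E → ℂ) = 0 := by
  simpa using act_smul (b := b) l 0 (f := (0 : E → ℂ)) contDiff_const

lemma act_sum {κ : Type*} (l : List (ι ⊕ ι)) (s : Finset κ) {f : κ → E → ℂ}
    (hf : ∀ k ∈ s, ContDiff ℝ ∞ (f k)) : act b l (∑ k ∈ s, f k) = ∑ k ∈ s, act b l (f k) := by
  classical
  induction s using Finset.induction_on with
  | empty => simpa using act_zero l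
  | insert k s hk ih =>
    rw [Finset.sum_insert hk, Finset.sum_insert hk, act_add l (hf k (by simp))
      (contDiff_sum' s fun j hj => hf j (by simp [hj])), ih fun j hj => hf j (by simp [hj])]

lemma contDiff_smul' (a : ℂ) {f : E → ℂ} (hf : ContDiff ℝ ∞ f) : ContDiff ℝ ∞ (a • f) :=
  contDiff_const.smul hf

lemma act_sub (l : List (ι ⊕ ι)) {f g : E → ℂ} (hf : ContDiff ℝ ∞ f) (hg : ContDiff ℝ ∞ g) :
    act b l (f - g) = act b l f - act b l g := by
  have h1 : f - g = f + (-1 : ℂ) • g := by funext x; simp [sub_eq_add_neg]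
  rw [h1, act_add l hf (contDiff_smul' _ hg), act_smul l _ hg]
  funext x; simp [sub_eq_add_neg]

/-- The derivative of a function in terms of its partial derivatives. -/
lemma fderiv_eq_sum (f : E → ℂ) (x v : E) :
    fderiv ℝ f x v = ∑ i, (b.repr v i : ℂ) * op b (.inr i) f x := by
  conv_lhs => rw [← b.sum_repr v]
  rw [map_sum]
  refine Finset.sum_congr rfl fun i _ => ?_
  rw [map_smul]
  simp [op, dirDeriv]

lemma dirDeriv_of_hasFDerivAt {f : E → ℂ} {f' : E →L[ℝ] ℂ} {x : E} (h : HasFDerivAt f f' x)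
    (v : E) : dirDeriv v f x = f' v := by
  rw [dirDeriv, h.fderiv]

/-- The continuous linear map with prescribed values on the basis vectors. -/
def ofPartials (b : Module.Basis ι ℝ E) (c : ι → ℂ) : E →L[ℝ] ℂ :=
  ∑ i, (coordL b i).smulRight (c i)

lemma ofPartials_apply (c : ι → ℂ) (v : E) :
    ofPartials b c v = ∑ i, (b.repr v i : ℂ) * c i := by
  simp [ofPartials]

lemma ofPartials_basis [DecidableEq ι] (c : ι → ℂ) (i : ι) : ofPartials b c (b i) = c i := by
  rw [ofPartials_apply, Finset.sum_eq_single i]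
  · simp
  · intro j _ hj; simp [Finsupp.single_eq_of_ne hj]
  · simp

lemma fderiv_eq_ofPartials (f : E → ℂ) (x : E) :
    fderiv ℝ f x = ofPartials b fun i => op b (.inr i) f x := by
  ext v; rw [fderiv_eq_sum (b := b), ofPartials_apply]

/-- A family of functions that is closed under partial derivatives consists of smooth
functions. -/
lemma contDiff_of_closed (S : Set (E → ℂ))
    (h : ∀ f ∈ S, ∃ g : ι → E → ℂ, (∀ i, g i ∈ S) ∧
      ∀ x, HasFDerivAt f (ofPartials b fun i => g i x) x) {f : E → ℂ} (hf : f ∈ S) :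
    ContDiff ℝ ∞ f := by
  suffices H : ∀ n : ℕ, ∀ f ∈ S, ContDiff ℝ n f from contDiff_infty.2 fun n => H n f hf
  intro n
  induction n with
  | zero =>
    intro f hf
    obtain ⟨g, -, hg⟩ := h f hf
    exact contDiff_zero.2 (continuous_iff_continuousAt.2 fun x => (hg x).continuousAt)
  | succ n ih =>
    intro f hf
    obtain ⟨g, hgS, hg⟩ := h f hf
    push_cast
    rw [contDiff_succ_iff_fderiv]
    refine ⟨fun x => (hg x).differentiableAt, by simp, ?_⟩
    have : fderiv ℝ f = fun x => ∑ i, (coordL b i).smulRight (g i x) := by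
      funext x; rw [(hg x).fderiv]; rfl
    rw [this]
    refine ContDiff.sum fun i _ => ?_
    exact ((ContinuousLinearMap.smulRightL ℝ E ℂ (coordL b i)).contDiff).comp (ih _ (hgS i))

/-- The operators of a word that have type `true`. -/
def nT (τ : ι ⊕ ι → Bool) (l : List (ι ⊕ ι)) : ℕ := l.countP τ

/-- The operators of a word that have type `false`. -/
def nF (τ : ι ⊕ ι → Bool) (l : List (ι ⊕ ι)) : ℕ := l.countP fun s => !τ s

section counts
variable (τ : ι ⊕ ι → Bool) (l m : List (ι ⊕ ι)) (s : ι ⊕ ι)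

@[simp] lemma nT_nil : nT τ [] = 0 := rfl
@[simp] lemma nF_nil : nF τ [] = 0 := rfl
@[simp] lemma nT_append : nT τ (l ++ m) = nT τ l + nT τ m := List.countP_append
@[simp] lemma nF_append : nF τ (l ++ m) = nF τ l + nF τ m := List.countP_append
lemma nT_cons : nT τ (s :: l) = nT τ l + if τ s then 1 else 0 := List.countP_cons
lemma nF_cons : nF τ (s :: l) = nF τ l + if τ s then 0 else 1 := by
  rw [nF, List.countP_cons]; cases τ s <;> rfl
lemma nT_add_nF : nT τ l + nF τ l = l.length := by
  induction l with
  | nil => rfl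
  | cons s l ih => rw [nT_cons, nF_cons, List.length_cons, ← ih]; cases τ s <;> simp <;> omega

end counts

/-- All words in the coordinate and derivative operators satisfy the Gelfand-Shilov estimate, the
operators of type `true` (as prescribed by `τ`) being counted by `M` and those of type `false`
by `N`. In contrast to `Bound` the operators may come in any order, and there is a single
parameter `A`. -/
def WBound (b : Module.Basis ι ℝ E) (τ : ι ⊕ ι → Bool) (M N : WeightSeq) (A C : ℝ)
    (f : E → ℂ) : Prop :=
  ContDiff ℝ ∞ f ∧ ∀ l x, ‖act b l f x‖ ≤ C * wtc M N A (nT τ l) (nF τ l)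

/-- Smooth functions all of whose images under words are bounded; these are the Schwartz
functions. -/
def Rapid (b : Module.Basis ι ℝ E) (f : E → ℂ) : Prop :=
  ContDiff ℝ ∞ f ∧ ∀ l, ∃ C, ∀ x, ‖act b l f x‖ ≤ C

lemma Rapid.act {f : E → ℂ} (hf : Rapid b f) (l : List (ι ⊕ ι)) : Rapid b (act b l f) :=
  ⟨contDiff_act l hf.1, fun m => by simpa [act_append] using hf.2 (m ++ l)⟩

lemma Rapid.op {f : E → ℂ} (hf : Rapid b f) (s : ι ⊕ ι) : Rapid b (op b s f) := hf.act [s]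

lemma Rapid.smul (a : ℂ) {f : E → ℂ} (hf : Rapid b f) : Rapid b (a • f) := by
  refine ⟨contDiff_const.smul hf.1, fun l => ?_⟩
  obtain ⟨C, hC⟩ := hf.2 l
  exact ⟨‖a‖ * C, fun x => by
    rw [act_smul l a hf.1, Pi.smul_apply, norm_smul]
    exact mul_le_mul_of_nonneg_left (hC x) (norm_nonneg a)⟩

/-- Finitely many words have a common bound. -/
lemma Rapid.exists_bound {f : E → ℂ} (hf : Rapid b f) (n : ℕ) :
    ∃ R, 0 ≤ R ∧ ∀ m : List (ι ⊕ ι), m.length ≤ n → ∀ x, ‖GelfandShilov.act b m f x‖ ≤ R := by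
  choose C hC using hf.2
  have hfin : {m : List (ι ⊕ ι) | m.length ≤ n}.Finite := List.finite_length_le _ n
  refine ⟨∑ m ∈ hfin.toFinset, |C m|, Finset.sum_nonneg fun _ _ => abs_nonneg _, fun m hm x => ?_⟩
  refine ((hC m x).trans (le_abs_self _)).trans ?_
  exact Finset.single_le_sum (f := fun m => |C m|) (fun _ _ => abs_nonneg _) (by simpa using hm)

variable {τ : ι ⊕ ι → Bool} {M N : WeightSeq} {A A' C D : ℝ} {f g : E → ℂ}

lemma WBound.rapid (hf : WBound b τ M N A C f) : Rapid b f :=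
  ⟨hf.1, fun l => ⟨_, hf.2 l⟩⟩

lemma WBound.nonneg (hf : WBound b τ M N A C f) : 0 ≤ C := by
  simpa [wtc_zero] using (norm_nonneg _).trans (hf.2 [] 0)

lemma WBound.mono (hA : 0 < A) (hAA : A ≤ A') (hf : WBound b τ M N A C f) :
    WBound b τ M N A' C f :=
  ⟨hf.1, fun l x => (hf.2 l x).trans (mul_le_mul_of_nonneg_left (wtc_mono hA hAA _ _) hf.nonneg)⟩

lemma WBound.add (hf : WBound b τ M N A C f) (hg : WBound b τ M N A D g) :
    WBound b τ M N A (C + D) (f + g) := by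
  refine ⟨hf.1.add hg.1, fun l x => ?_⟩
  rw [act_add l hf.1 hg.1, add_mul]
  exact (norm_add_le _ _).trans (add_le_add (hf.2 l x) (hg.2 l x))

lemma WBound.smul (a : ℂ) (hf : WBound b τ M N A C f) :
    WBound b τ M N A (‖a‖ * C) (a • f) := by
  refine ⟨contDiff_const.smul hf.1, fun l x => ?_⟩
  rw [act_smul l a hf.1, Pi.smul_apply, norm_smul, mul_assoc]
  exact mul_le_mul_of_nonneg_left (hf.2 l x) (norm_nonneg a)

/-- A word applied to a function with Gelfand-Shilov estimates, after at most `n` further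
operators. -/
lemma WBound.act_act_le {K κ : ℝ} {n : ℕ}
    (hK : ∀ p q p' q', p + q ≤ n → wtc M N A (p + p') (q + q') ≤ K * wtc M N (κ * A) p' q')
    (hf : WBound b τ M N A C f) (m l : List (ι ⊕ ι)) (hm : m.length ≤ n) (x : E) :
    ‖act b m (act b l f) x‖ ≤ C * K * wtc M N (κ * A) (nT τ l) (nF τ l) := by
  rw [← act_append, mul_assoc]
  refine (hf.2 (m ++ l) x).trans (mul_le_mul_of_nonneg_left ?_ hf.nonneg)
  rw [nT_append, nF_append]
  exact hK _ _ _ _ (by rwa [nT_add_nF])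

lemma norm_sum_smul_le {κ : Type*} (s : Finset κ) (k : κ → ℂ) (F : κ → E → ℂ) (x : E) {R L : ℝ}
    (hR : 0 ≤ R) (hF : ∀ j ∈ s, k j ≠ 0 → ‖F j x‖ ≤ R) (hL : ∑ j ∈ s, ‖k j‖ ≤ L) :
    ‖(∑ j ∈ s, k j • F j) x‖ ≤ L * R := by
  rw [Finset.sum_apply]
  refine (norm_sum_le _ _).trans (le_trans ?_ (mul_le_mul_of_nonneg_right hL hR))
  rw [Finset.sum_mul]
  refine Finset.sum_le_sum fun j hj => ?_
  rw [Pi.smul_apply, norm_smul]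
  by_cases h : k j = 0
  · simp [h]
  · exact mul_le_mul_of_nonneg_left (hF j hj h) (norm_nonneg _)

end Words

section Transfer

variable {ι ι' ι₂ : Type} [Fintype ι] [Fintype ι'] [Fintype ι₂]
  {E E' E₂ : Type} [NormedAddCommGroup E] [NormedSpace ℝ E]
  [NormedAddCommGroup E'] [NormedSpace ℝ E'] [NormedAddCommGroup E₂] [NormedSpace ℝ E₂]
  {b : Module.Basis ι ℝ E} {b' : Module.Basis ι' ℝ E'} {b₂ : Module.Basis ι₂ ℝ E₂}

/-- Operators that intertwine elementary operators with combinations of elementary operators of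
the same type preserve the Gelfand-Shilov estimates. This covers linear changes of variables and
the partial Fourier transform. -/
theorem WBound.transfer {τ : ι ⊕ ι → Bool} {τ' : ι' ⊕ ι' → Bool} (M N : WeightSeq)
    (U : (E → ℂ) → E' → ℂ) (k : ι' ⊕ ι' → ι ⊕ ι → ℂ) (n : ℕ) (c₀ : ℝ)
    (hk : ∀ P Q, k P Q ≠ 0 → τ Q = τ' P)
    (hsmooth : ∀ f, Rapid b f → ContDiff ℝ ∞ (U f))
    (hop : ∀ f, Rapid b f → ∀ P, op b' P (U f) = ∑ Q, k P Q • U (op b Q f))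
    (hsup : ∀ f, Rapid b f → ∀ R, (∀ m : List (ι ⊕ ι), m.length ≤ n → ∀ x, ‖act b m f x‖ ≤ R) →
      ∀ y, ‖U f y‖ ≤ c₀ * R) :
    ∃ κ : ℝ, 0 < κ ∧ ∀ A, 0 < A → ∃ K : ℝ, 0 ≤ K ∧ ∀ C f, WBound b τ M N A C f →
      WBound b' τ' M N (κ * A) (K * C) (U f) := by
  obtain ⟨κ₁, hκ₁, hκ⟩ := exists_wtc_add_le_of_le M N
  set L : ℝ := 1 + ∑ P, ∑ Q, ‖k P Q‖ with hL
  have hL1 : 1 ≤ L := by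
    have : 0 ≤ ∑ P, ∑ Q, ‖k P Q‖ := by positivity
    linarith
  have hLP : ∀ P, ∑ Q, ‖k P Q‖ ≤ L := fun P => by
    have := Finset.single_le_sum (f := fun P => ∑ Q, ‖k P Q‖) (fun _ _ => by positivity)
      (Finset.mem_univ P)
    linarith [(this : ∑ Q, ‖k P Q‖ ≤ _)]
  refine ⟨L * κ₁, by positivity, fun A hA => ?_⟩
  obtain ⟨K, hK1, hK⟩ := hκ A hA n
  refine ⟨|c₀| * K, by positivity, fun C f hf => ⟨hsmooth f hf.rapid, ?_⟩⟩
  have hC := hf.nonneg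
  have main : ∀ l m, ∀ y, ‖act b' l (U (act b m f)) y‖ ≤ L ^ l.length *
      (|c₀| * (C * K) * wtc M N (κ₁ * A) (nT τ' l + nT τ m) (nF τ' l + nF τ m)) := by
    intro l
    induction l using List.reverseRecOn with
    | nil =>
      intro m y
      have h1 := hsup (act b m f) (hf.rapid.act m) _ (hf.act_act_le hK · m) y
      have h0 : 0 ≤ C * K * wtc M N (κ₁ * A) (nT τ m) (nF τ m) :=
        mul_nonneg (by positivity) (wtc_pos (by positivity) _ _).le
      have h2 := mul_le_mul_of_nonneg_right (le_abs_self c₀) h0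
      simp only [act_nil, List.length_nil, pow_zero, nT_nil, nF_nil, zero_add, one_mul]
      linarith
    | append_singleton l P ih =>
      intro m y
      have hw : 0 < wtc M N (κ₁ * A) (nT τ' (l ++ [P]) + nT τ m) (nF τ' (l ++ [P]) + nF τ m) :=
        wtc_pos (by positivity) _ _
      rw [act_append, act_cons, act_nil, hop _ (hf.rapid.act m) P, act_sum l Finset.univ
        (fun Q _ => contDiff_smul' _ (hsmooth _ ((hf.rapid.act m).op Q)))]
      simp only [fun Q => act_smul (b := b') l (k P Q) (hsmooth _ ((hf.rapid.act m).op Q))]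
      rw [List.length_append, List.length_singleton, pow_succ', mul_assoc]
      refine norm_sum_smul_le _ _ _ _ (by positivity) (fun Q _ hQ => ?_) (hLP P)
      refine (ih (Q :: m) y).trans (le_of_eq ?_)
      rw [nT_append, nF_append, nT_cons, nF_cons, nT_cons, nF_cons, hk P Q hQ, nT_nil, nF_nil]
      congr 3 <;> ring
  intro l y
  refine (main l [] y).trans (le_of_eq ?_)
  rw [mul_assoc L, wtc_smul L, nT_nil, nF_nil, add_zero, add_zero, nT_add_nF]
  ring

/-- The bilinear form of `WBound.transfer`. The words are applied after the arguments have been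
acted upon by further words, as needed in inductive arguments. -/
theorem WBound.bitransfer_aux {τ : ι ⊕ ι → Bool} {τ₂ : ι₂ ⊕ ι₂ → Bool} {τ' : ι' ⊕ ι' → Bool}
    (M N : WeightSeq) (n : ℕ) (L : ℝ) (hL1 : 1 ≤ L) :
    ∃ κ : ℝ, 0 < κ ∧ ∀ A, 0 < A → ∃ K : ℝ, 0 ≤ K ∧
      ∀ (U : (E → ℂ) → (E₂ → ℂ) → E' → ℂ) (k : ι' ⊕ ι' → ι ⊕ ι → ℂ) (k₂ : ι' ⊕ ι' → ι₂ ⊕ ι₂ → ℂ)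
      (c₀ : ℝ) (_ : 0 ≤ c₀)
      (_ : ∀ P Q, k P Q ≠ 0 → τ Q = τ' P) (_ : ∀ P Q, k₂ P Q ≠ 0 → τ₂ Q = τ' P)
      (_ : ∀ P, ∑ Q, ‖k P Q‖ + ∑ Q, ‖k₂ P Q‖ ≤ L)
      (_ : ∀ f g, Rapid b f → Rapid b₂ g → ContDiff ℝ ∞ (U f g))
      (_ : ∀ f g, Rapid b f → Rapid b₂ g → ∀ P, op b' P (U f g) =
        ∑ Q, k P Q • U (op b Q f) g + ∑ Q, k₂ P Q • U f (op b₂ Q g))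
      (_ : ∀ f g, Rapid b f → Rapid b₂ g → ∀ R R₂,
        (∀ m : List (ι ⊕ ι), m.length ≤ n → ∀ x, ‖act b m f x‖ ≤ R) →
        (∀ m : List (ι₂ ⊕ ι₂), m.length ≤ n → ∀ x, ‖act b₂ m g x‖ ≤ R₂) →
        ∀ y, ‖U f g y‖ ≤ c₀ * (R * R₂)),
      ∀ C C₂ f g, WBound b τ M N A C f → WBound b₂ τ₂ M N A C₂ g → ∀ l m m₂ y,
        ‖act b' l (U (act b m f) (act b₂ m₂ g)) y‖ ≤ L ^ l.length * (c₀ * K * (C * C₂) *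
          wtc M N (κ * A) (nT τ' l + nT τ m + nT τ₂ m₂) (nF τ' l + nF τ m + nF τ₂ m₂)) := by
  obtain ⟨κ₁, hκ₁, hκ⟩ := exists_wtc_add_le_of_le M N
  refine ⟨κ₁, by positivity, fun A hA => ?_⟩
  obtain ⟨K, hK1, hK⟩ := hκ A hA n
  refine ⟨K * K, by positivity, fun U k k₂ c₀ hc₀ hk hk₂ hL hsmooth hop hsup C C₂ f g hf hg => ?_⟩
  have hC := hf.nonneg
  have hC₂ := hg.nonneg
  have hB : 0 < κ₁ * A := by positivity
  intro l
  induction l using List.reverseRecOn with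
  | nil =>
    intro m m₂ y
    have h1 := hsup _ _ (hf.rapid.act m) (hg.rapid.act m₂) _ _ (hf.act_act_le hK · m)
      (hg.act_act_le hK · m₂) y
    simp only [act_nil, List.length_nil, pow_zero, nT_nil, nF_nil, zero_add, one_mul]
    refine h1.trans ?_
    have h2 := wtc_mul_le (M := M) (N := N) hB (nT τ m) (nF τ m) (nT τ₂ m₂) (nF τ₂ m₂)
    calc _ = c₀ * (K * K) * (C * C₂) * (wtc M N (κ₁ * A) (nT τ m) (nF τ m) *
          wtc M N (κ₁ * A) (nT τ₂ m₂) (nF τ₂ m₂)) := by ring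
      _ ≤ _ := by gcongr
  | append_singleton l P ih =>
    intro m m₂ y
    have hf' := hf.rapid.act m
    have hg' := hg.rapid.act m₂
    have hw : 0 < wtc M N (κ₁ * A) (nT τ' (l ++ [P]) + nT τ m + nT τ₂ m₂)
        (nF τ' (l ++ [P]) + nF τ m + nF τ₂ m₂) := wtc_pos hB _ _
    have s1 : ∀ Q ∈ Finset.univ, ContDiff ℝ ∞ (k P Q • U (op b Q (act b m f)) (act b₂ m₂ g)) :=
      fun Q _ => contDiff_smul' _ (hsmooth _ _ (hf'.op Q) hg')
    have s2 : ∀ Q ∈ Finset.univ, ContDiff ℝ ∞ (k₂ P Q • U (act b m f) (op b₂ Q (act b₂ m₂ g))) :=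
      fun Q _ => contDiff_smul' _ (hsmooth _ _ hf' (hg'.op Q))
    rw [act_append, act_cons, act_nil, hop _ _ hf' hg' P,
      act_add l (contDiff_sum' _ s1) (contDiff_sum' _ s2), act_sum l _ s1, act_sum l _ s2]
    simp only [fun Q => act_smul (b := b') l (k P Q) (hsmooth _ _ (hf'.op Q) hg'),
      fun Q => act_smul (b := b') l (k₂ P Q) (hsmooth _ _ hf' (hg'.op Q))]
    rw [List.length_append, List.length_singleton, pow_succ', mul_assoc]
    set R := L ^ l.length * (c₀ * (K * K) * (C * C₂) * wtc M N (κ₁ * A)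
      (nT τ' (l ++ [P]) + nT τ m + nT τ₂ m₂) (nF τ' (l ++ [P]) + nF τ m + nF τ₂ m₂)) with hR
    have hR0 : 0 ≤ R := by positivity
    have t1 := norm_sum_smul_le Finset.univ (k P)
      (fun Q => act b' l (U (op b Q (act b m f)) (act b₂ m₂ g))) y hR0 (fun Q _ hQ => by
        refine (ih (Q :: m) m₂ y).trans (le_of_eq ?_)
        rw [hR, nT_append, nF_append, nT_cons, nF_cons, nT_cons, nF_cons, hk P Q hQ, nT_nil, nF_nil]
        congr 3 <;> ring) le_rfl
    have t2 := norm_sum_smul_le Finset.univ (k₂ P)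
      (fun Q => act b' l (U (act b m f) (op b₂ Q (act b₂ m₂ g)))) y hR0 (fun Q _ hQ => by
        refine (ih m (Q :: m₂) y).trans (le_of_eq ?_)
        rw [hR, nT_append, nF_append, nT_cons, nF_cons, nT_cons, nF_cons, hk₂ P Q hQ, nT_nil,
          nF_nil]
        congr 3 <;> ring) le_rfl
    rw [Pi.add_apply]
    refine (norm_add_le _ _).trans ((add_le_add t1 t2).trans ?_)
    rw [← add_mul]
    exact mul_le_mul_of_nonneg_right (hL P) hR0

end Transfer

/-! ### Normal ordering: the estimates for `x^α ∂^β` control all words -/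

section NormalOrder

variable {ι : Type} [Fintype ι] {E : Type} [NormedAddCommGroup E] [NormedSpace ℝ E]
  {b : Module.Basis ι ℝ E}

lemma dirDeriv_comm (v w : E) {f : E → ℂ} (hf : ContDiff ℝ ∞ f) :
    dirDeriv v (dirDeriv w f) = dirDeriv w (dirDeriv v f) := by
  funext x
  have hd : DifferentiableAt ℝ (fderiv ℝ f) x :=
    (hf.fderiv_right (m := ∞) (by simp)).differentiable (by simp) x
  have key : ∀ v w : E, dirDeriv v (dirDeriv w f) x = fderiv ℝ (fderiv ℝ f) x v w := by
    intro v w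
    have h1 : HasFDerivAt (fun y => fderiv ℝ f y w)
        ((ContinuousLinearMap.apply ℝ ℂ w).comp (fderiv ℝ (fderiv ℝ f) x)) x :=
      (ContinuousLinearMap.apply ℝ ℂ w).hasFDerivAt.comp x hd.hasFDerivAt
    exact dirDeriv_of_hasFDerivAt h1 v
  rw [key, key]
  exact ((contDiff_infty.1 hf 2).contDiffAt.isSymmSndFDerivAt (by simp)).eq v w

lemma dirDeriv_iterate_comm (v w : E) (k : ℕ) {f : E → ℂ} (hf : ContDiff ℝ ∞ f) :
    dirDeriv v ((dirDeriv w)^[k] f) = (dirDeriv w)^[k] (dirDeriv v f) := by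
  induction k with
  | zero => rfl
  | succ k ih =>
    rw [Function.iterate_succ_apply', Function.iterate_succ_apply',
      dirDeriv_comm _ _ (contDiff_dirDeriv_iterate w k hf), ih]

lemma contDiff_foldr (β : ι → ℕ) (l : List ι) {f : E → ℂ} (hf : ContDiff ℝ ∞ f) :
    ContDiff ℝ ∞ (l.foldr (fun i F => (dirDeriv (b i))^[β i] F) f) := by
  induction l with
  | nil => exact hf
  | cons i l ih => exact contDiff_dirDeriv_iterate _ _ ih

lemma contDiff_iterDeriv (β : ι → ℕ) {f : E → ℂ} (hf : ContDiff ℝ ∞ f) :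
    ContDiff ℝ ∞ (iterDeriv b β f) := contDiff_foldr β _ hf

variable [DecidableEq ι]

/-- Raising `β i` by one applies `∂_i` once more if `i` occurs in the list that prescribes the order of
the derivatives, wherever it does, and has no effect otherwise. -/
lemma dirDeriv_foldr (β : ι → ℕ) (i : ι) (l : List ι) (hl : l.Nodup) {f : E → ℂ}
    (hf : ContDiff ℝ ∞ f) :
    (i ∉ l → l.foldr (fun j F => (dirDeriv (b j))^[(β + Pi.single i 1 : ι → ℕ) j] F) f =
      l.foldr (fun j F => (dirDeriv (b j))^[β j] F) f) ∧
    (i ∈ l → l.foldr (fun j F => (dirDeriv (b j))^[(β + Pi.single i 1 : ι → ℕ) j] F) f =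
      dirDeriv (b i) (l.foldr (fun j F => (dirDeriv (b j))^[β j] F) f)) := by
  induction l with
  | nil => simp
  | cons j l ih =>
    obtain ⟨h1, h2⟩ := ih (List.nodup_cons.1 hl).2
    have hj : j ∉ l := (List.nodup_cons.1 hl).1
    simp only [List.foldr_cons, List.mem_cons, not_or]
    constructor
    · rintro ⟨hij, hil⟩
      rw [h1 hil, Pi.add_apply, Pi.single_eq_of_ne (Ne.symm hij), add_zero]
    · intro h
      by_cases hij : i = j
      · subst hij
        rw [h1 hj, Pi.add_apply, Pi.single_eq_same, Function.iterate_succ_apply']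
      · have hil : i ∈ l := h.resolve_left hij
        rw [h2 hil, Pi.add_apply, Pi.single_eq_of_ne (Ne.symm hij), add_zero,
          dirDeriv_iterate_comm _ _ _ (contDiff_foldr β l hf)]

lemma dirDeriv_iterDeriv (β : ι → ℕ) (i : ι) {f : E → ℂ} (hf : ContDiff ℝ ∞ f) :
    dirDeriv (b i) (iterDeriv b β f) = iterDeriv b (β + Pi.single i 1) f :=
  ((dirDeriv_foldr β i _ (Finset.nodup_toList _) hf).2 (by simp)).symm

lemma monomial_add_single (α : ι → ℕ) (i : ι) (x : E) :
    monomial b (α + Pi.single i 1) x = b.repr x i * monomial b α x := by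
  simp only [monomial, Pi.add_apply, pow_add, Finset.prod_mul_distrib]
  rw [mul_comm]
  congr 1
  rw [Finset.prod_eq_single i]
  · simp
  · intro j _ hj; simp [Pi.single_eq_of_ne hj]
  · simp

lemma hasFDerivAt_monomial (α : ι → ℕ) (x : E) :
    HasFDerivAt (monomial b α) (∑ j, (∏ k ∈ Finset.univ.erase j, b.repr x k ^ α k) •
      ((α j : ℝ) * b.repr x j ^ (α j - 1)) • coordL b j) x := by
  have h : ∀ j ∈ (Finset.univ : Finset ι), HasFDerivAt (fun y => coordL b j y ^ α j)
      (((α j : ℝ) * b.repr x j ^ (α j - 1)) • coordL b j) x := fun j _ => by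
    have := (coordL b j).hasFDerivAt (x := x) |>.pow (α j)
    simpa using this
  exact HasFDerivAt.finsetProd h

lemma dirDeriv_monomial (α : ι → ℕ) (i : ι) (x : E) :
    fderiv ℝ (monomial b α) x (b i) = α i * monomial b (α - Pi.single i 1) x := by
  rw [(hasFDerivAt_monomial α x).fderiv, sum_apply, Finset.sum_eq_single i]
  · simp only [smul_apply, coordL_apply, smul_eq_mul, Module.Basis.repr_self,
      Finsupp.single_eq_same, mul_one, monomial]
    rw [← Finset.mul_prod_erase _ _ (Finset.mem_univ i)]
    simp only [Pi.sub_apply, Pi.single_eq_same]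
    rw [mul_comm, mul_assoc]
    congr 2
    refine Finset.prod_congr rfl fun k hk => ?_
    rw [Pi.single_eq_of_ne (Finset.ne_of_mem_erase hk), Nat.sub_zero]
  · intro j _ hj
    simp [Finsupp.single_eq_of_ne hj]
  · simp

/-- The normally ordered expression `x^α ∂^β f`. -/
def nrm (b : Module.Basis ι ℝ E) (α β : ι → ℕ) (f : E → ℂ) : E → ℂ :=
  fun x => (monomial b α x : ℂ) * iterDeriv b β f x

omit [DecidableEq ι] in
lemma norm_nrm (α β : ι → ℕ) (f : E → ℂ) (x : E) :
    ‖nrm b α β f x‖ = |monomial b α x| * ‖iterDeriv b β f x‖ := by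
  simp [nrm]

lemma contDiff_nrm (α β : ι → ℕ) {f : E → ℂ} (hf : ContDiff ℝ ∞ f) :
    ContDiff ℝ ∞ (nrm b α β f) := by
  refine ContDiff.mul ?_ (contDiff_iterDeriv β hf)
  refine Complex.ofRealCLM.contDiff.comp ?_
  exact contDiff_prod fun i _ => (coordL b i).contDiff.pow _

lemma op_inl_nrm (α β : ι → ℕ) (i : ι) (f : E → ℂ) :
    op b (.inl i) (nrm b α β f) = nrm b (α + Pi.single i 1) β f := by
  funext x
  simp only [op, nrm, monomial_add_single]
  push_cast; ring

/-- The product rule: `∂_i x^α ∂^β = x^α ∂_i ∂^β + α_i x^(α - e_i) ∂^β`. -/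
lemma op_inr_nrm (α β : ι → ℕ) (i : ι) {f : E → ℂ} (hf : ContDiff ℝ ∞ f) :
    op b (.inr i) (nrm b α β f) =
      nrm b α (β + Pi.single i 1) f + (α i : ℂ) • nrm b (α - Pi.single i 1) β f := by
  funext x
  have h1 : HasFDerivAt (fun x => (monomial b α x : ℂ))
      (Complex.ofRealCLM.comp (fderiv ℝ (monomial b α) x)) x :=
    Complex.ofRealCLM.hasFDerivAt.comp x (hasFDerivAt_monomial α x).differentiableAt.hasFDerivAt
  have h2 := (contDiff_iterDeriv (b := b) β hf).differentiable (by simp) x |>.hasFDerivAt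
  have h3 := dirDeriv_of_hasFDerivAt (h1.mul h2) (b i)
  have h4 := congrFun (dirDeriv_iterDeriv (b := b) β i hf) x
  simp only [op]
  refine h3.trans ?_
  simp only [nrm, Pi.add_apply, Pi.smul_apply, smul_eq_mul, add_apply,
    smul_apply, ContinuousLinearMap.comp_apply, Complex.ofRealCLM_apply,
    dirDeriv_monomial, ← h4, dirDeriv]
  push_cast; ring

/-- The number of factors of the type selected by `p` in `x^α ∂^β`. -/
def cnt (p : ι ⊕ ι → Bool) (α β : ι → ℕ) : ℕ :=
  ∑ i, ((if p (.inl i) then α i else 0) + if p (.inr i) then β i else 0)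

lemma cnt_add_single_left (p : ι ⊕ ι → Bool) (α β : ι → ℕ) (i : ι) :
    cnt p (α + Pi.single i 1) β = cnt p α β + if p (.inl i) then 1 else 0 := by
  have : ∀ j, ((if p (.inl j) then (α + Pi.single i 1 : ι → ℕ) j else 0) + if p (.inr j) then β j else 0)
      = ((if p (.inl j) then α j else 0) + if p (.inr j) then β j else 0) +
        if j = i then (if p (.inl i) then 1 else 0) else 0 := by
    intro j
    by_cases h : j = i
    · subst h; simp only [Pi.add_apply, Pi.single_eq_same]; split_ifs <;> omega
    · simp [h]
  simp only [cnt, this, Finset.sum_add_distrib, Finset.sum_ite_eq', Finset.mem_univ, if_true]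

lemma cnt_add_single_right (p : ι ⊕ ι → Bool) (α β : ι → ℕ) (i : ι) :
    cnt p α (β + Pi.single i 1) = cnt p α β + if p (.inr i) then 1 else 0 := by
  have : ∀ j, ((if p (.inl j) then α j else 0) + if p (.inr j) then (β + Pi.single i 1 : ι → ℕ) j else 0)
      = ((if p (.inl j) then α j else 0) + if p (.inr j) then β j else 0) +
        if j = i then (if p (.inr i) then 1 else 0) else 0 := by
    intro j
    by_cases h : j = i
    · subst h; simp only [Pi.add_apply, Pi.single_eq_same]; split_ifs <;> omega
    · simp [h]
  simp only [cnt, this, Finset.sum_add_distrib, Finset.sum_ite_eq', Finset.mem_univ, if_true]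

omit [DecidableEq ι] in
lemma cnt_add_cnt_not (p : ι ⊕ ι → Bool) (α β : ι → ℕ) :
    cnt p α β + cnt (fun s => !p s) α β = ∑ i, α i + ∑ i, β i := by
  simp only [cnt, ← Finset.sum_add_distrib]
  refine Finset.sum_congr rfl fun i _ => ?_
  by_cases h1 : p (.inl i) <;> by_cases h2 : p (.inr i) <;> simp [h1, h2] <;> omega

lemma sub_single_add_single {α : ι → ℕ} {i : ι} (h : α i ≠ 0) :
    α - Pi.single i 1 + Pi.single i 1 = α := by
  funext j
  by_cases hj : j = i
  · subst hj; simp; omega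
  · simp [Pi.single_eq_of_ne hj]

/-- The number of derivatives in a word. -/
def nD (l : List (ι ⊕ ι)) : ℕ := nF Sum.isLeft l

/-- The number of coordinate multiplications in a word. -/
def nX (l : List (ι ⊕ ι)) : ℕ := nT Sum.isLeft l

/-- Moving the derivatives in a word to the right by the canonical commutation relations: each of
them may be contracted with one of the coordinates, which reduces the number of operators of
either type by one. -/
lemma norm_act_nrm_le {τ : ι ⊕ ι → Bool} (hτ : ∀ i, τ (.inr i) = !τ (.inl i)) {Z : ℕ → ℕ → ℝ}
    (hZ0 : ∀ p q, 0 ≤ Z p q) {f : E → ℂ} (hf : ContDiff ℝ ∞ f)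
    (hZ : ∀ α β x, ‖nrm b α β f x‖ ≤ Z (cnt τ α β) (cnt (fun s => !τ s) α β))
    (l : List (ι ⊕ ι)) (x : E) : ∀ (α β : ι → ℕ) (V : ℝ), (∀ k, k ≤ nD l →
        k ≤ nT τ l + cnt τ α β → k ≤ nF τ l + cnt (fun s => !τ s) α β →
        ((nX l + ∑ i, α i).descFactorial k : ℝ) *
          Z (nT τ l + cnt τ α β - k) (nF τ l + cnt (fun s => !τ s) α β - k) ≤ V) →
      ‖act b l (nrm b α β f) x‖ ≤ 2 ^ nD l * V := by
  induction l using List.reverseRecOn with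
  | nil =>
    intro α β V hV
    have := hV 0 (by simp) (by simp) (by simp)
    simp only [nT_nil, nF_nil, zero_add, Nat.sub_zero, Nat.descFactorial_zero, Nat.cast_one,
      one_mul] at this
    simpa [nD] using (hZ α β x).trans this
  | append_singleton l P ih =>
    intro α β V hV
    rw [act_append, act_cons, act_nil]
    cases P with
    | inl i =>
      rw [op_inl_nrm]
      have hD : nD (l ++ [Sum.inl i]) = nD l := by simp [nD, nF_cons]
      rw [hD]
      refine ih _ _ _ fun k hk h1 h2 => ?_
      rw [cnt_add_single_left] at h1 ⊢
      rw [cnt_add_single_left] at h2 ⊢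
      have := hV k (by rwa [hD]) (by simpa [nT_cons, add_assoc, add_comm, add_left_comm] using h1)
        (by rw [nF_append, nF_cons, nF_nil]; revert h2; cases τ (.inl i) <;> simp <;> omega)
      convert this using 3
      · simp only [nX, nT_append, nT_cons, nT_nil, Sum.isLeft_inl, if_true, Pi.add_apply,
          Finset.sum_add_distrib, Finset.sum_pi_single', Finset.mem_univ]
        congr 1; omega
      · simp only [nT_append, nT_cons, nT_nil]; omega
      · simp only [nF_append, nF_cons, nF_nil]; cases τ (.inl i) <;> simp <;> omega
    | inr i =>
      have hD : nD (l ++ [Sum.inr i]) = nD l + 1 := by simp [nD, nF_cons]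
      have hX : nX (l ++ [Sum.inr i]) = nX l := by simp [nX, nT_cons]
      have e1 : nT τ (l ++ [Sum.inr i]) = nT τ l + if τ (.inr i) then 1 else 0 := by
        simp [nT_cons]
      have e2 : nF τ (l ++ [Sum.inr i]) = nF τ l + if τ (.inr i) then 0 else 1 := by
        simp [nF_cons]
      rw [hD, hX, e1, e2] at hV
      rw [op_inr_nrm _ _ _ hf, act_add l (contDiff_nrm _ _ hf) (contDiff_smul' _ (contDiff_nrm _ _ hf)),
        act_smul l _ (contDiff_nrm _ _ hf), hD, pow_succ]
      have h1 : ‖act b l (nrm b α (β + Pi.single i 1) f) x‖ ≤ 2 ^ nD l * V := by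
        refine ih _ _ _ fun k hk h1 h2 => ?_
        rw [cnt_add_single_right] at h1 ⊢
        rw [cnt_add_single_right] at h2 ⊢
        have := hV k (by omega) (by omega) (by revert h2; cases τ (.inr i) <;> simp <;> omega)
        convert this using 3
        · omega
        · cases τ (.inr i) <;> simp <;> omega
      have h2 : ‖(α i : ℂ) • act b l (nrm b (α - Pi.single i 1) β f) x‖ ≤ 2 ^ nD l * V := by
        by_cases hα : α i = 0
        · have h3 : 0 ≤ V := by
            have := hV 0 (by simp) (by simp) (by simp)
            exact (mul_nonneg (by positivity) (hZ0 _ _)).trans this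
          rw [hα]
          simp only [Nat.cast_zero, zero_smul, norm_zero]; positivity
        · have hαe := sub_single_add_single hα
          set α' := α - Pi.single i 1 with hα'
          have hsum : ∑ j, α j = ∑ j, α' j + 1 := by
            conv_lhs => rw [← hαe]
            simp [Finset.sum_add_distrib]
          have c1 : cnt τ α β = cnt τ α' β + if τ (.inl i) then 1 else 0 := by
            conv_lhs => rw [← hαe]
            exact cnt_add_single_left _ _ _ _
          have c2 : cnt (fun s => !τ s) α β = cnt (fun s => !τ s) α' β +
              if τ (.inl i) then 0 else 1 := by
            conv_lhs => rw [← hαe]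
            rw [cnt_add_single_left]
            cases τ (.inl i) <;> simp
          have hle : α i ≤ ∑ j, α j := Finset.single_le_sum (f := α) (by simp) (Finset.mem_univ i)
          set n := nX l + ∑ j, α j with hn
          have hn0 : (0 : ℝ) < n := by
            have : 0 < n := by omega
            exact_mod_cast this
          have h3 : ‖act b l (nrm b α' β f) x‖ ≤ 2 ^ nD l * (V / n) := by
            refine ih _ _ _ fun k hk h1 h2 => ?_
            rw [le_div_iff₀ hn0]
            have := hV (k + 1) (by omega)
              (by rw [c1, hτ i]; cases τ (.inl i) <;> simp <;> omega)
              (by rw [c2, hτ i]; cases τ (.inl i) <;> simp <;> omega)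
            refine le_trans (le_of_eq ?_) this
            have hn1 : n = (nX l + ∑ j, α' j) + 1 := by omega
            rw [hn1, Nat.succ_descFactorial_succ, c1, c2, hτ i]
            push_cast
            rw [mul_comm, ← mul_assoc]
            congr 2
            · cases τ (.inl i) <;> simp <;> omega
            · cases τ (.inl i) <;> simp <;> omega
          have h4 : (α i : ℝ) ≤ n := by
            have : α i ≤ n := by omega
            exact_mod_cast this
          rw [norm_smul]
          have h5 : ‖(α i : ℂ)‖ = α i := by simp
          rw [h5]
          calc (α i : ℝ) * ‖act b l (nrm b α' β f) x‖ ≤ n * (2 ^ nD l * (V / n)) :=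
                mul_le_mul h4 h3 (norm_nonneg _) hn0.le
            _ = 2 ^ nD l * V := by field_simp
      rw [Pi.add_apply]
      refine (norm_add_le _ _).trans ((add_le_add h1 h2).trans (le_of_eq (by ring)))


/-- The word that gives `x^α ∂^β`. -/
def ordWord (α β : ι → ℕ) : List (ι ⊕ ι) :=
  ((Finset.univ : Finset ι).toList.flatMap fun i => List.replicate (α i) (.inl i)) ++
    (Finset.univ : Finset ι).toList.flatMap fun i => List.replicate (β i) (.inr i)

omit [DecidableEq ι] in
lemma act_ordWord (α β : ι → ℕ) (f : E → ℂ) : act b (ordWord α β) f = nrm b α β f := by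
  have h1 : ∀ l : List ι, act b (l.flatMap fun i => List.replicate (β i) (.inr i)) f =
      l.foldr (fun i F => (dirDeriv (b i))^[β i] F) f := by
    intro l
    induction l with
    | nil => rfl
    | cons i l ih =>
      rw [List.flatMap_cons, act_append, ih, List.foldr_cons]
      generalize l.foldr (fun i F => (dirDeriv (b i))^[β i] F) f = F
      induction β i with
      | zero => rfl
      | succ k ih => rw [List.replicate_succ, act_cons, ih, Function.iterate_succ_apply']; rfl
  have h2 : ∀ (l : List ι) (F : E → ℂ) (x : E),
      act b (l.flatMap fun i => List.replicate (α i) (.inl i)) F x =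
      ((l.map fun i => b.repr x i ^ α i).prod : ℝ) * F x := by
    intro l F x
    induction l with
    | nil => simp
    | cons i l ih =>
      rw [List.flatMap_cons, act_append, List.map_cons, List.prod_cons]
      generalize hG : act b (l.flatMap fun i => List.replicate (α i) (.inl i)) F = G at ih
      have : ∀ k : ℕ, act b (List.replicate k (.inl i)) G x = (b.repr x i : ℂ) ^ k * G x := by
        intro k
        induction k with
        | zero => simp
        | succ k ih => rw [List.replicate_succ, act_cons]; simp only [op]; rw [ih, pow_succ']; ring
      rw [this, ih]
      push_cast; ring
  funext x
  rw [ordWord, act_append, h1, h2, Finset.prod_map_toList]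
  rfl

omit [DecidableEq ι] in
lemma countP_ordWord (p : ι ⊕ ι → Bool) (α β : ι → ℕ) :
    (ordWord α β).countP p = cnt p α β := by
  rw [ordWord, List.countP_append, List.countP_flatMap, List.countP_flatMap]
  simp only [Function.comp_def, List.countP_replicate, Finset.sum_map_toList, cnt,
    Finset.sum_add_distrib]

end NormalOrder

/-! ### Equivalence of the two systems of norms -/

section Equivalence

variable {ι : Type} [Fintype ι] {E : Type} [NormedAddCommGroup E] [NormedSpace ℝ E]
  {b : Module.Basis ι ℝ E}

/-- The weights `m`, `n` on multi-indices are equivalent, up to geometric factors, to counting the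
operators of type `true` by `M` and those of type `false` by `N`. A coordinate and the derivative
in its direction are required to be of opposite types. -/
structure Compat (τ : ι ⊕ ι → Bool) (m n : MultiWeight ι) (M N : WeightSeq) : Prop where
  swap : ∀ i, τ (.inr i) = !τ (.inl i)
  le : ∀ α β, m.1 α * n.1 β ≤ M.M (cnt τ α β) * N.M (cnt (fun s => !τ s) α β)
  ge : ∃ K H : ℝ, 0 < K ∧ 1 ≤ H ∧ ∀ α β, M.M (cnt τ α β) * N.M (cnt (fun s => !τ s) α β) ≤
    K * H ^ (∑ i, α i + ∑ i, β i) * (m.1 α * n.1 β)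

variable {τ : ι ⊕ ι → Bool} {m n : MultiWeight ι} {M N : WeightSeq} {c : GSType}

lemma descFactorial_le (n k : ℕ) : (n.descFactorial k : ℝ) ≤ 2 ^ n * k.factorial := by
  rw [Nat.descFactorial_eq_factorial_mul_choose, mul_comm]
  push_cast
  have : (n.choose k : ℝ) ≤ 2 ^ n := by exact_mod_cast Nat.choose_le_two_pow n k
  gcongr

/-- Passage from `x^α ∂^β` to words for a fixed parameter: normal ordering produces a descending
factorial, which is at most `2 ^ n * k!` for `k` contractions, and `k!` is absorbed by the weights
`M k * N k` of the contracted operators. -/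
lemma WBound.of_bound (hτ : Compat τ m n M N) {A C D h : ℝ} (hA : 0 < A) (hD : 0 < D)
    (hh : 0 < h) (hhA : h ≤ A ^ 2)
    (hfac : ∀ k : ℕ, (k.factorial : ℝ) ≤ D * h ^ k * (M.M k * N.M k)) {f : E → ℂ}
    (hf : Bound b m n A A C f) : WBound b τ M N (4 * A) (D * C) f := by
  classical
  have hC := hf.nonneg hA hA
  refine ⟨hf.1, fun l x => ?_⟩
  have h0 : f = nrm b 0 0 f := by
    funext x; simp [nrm, monomial, iterDeriv_zero]
  have hcnt : ∀ p : ι ⊕ ι → Bool, cnt p (0 : ι → ℕ) 0 = 0 := by simp [cnt]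
  conv_lhs => rw [h0]
  have key := norm_act_nrm_le (b := b) hτ.swap (Z := fun p q => C * wtc M N A p q)
    (fun p q => mul_nonneg hC (wtc_pos hA p q).le) hf.1 (fun α β x => ?_) l x 0 0
    (2 ^ nX l * (D * C * wtc M N A (nT τ l) (nF τ l))) ?_
  · refine key.trans (le_of_eq_of_le (b := 2 ^ l.length * (D * C * wtc M N A (nT τ l) (nF τ l)))
      ?_ ?_)
    · rw [← nT_add_nF Sum.isLeft l, pow_add, nX, nD]; ring
    · rw [wtc_smul, nT_add_nF]
      have h1 := wtc_pos (M := M) (N := N) hA (nT τ l) (nF τ l)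
      have h2 : (2 : ℝ) ^ l.length ≤ 4 ^ l.length := by gcongr; norm_num
      calc _ = D * C * (2 ^ l.length * wtc M N A (nT τ l) (nF τ l)) := by ring
        _ ≤ _ := by gcongr
  · rw [norm_nrm]
    refine (hf.2 α β x).trans (mul_le_mul_of_nonneg_left ?_ hC)
    have h1 := hτ.le α β
    calc _ = A ^ (∑ i, α i + ∑ i, β i) * (m.1 α * n.1 β) := by rw [pow_add]; ring
      _ ≤ _ := by rw [wtc, cnt_add_cnt_not]; gcongr
  · intro k hk h1 h2
    simp only [hcnt, add_zero, Pi.zero_apply, Finset.sum_const_zero] at h1 h2 ⊢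
    have e1 := M.pos k
    have e2 := N.pos k
    have e3 := wtc_pos (M := M) (N := N) hA (nT τ l - k) (nF τ l - k)
    have e4 : h ^ k ≤ A ^ (k + k) := by
      rw [← two_mul, pow_mul]; gcongr
    calc ((nX l).descFactorial k : ℝ) * (C * wtc M N A (nT τ l - k) (nF τ l - k))
        ≤ (2 ^ nX l * (D * A ^ (k + k) * (M.M k * N.M k))) *
            (C * wtc M N A (nT τ l - k) (nF τ l - k)) := by
          refine mul_le_mul_of_nonneg_right ((descFactorial_le _ _).trans ?_) (by positivity)
          refine mul_le_mul_of_nonneg_left ((hfac k).trans ?_) (by positivity)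
          gcongr
      _ = 2 ^ nX l * (D * C * (wtc M N A k k * wtc M N A (nT τ l - k) (nF τ l - k))) := by
          simp only [wtc]; ring
      _ ≤ _ := by
          have := wtc_mul_le (M := M) (N := N) hA k k (nT τ l - k) (nF τ l - k)
          rw [Nat.add_sub_cancel' h1, Nat.add_sub_cancel' h2] at this
          gcongr

/-- The estimates for words follow from those for `x^α ∂^β`. -/
lemma tame_wbound_of_bound (hτ : Compat τ m n M N) (hM : M.Nontrivial c) (hN : N.Nontrivial c) :
    c.Tame fun A A' => ∃ K : ℝ, 0 ≤ K ∧ ∀ C (f : E → ℂ), Bound b m n A A C f →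
      WBound b τ M N A' (K * C) f := by
  have hfac := factorial_le hM hN
  cases c
  · intro A hA
    obtain ⟨h, hh, D, hD, hfac⟩ := hfac
    have h1 : A ≤ max A (√h) := le_max_left _ _
    have h3 : 0 < max A (√h) := hA.trans_le h1
    have h2 : h ≤ max A (√h) ^ 2 :=
      (Real.sq_sqrt hh.le).symm.le.trans (pow_le_pow_left₀ (Real.sqrt_nonneg _) (le_max_right _ _) 2)
    exact ⟨4 * max A (√h), by positivity, D, hD.le, fun C f hf =>
      WBound.of_bound hτ h3 hD hh h2 hfac (hf.mono hA hA h1 h1)⟩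
  · intro A' hA'
    obtain ⟨D, hD, hfac⟩ := hfac ((A' / 4) ^ 2) (by positivity)
    refine ⟨A' / 4, by positivity, D, hD.le, fun C f hf => ?_⟩
    have := WBound.of_bound hτ (by positivity) hD (by positivity) le_rfl hfac hf
    rwa [mul_div_cancel₀ _ (by norm_num : (4 : ℝ) ≠ 0)] at this

lemma exists_bound_of_wbound (hτ : Compat τ m n M N) :
    ∃ K κ : ℝ, 0 < K ∧ 0 < κ ∧ ∀ A, 0 < A → ∀ C (f : E → ℂ), WBound b τ M N A C f →
      Bound b m n (κ * A) (κ * A) (K * C) f := by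
  obtain ⟨K, H, hK, hH, h⟩ := hτ.ge
  refine ⟨K, H, hK, by positivity, fun A hA C f hf => ⟨hf.1, fun α β x => ?_⟩⟩
  rw [← norm_nrm, ← act_ordWord]
  refine (hf.2 _ x).trans ?_
  have hC := hf.nonneg
  rw [nT, nF, countP_ordWord, countP_ordWord, wtc, cnt_add_cnt_not]
  calc C * (A ^ (∑ i, α i + ∑ i, β i) *
        (M.M (cnt τ α β) * N.M (cnt (fun s => !τ s) α β)))
      ≤ C * (A ^ (∑ i, α i + ∑ i, β i) * (K * H ^ (∑ i, α i + ∑ i, β i) * (m.1 α * n.1 β))) := by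
        exact mul_le_mul_of_nonneg_left (mul_le_mul_of_nonneg_left (h α β) (by positivity)) hC
    _ = _ := by simp only [mul_pow, pow_add]; ring

lemma tame_bound_of_wbound (hτ : Compat τ m n M N) :
    c.Tame fun A A' => ∃ K : ℝ, 0 ≤ K ∧ ∀ C (f : E → ℂ), WBound b τ M N A C f →
      Bound b m n A' A' (K * C) f := by
  obtain ⟨K, κ, hK, hκ, h⟩ := exists_bound_of_wbound (b := b) hτ
  exact GSType.tame_of_linear hκ fun A hA => ⟨K, hK.le, h A hA⟩

/-- Membership in the Gelfand-Shilov space in terms of words. -/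
lemma mem_space_iff (hτ : Compat τ m n M N) (hM : M.Nontrivial c) (hN : N.Nontrivial c)
    {f : E → ℂ} : f ∈ Space c b m n ↔ c.quant₁ fun A => ∃ C, WBound b τ M N A C f := by
  have h1 : f ∈ Space c b m n ↔ c.quant₁ fun A => ∃ C, Bound b m n A A C f :=
    GSType.quant_iff_quant₁ fun A A' B B' hA hB hAA hBB ⟨C, hC⟩ => ⟨C, hC.mono hA hB hAA hBB⟩
  rw [h1]
  constructor
  · intro h
    exact (tame_wbound_of_bound (b := b) hτ hM hN).quant₁ h
      fun A A' _ _ ⟨K, _, hK⟩ ⟨C, hC⟩ => ⟨K * C, hK C f hC⟩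
  · intro h
    exact (tame_bound_of_wbound (b := b) hτ).quant₁ h
      fun A A' _ _ ⟨K, _, hK⟩ ⟨C, hC⟩ => ⟨K * C, hK C f hC⟩

/-- The functional `u` is bounded by `K` times the norm with parameter `A` defined by words. -/
def WDual (τ : ι ⊕ ι → Bool) (M N : WeightSeq) (u : Space c b m n →ₗ[ℂ] ℂ) (A K : ℝ) : Prop :=
  ∀ (φ : Space c b m n) (C : ℝ), WBound b τ M N A C (φ : E → ℂ) → ‖u φ‖ ≤ K * C

lemma DualBound.mono {u : Space c b m n →ₗ[ℂ] ℂ} {A A' B B' K : ℝ} (hA : 0 < A) (hB : 0 < B)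
    (hAA : A ≤ A') (hBB : B ≤ B') (h : DualBound u A' B' K) : DualBound u A B K :=
  fun φ hφ => h φ (hφ.mono hA hB hAA hBB)

lemma le_mul_of_forall_pos {a K C : ℝ} (hC : 0 ≤ C) (h : ∀ D, 0 < D → C ≤ D → a ≤ K * D) :
    a ≤ K * C := by
  refine le_of_forall_pos_le_add fun ε hε => ?_
  have hK : 0 < |K| + 1 := by positivity
  refine (h (C + ε / (|K| + 1)) (by positivity) (by linarith [div_pos hε hK])).trans ?_
  rw [mul_add]
  have : K * (ε / (|K| + 1)) ≤ ε := by
    rw [← mul_div_assoc, div_le_iff₀ hK]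
    nlinarith [le_abs_self K]
  linarith

lemma DualBound.le_mul {u : Space c b m n →ₗ[ℂ] ℂ} {A B K : ℝ} (hA : 0 < A) (hB : 0 < B)
    (h : DualBound u A B K) {φ : Space c b m n} {C : ℝ} (hφ : Bound b m n A B C (φ : E → ℂ)) :
    ‖u φ‖ ≤ K * C := by
  have hC := hφ.nonneg hA hB
  refine le_mul_of_forall_pos hC fun D hD hCD => ?_
  have h1 := h ((D : ℂ)⁻¹ • φ) (by
    have := hφ.lin (D : ℂ)⁻¹ (Bound.zero A B)
    simp only [add_zero, norm_inv, Complex.norm_real, Real.norm_of_nonneg hD.le] at this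
    refine ⟨this.1, fun α β x => (this.2 α β x).trans ?_⟩
    have h4 : D⁻¹ * C ≤ 1 := by rw [inv_mul_le_iff₀ hD]; linarith
    have h5 := m.2 α
    have h6 := n.2 β
    gcongr)
  rw [map_smul, norm_smul, norm_inv, Complex.norm_real, Real.norm_of_nonneg hD.le,
    inv_mul_le_iff₀ hD] at h1
  linarith

lemma WDual.mono {u : Space c b m n →ₗ[ℂ] ℂ} {A A' K K' : ℝ} (hA : 0 < A)
    (hAA : A ≤ A') (hK : K ≤ K') (h : WDual τ M N u A' K) : WDual τ M N u A K' :=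
  fun φ C hφ => (h φ C (hφ.mono hA hAA)).trans (mul_le_mul_of_nonneg_right hK hφ.nonneg)

/-- Membership in the dual in terms of words. -/
lemma mem_dual_iff (hτ : Compat τ m n M N) (hM : M.Nontrivial c) (hN : N.Nontrivial c)
    {u : Space c b m n →ₗ[ℂ] ℂ} :
    u ∈ dualSubmodule c b m n ↔ c.coquant₁ fun A => ∃ K, 0 ≤ K ∧ WDual τ M N u A K := by
  have h1 : u ∈ dualSubmodule c b m n ↔ c.coquant₁ fun A => ∃ K, DualBound u A A K :=
    GSType.coquant_iff_coquant₁ fun A A' B B' hA hB hAA hBB ⟨K, hK⟩ =>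
      ⟨K, hK.mono hA hB hAA hBB⟩
  rw [h1]
  constructor
  · intro h
    refine (tame_bound_of_wbound (b := b) (c := c) hτ).coquant₁ h
      fun A A' hA hA' ⟨K, hK0, hK⟩ ⟨L, hL⟩ => ⟨|L| * K, by positivity, fun φ C hφ => ?_⟩
    have := hφ.nonneg
    rw [mul_assoc]
    exact (hL.le_mul hA' hA' (hK C _ hφ)).trans
      (mul_le_mul_of_nonneg_right (le_abs_self L) (by positivity))
  · intro h
    refine (tame_wbound_of_bound (b := b) hτ hM hN).coquant₁ h
      fun A A' _ _ ⟨K, _, hK⟩ ⟨L, _, hL⟩ => ⟨L * K, fun φ hφ => ?_⟩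
    simpa using hL φ _ (hK 1 _ hφ)

lemma WDual.smul {u : Space c b m n →ₗ[ℂ] ℂ} {A K : ℝ} (a : ℂ) (h : WDual τ M N u A K) :
    WDual τ M N (a • u) A (‖a‖ * K) := fun φ C hφ => by
  rw [LinearMap.smul_apply, norm_smul, mul_assoc]
  exact mul_le_mul_of_nonneg_left (h φ C hφ) (norm_nonneg a)

lemma Dual.lin_smul (a : ℂ) (u : Dual c b m n) : (a • u).lin = a • u.lin := rfl

lemma Dual.lin_add (u v : Dual c b m n) : (u + v).lin = u.lin + v.lin := rfl

lemma Dual.lin_sub (u v : Dual c b m n) : (u - v).lin = u.lin - v.lin := rfl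

lemma Dual.ext {u v : Dual c b m n} (h : ∀ φ, u.lin φ = v.lin φ) : u = v :=
  Subtype.ext (LinearMap.ext h)

/-- A seminorm that is bounded on the unit ball of a dual norm is dominated by the norm. -/
lemma seminorm_le_mul {q : Seminorm ℂ (Dual c b m n)} {A K L : ℝ}
    (h : ∀ u : Dual c b m n, WDual τ M N u.lin A 1 → q u ≤ K) (hL : 0 ≤ L) {u : Dual c b m n}
    (hu : WDual τ M N u.lin A L) : q u ≤ K * L := by
  refine le_mul_of_forall_pos hL fun D hD hLD => ?_
  have h1 := h ((D : ℂ)⁻¹ • u) (by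
    intro φ C hφ
    refine (hu.smul (D : ℂ)⁻¹ φ C hφ).trans (mul_le_mul_of_nonneg_right ?_ hφ.nonneg)
    rw [norm_inv, Complex.norm_real, Real.norm_of_nonneg hD.le, inv_mul_le_iff₀ hD]
    linarith)
  rw [map_smul_eq_mul, norm_inv, Complex.norm_real, Real.norm_of_nonneg hD.le,
    inv_mul_le_iff₀ hD] at h1
  linarith

/-- The continuous seminorms on the dual in terms of words. -/
lemma isDualSeminorm_iff (hτ : Compat τ m n M N) (hM : M.Nontrivial c) (hN : N.Nontrivial c)
    {q : Seminorm ℂ (Dual c b m n)} : IsDualSeminorm q ↔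
      c.quant₁ fun A => ∃ K : ℝ, 0 ≤ K ∧ ∀ u : Dual c b m n, WDual τ M N u.lin A 1 → q u ≤ K := by
  have h1 : IsDualSeminorm q ↔
      c.quant₁ fun A => ∃ K : ℝ, ∀ u : Dual c b m n, DualBound u.lin A A 1 → q u ≤ K :=
    GSType.quant_iff_quant₁ fun A A' B B' hA hB hAA hBB ⟨K, hK⟩ =>
      ⟨K, fun u hu => hK u (hu.mono hA hB hAA hBB)⟩
  rw [h1]
  constructor
  · intro h
    refine (tame_wbound_of_bound (b := b) hτ hM hN).quant₁ h
      fun A A' hA _ ⟨K, hK0, hK⟩ ⟨L, hL⟩ => ⟨|L| * (K + 1), by positivity, fun u hu => ?_⟩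
    have h2 := hL (((K + 1 : ℝ) : ℂ)⁻¹ • u) (by
      intro φ hφ
      have h3 := hu φ _ (hK 1 _ hφ)
      rw [Dual.lin_smul, LinearMap.smul_apply, norm_smul, norm_inv, Complex.norm_real,
        Real.norm_of_nonneg (by positivity), inv_mul_le_iff₀ (by positivity)]
      linarith)
    rw [map_smul_eq_mul, norm_inv, Complex.norm_real, Real.norm_of_nonneg (by positivity),
      inv_mul_le_iff₀ (by positivity)] at h2
    nlinarith [le_abs_self L]
  · intro h
    refine (tame_bound_of_wbound (b := b) (c := c) hτ).quant₁ h
      fun A A' _ hA' ⟨K, hK0, hK⟩ ⟨L, hL0, hL⟩ => ⟨L * K, fun u hu => ?_⟩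
    refine seminorm_le_mul hL hK0 fun φ C hφ => ?_
    simpa using hu.le_mul hA' hA' (hK C _ hφ)

end Equivalence

section

/-! ### Decay of rapidly decreasing functions -/

section Decay

variable {ι : Type} [Fintype ι] {E : Type} [NormedAddCommGroup E] [NormedSpace ℝ E]
  {b : Module.Basis ι ℝ E}

/-- Bounds for short words give polynomial decay in any selection of the coordinates. -/
lemma decay_coord (J : Finset ι) (x : E) (n : ℕ) : ∀ (f : E → ℂ) (R : ℝ),
    (∀ m : List (ι ⊕ ι), m.length ≤ n → ‖act b m f x‖ ≤ R) →
      (1 + ∑ i ∈ J, |b.repr x i|) ^ n * ‖f x‖ ≤ (J.card + 1) ^ n * R := by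
  induction n with
  | zero => intro f R h; simpa using h [] le_rfl
  | succ n ih =>
    intro f R h
    have h0 := ih f R fun m hm => h m (by omega)
    have h1 : ∀ i, (1 + ∑ i ∈ J, |b.repr x i|) ^ n * (|b.repr x i| * ‖f x‖) ≤
        (J.card + 1) ^ n * R := by
      intro i
      have := ih (op b (.inl i) f) R fun m hm => by
        have := h (m ++ [.inl i]) (by simp; omega)
        rwa [act_append] at this
      simpa [op] using this
    have h2 : (1 + ∑ i ∈ J, |b.repr x i|) ^ (n + 1) * ‖f x‖ =
        (1 + ∑ i ∈ J, |b.repr x i|) ^ n * ‖f x‖ +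
          ∑ i ∈ J, (1 + ∑ i ∈ J, |b.repr x i|) ^ n * (|b.repr x i| * ‖f x‖) := by
      rw [← Finset.mul_sum, ← Finset.sum_mul]; ring
    rw [h2]
    refine (add_le_add h0 (Finset.sum_le_sum fun i _ => h1 i)).trans (le_of_eq ?_)
    rw [Finset.sum_const, nsmul_eq_mul]; ring

end Decay

variable {d : ℕ}

/-- An integrable and square integrable weight on `ℝ^d` of polynomial decay. -/
def jap (x : Rn d) : ℝ := ((1 + ‖x‖) ^ (d + 1))⁻¹

lemma jap_pos (x : Rn d) : 0 < jap x := by unfold jap; positivity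

lemma jap_le_one (x : Rn d) : jap x ≤ 1 :=
  inv_le_one_of_one_le₀ (one_le_pow₀ (by linarith [norm_nonneg x]))

lemma continuous_jap : Continuous (jap : Rn d → ℝ) := by
  unfold jap
  exact ((continuous_const.add continuous_norm).pow _).inv₀ fun x =>
    (by positivity : (0 : ℝ) < (1 + ‖x‖) ^ (d + 1)).ne'

lemma integrable_jap : Integrable (jap : Rn d → ℝ) := by
  have h := integrable_one_add_norm (E := Rn d) (μ := volume) (r := (d + 1 : ℕ))
    (by rw [finrank_euclideanSpace_fin]; push_cast; linarith)
  refine h.congr (Eventually.of_forall fun x => ?_)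
  simp only [jap]
  rw [Real.rpow_neg (by positivity), Real.rpow_natCast]

@[simp] lemma stdBasis_repr (x : Rn d) (i : Fin d) : (stdBasis d).repr x i = x i := rfl

@[simp] lemma stdBasis₂_repr_inl (z : Rn d × Rn d) (i : Fin d) :
    (stdBasis₂ d).repr z (.inl i) = z.1 i := rfl

@[simp] lemma stdBasis₂_repr_inr (z : Rn d × Rn d) (i : Fin d) :
    (stdBasis₂ d).repr z (.inr i) = z.2 i := rfl

lemma stdBasis₂_inl (i : Fin d) : stdBasis₂ d (.inl i) = (stdBasis d i, 0) := by
  simp [stdBasis₂]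

lemma stdBasis₂_inr (i : Fin d) : stdBasis₂ d (.inr i) = (0, stdBasis d i) := by
  simp [stdBasis₂]

lemma norm_le_sum_abs (x : Rn d) : ‖x‖ ≤ ∑ i, |x i| := by
  conv_lhs => rw [← (stdBasis d).sum_repr x]
  refine (norm_sum_le _ _).trans (Finset.sum_le_sum fun i _ => ?_)
  rw [norm_smul, stdBasis_repr, Real.norm_eq_abs, stdBasis, OrthonormalBasis.coe_toBasis,
    OrthonormalBasis.norm_eq_one, mul_one]

lemma norm_le_jap {f : Rn d → ℂ} {R : ℝ} {x : Rn d}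
    (h : ∀ m : List (Fin d ⊕ Fin d), m.length ≤ d + 1 → ‖act (stdBasis d) m f x‖ ≤ R) :
    ‖f x‖ ≤ (d + 1) ^ (d + 1) * R * jap x := by
  have h1 := decay_coord (b := stdBasis d) Finset.univ x (d + 1) f R h
  rw [jap, ← div_eq_mul_inv, le_div_iff₀ (by positivity), mul_comm]
  simp only [stdBasis_repr, Finset.card_univ, Fintype.card_fin] at h1
  refine le_trans ?_ h1
  have := norm_le_sum_abs x
  gcongr

/-- Bounds for short words give decay in the second variable, uniformly in the first. -/
lemma norm_le_jap_snd {Ψ : Rn d × Rn d → ℂ} {R : ℝ} {x t : Rn d}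
    (h : ∀ m : List ((Fin d ⊕ Fin d) ⊕ (Fin d ⊕ Fin d)), m.length ≤ d + 1 →
      ‖act (stdBasis₂ d) m Ψ (x, t)‖ ≤ R) :
    ‖Ψ (x, t)‖ ≤ (d + 1) ^ (d + 1) * R * jap t := by
  have h1 := decay_coord (b := stdBasis₂ d) (Finset.univ.map Function.Embedding.inr) (x, t) (d + 1)
    Ψ R h
  rw [jap, ← div_eq_mul_inv, le_div_iff₀ (by positivity), mul_comm]
  simp only [Finset.sum_map, Function.Embedding.inr_apply, stdBasis₂_repr_inr, Finset.card_map,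
    Finset.card_univ, Fintype.card_fin] at h1
  refine le_trans ?_ h1
  have := norm_le_sum_abs t
  gcongr

lemma norm_le_jap_jap {Ψ : Rn d × Rn d → ℂ} {R : ℝ} {x t : Rn d}
    (h : ∀ m : List ((Fin d ⊕ Fin d) ⊕ (Fin d ⊕ Fin d)), m.length ≤ 2 * (d + 1) →
      ‖act (stdBasis₂ d) m Ψ (x, t)‖ ≤ R) :
    ‖Ψ (x, t)‖ ≤ (2 * d + 1) ^ (2 * (d + 1)) * R * (jap x * jap t) := by
  have h1 := decay_coord (b := stdBasis₂ d) Finset.univ (x, t) (2 * (d + 1)) Ψ R h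
  rw [jap, jap, ← mul_inv, ← div_eq_mul_inv, le_div_iff₀ (by positivity), mul_comm]
  simp only [Fintype.sum_sum_type, stdBasis₂_repr_inr, stdBasis₂_repr_inl,
    Finset.card_univ, Fintype.card_sum, Fintype.card_fin] at h1
  push_cast at h1
  rw [← two_mul (d : ℝ)] at h1
  refine le_trans ?_ h1
  have e1 := norm_le_sum_abs t
  have e2 := norm_le_sum_abs x
  have e3 : 0 ≤ ∑ i, |x i| := by positivity
  have e4 : 0 ≤ ∑ i, |t i| := by positivity
  rw [show 2 * (d + 1) = (d + 1) + (d + 1) by ring, pow_add (1 + (∑ i, |x i| + ∑ i, |t i|))]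
  refine mul_le_mul_of_nonneg_right (mul_le_mul (pow_le_pow_left₀ (by positivity) ?_ _)
    (pow_le_pow_left₀ (by positivity) ?_ _) (by positivity) (by positivity)) (norm_nonneg _)
  · linarith
  · linarith

lemma Rapid.exists_norm_le_jap {f : Rn d → ℂ} (hf : Rapid (stdBasis d) f) :
    ∃ C, 0 ≤ C ∧ ∀ x, ‖f x‖ ≤ C * jap x := by
  obtain ⟨R, hR, h⟩ := hf.exists_bound (d + 1)
  exact ⟨_, by positivity, fun x => norm_le_jap fun m hm => h m hm x⟩

lemma Rapid.exists_norm_le_jap_snd {Ψ : Rn d × Rn d → ℂ} (hΨ : Rapid (stdBasis₂ d) Ψ) :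
    ∃ C, 0 ≤ C ∧ ∀ x t, ‖Ψ (x, t)‖ ≤ C * jap t := by
  obtain ⟨R, hR, h⟩ := hΨ.exists_bound (d + 1)
  exact ⟨_, by positivity, fun x t => norm_le_jap_snd fun m hm => h m hm (x, t)⟩

lemma Rapid.exists_norm_le_jap_jap {Ψ : Rn d × Rn d → ℂ} (hΨ : Rapid (stdBasis₂ d) Ψ) :
    ∃ C, 0 ≤ C ∧ ∀ x t, ‖Ψ (x, t)‖ ≤ C * (jap x * jap t) := by
  obtain ⟨R, hR, h⟩ := hΨ.exists_bound (2 * (d + 1))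
  exact ⟨_, by positivity, fun x t => norm_le_jap_jap fun m hm => h m hm (x, t)⟩

lemma Rapid.integrable {f : Rn d → ℂ} (hf : Rapid (stdBasis d) f) : Integrable f := by
  obtain ⟨C, -, h⟩ := hf.exists_norm_le_jap
  exact (integrable_jap.const_mul C).mono' hf.1.continuous.aestronglyMeasurable
    (Eventually.of_forall h)

lemma Rapid.integrable_slice {Ψ : Rn d × Rn d → ℂ} (hΨ : Rapid (stdBasis₂ d) Ψ) (x : Rn d) :
    Integrable fun t => Ψ (x, t) := by
  obtain ⟨C, -, h⟩ := hΨ.exists_norm_le_jap_snd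
  exact (integrable_jap.const_mul C).mono'
    (hΨ.1.continuous.comp (by fun_prop)).aestronglyMeasurable (Eventually.of_forall (h x))

lemma Rapid.integrable₂ {Ψ : Rn d × Rn d → ℂ} (hΨ : Rapid (stdBasis₂ d) Ψ) : Integrable Ψ := by
  obtain ⟨C, -, h⟩ := hΨ.exists_norm_le_jap_jap
  exact ((integrable_jap.mul_prod integrable_jap).const_mul C).mono'
    hΨ.1.continuous.aestronglyMeasurable (Eventually.of_forall fun z => h z.1 z.2)

/-! ### Slices -/

/-- The operators on `ℝ^{2d}` that act in the second variable. -/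
def sndOp : Fin d ⊕ Fin d → (Fin d ⊕ Fin d) ⊕ (Fin d ⊕ Fin d)
  | .inl i => .inl (.inr i)
  | .inr i => .inr (.inr i)

/-- The operators on `ℝ^{2d}` that act in the first variable. -/
def fstOp : Fin d ⊕ Fin d → (Fin d ⊕ Fin d) ⊕ (Fin d ⊕ Fin d)
  | .inl i => .inl (.inl i)
  | .inr i => .inr (.inl i)

lemma contDiff_slice {Ψ : Rn d × Rn d → ℂ} (hΨ : ContDiff ℝ ∞ Ψ) (x : Rn d) :
    ContDiff ℝ ∞ fun t => Ψ (x, t) :=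
  hΨ.comp (contDiff_const.prodMk contDiff_id)

lemma op_slice {Ψ : Rn d × Rn d → ℂ} (hΨ : ContDiff ℝ ∞ Ψ) (x : Rn d) (s : Fin d ⊕ Fin d) :
    op (stdBasis d) s (fun t => Ψ (x, t)) = fun t => op (stdBasis₂ d) (sndOp s) Ψ (x, t) := by
  funext t
  cases s with
  | inl i => simp [op, sndOp]
  | inr i =>
    have h1 : HasFDerivAt (fun t => Ψ (x, t)) ((fderiv ℝ Ψ (x, t)).comp
        (ContinuousLinearMap.inr ℝ (Rn d) (Rn d))) t :=
      (hΨ.differentiable (by simp) (x, t)).hasFDerivAt.comp t (hasFDerivAt_prodMk_right x t)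
    simp only [op, sndOp]
    rw [dirDeriv_of_hasFDerivAt h1, dirDeriv, stdBasis₂_inr]
    rfl

lemma act_slice {Ψ : Rn d × Rn d → ℂ} (hΨ : ContDiff ℝ ∞ Ψ) (x : Rn d)
    (l : List (Fin d ⊕ Fin d)) : act (stdBasis d) l (fun t => Ψ (x, t)) =
      fun t => act (stdBasis₂ d) (l.map sndOp) Ψ (x, t) := by
  induction l with
  | nil => rfl
  | cons s l ih => rw [act_cons, ih, op_slice (contDiff_act _ hΨ), List.map_cons, act_cons]

lemma Rapid.slice {Ψ : Rn d × Rn d → ℂ} (hΨ : Rapid (stdBasis₂ d) Ψ) (x : Rn d) :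
    Rapid (stdBasis d) fun t => Ψ (x, t) := by
  refine ⟨contDiff_slice hΨ.1 x, fun l => ?_⟩
  obtain ⟨C, hC⟩ := hΨ.2 (l.map sndOp)
  exact ⟨C, fun t => by rw [act_slice hΨ.1]; exact hC _⟩

/-! ### The partial Fourier transform -/

open FourierTransform RealInnerProductSpace

/-- The Fourier transform in the second variable. -/
def pFT (Φ : Rn d × Rn d → ℂ) : Rn d × Rn d → ℂ := fun z => 𝓕 (fun t => Φ (z.1, t)) z.2

lemma pFT_apply (Φ : Rn d × Rn d → ℂ) (z : Rn d × Rn d) :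
    pFT Φ z = ∫ t, Complex.exp (↑(-2 * Real.pi * ⟪t, z.2⟫) * Complex.I) * Φ (z.1, t) := by
  rw [pFT, Real.fourier_eq']; rfl

lemma pFT_smul (a : ℂ) (Φ : Rn d × Rn d → ℂ) : pFT (a • Φ) = a • pFT Φ := by
  funext z
  simp only [pFT_apply, Pi.smul_apply, smul_eq_mul]
  rw [← integral_const_mul]
  refine integral_congr_ae (Eventually.of_forall fun t => ?_)
  ring_nf

/-- The operator whose image under the partial Fourier transform is a multiple of the given one. -/
def ftOp : (Fin d ⊕ Fin d) ⊕ (Fin d ⊕ Fin d) → (Fin d ⊕ Fin d) ⊕ (Fin d ⊕ Fin d)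
  | .inl (.inl i) => .inl (.inl i)
  | .inl (.inr i) => .inr (.inr i)
  | .inr (.inl i) => .inr (.inl i)
  | .inr (.inr i) => .inl (.inr i)

/-- The factor with which the partial Fourier transform intertwines `P` and `ftOp P`. -/
def ftCoeff : (Fin d ⊕ Fin d) ⊕ (Fin d ⊕ Fin d) → ℂ
  | .inl (.inl _) => 1
  | .inl (.inr _) => (2 * Real.pi * Complex.I)⁻¹
  | .inr (.inl _) => 1
  | .inr (.inr _) => -(2 * Real.pi * Complex.I)

lemma norm_pFT_le {Φ : Rn d × Rn d → ℂ} {R : ℝ}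
    (h : ∀ m : List ((Fin d ⊕ Fin d) ⊕ (Fin d ⊕ Fin d)), m.length ≤ d + 1 → ∀ z,
      ‖act (stdBasis₂ d) m Φ z‖ ≤ R) (z : Rn d × Rn d) :
    ‖pFT Φ z‖ ≤ ((d + 1) ^ (d + 1) * ∫ t : Rn d, jap t) * R := by
  rw [pFT, Real.fourier_eq]
  refine (norm_integral_le_of_norm_le (integrable_jap.const_mul ((d + 1) ^ (d + 1) * R))
    (Eventually.of_forall fun t => ?_)).trans (le_of_eq ?_)
  · rw [Circle.norm_smul]
    exact norm_le_jap_snd fun m hm => h m hm _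
  · rw [integral_const_mul]; ring

lemma norm_ofPartials_le {ι : Type} [Fintype ι] {E : Type} [NormedAddCommGroup E] [NormedSpace ℝ E]
    (b : Module.Basis ι ℝ E) :
    ∃ K, 0 ≤ K ∧ ∀ (c : ι → ℂ) (B : ℝ), (∀ s, ‖c s‖ ≤ B) → ‖ofPartials b c‖ ≤ K * B := by
  refine ⟨∑ s, ‖coordL b s‖, by positivity, fun c B hB => ?_⟩
  rw [Finset.sum_mul]
  refine (norm_sum_le _ _).trans (Finset.sum_le_sum fun s _ => ?_)
  rw [ContinuousLinearMap.norm_smulRight_apply]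
  exact mul_le_mul_of_nonneg_left (hB s) (norm_nonneg _)

lemma Rapid.integrable_fderiv {f : Rn d → ℂ} (hf : Rapid (stdBasis d) f) :
    Integrable (fderiv ℝ f) := by
  obtain ⟨K, -, hK⟩ := norm_ofPartials_le (stdBasis d)
  choose C hC0 hC using fun i => (hf.op (.inr i)).exists_norm_le_jap
  refine ((integrable_jap.const_mul (∑ i, C i)).const_mul K).mono'
    (hf.1.continuous_fderiv (by simp)).aestronglyMeasurable (Eventually.of_forall fun x => ?_)
  rw [fderiv_eq_ofPartials (b := stdBasis d)]
  refine hK _ _ fun i => (hC i x).trans (mul_le_mul_of_nonneg_right ?_ (jap_pos x).le)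
  exact Finset.single_le_sum (f := C) (fun s _ => hC0 s) (Finset.mem_univ i)

/-- Differentiation under the integral. The partial derivatives are again partial Fourier transforms
of rapidly decreasing functions, which gives smoothness by `contDiff_of_closed`. -/
lemma hasFDerivAt_pFT {Φ : Rn d × Rn d → ℂ} (hΦ : Rapid (stdBasis₂ d) Φ) (z : Rn d × Rn d) :
    HasFDerivAt (pFT Φ) (ofPartials (stdBasis₂ d) fun s =>
      ftCoeff (.inr s) * pFT (op (stdBasis₂ d) (ftOp (.inr s)) Φ) z) z := by
  set e : Rn d × Rn d → Rn d → ℂ := fun z t =>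
    Complex.exp (↑(-2 * Real.pi * ⟪t, z.2⟫) * Complex.I) with he
  have hec : ∀ z, Continuous (e z) := fun z => by
    simp only [he]; fun_prop
  have hen : ∀ z t, ‖e z t‖ = 1 := fun z t => Complex.norm_exp_ofReal_mul_I _
  set g : Fin d ⊕ Fin d → Rn d × Rn d → ℂ := fun s =>
    ftCoeff (.inr s) • op (stdBasis₂ d) (ftOp (.inr s)) Φ with hg
  have hgr : ∀ s, Rapid (stdBasis₂ d) (g s) := fun s => (hΦ.op _).smul _
  choose C hC0 hC using fun s => (hgr s).exists_norm_le_jap_snd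
  obtain ⟨K, hK0, hK⟩ := norm_ofPartials_le (stdBasis₂ d)
  set F' : Rn d × Rn d → Rn d → (Rn d × Rn d) →L[ℝ] ℂ := fun z t =>
    ofPartials (stdBasis₂ d) fun s => e z t * g s (z.1, t) with hF'
  have hint : ∀ s z, Integrable fun t => e z t * g s (z.1, t) := fun s z =>
    ((hgr s).integrable_slice z.1).bdd_mul (hec z).aestronglyMeasurable
      (Eventually.of_forall fun t => (hen z t).le)
  have hF'c : ∀ z, Continuous (F' z) := fun z => by
    simp only [hF', ofPartials]
    refine continuous_finsetSum _ fun s _ => ?_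
    refine (ContinuousLinearMap.smulRightL ℝ (Rn d × Rn d) ℂ (coordL (stdBasis₂ d) s)).continuous.comp ?_
    exact (hec z).mul ((hgr s).1.continuous.comp (by fun_prop))
  have hder : ∀ t z, HasFDerivAt (fun z => e z t * Φ (z.1, t)) (F' z t) z := by
    intro t z
    have h1 : HasFDerivAt (fun z : Rn d × Rn d => (↑(-2 * Real.pi * ⟪t, z.2⟫) * Complex.I : ℂ))
        (((Complex.ofRealCLM.comp ((-2 * Real.pi) • (innerSL ℝ t).comp
          (ContinuousLinearMap.snd ℝ (Rn d) (Rn d)))).smulRight Complex.I)) z := by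
      have := (((Complex.ofRealCLM.comp ((-2 * Real.pi) • (innerSL ℝ t).comp
          (ContinuousLinearMap.snd ℝ (Rn d) (Rn d)))).smulRight Complex.I)).hasFDerivAt (x := z)
      refine this.congr_of_eventuallyEq (Eventually.of_forall fun y => ?_)
      simp
    have h2 := h1.cexp
    have h3 : HasFDerivAt (fun z : Rn d × Rn d => Φ (z.1, t)) ((fderiv ℝ Φ (z.1, t)).comp
        ((ContinuousLinearMap.fst ℝ (Rn d) (Rn d)).prod 0)) z :=
      (hΦ.1.differentiable (by simp) (z.1, t)).hasFDerivAt.comp z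
        (hasFDerivAt_fst.prodMk (hasFDerivAt_const _ _))
    refine (h2.mul h3).congr_fderiv (ContinuousLinearMap.ext fun v => ?_)
    have h4 : fderiv ℝ Φ (z.1, t) (v.1, 0) =
        ∑ i, (v.1 i : ℂ) * op (stdBasis₂ d) (.inr (.inl i)) Φ (z.1, t) := by
      rw [fderiv_eq_sum (b := stdBasis₂ d)]
      simp
    have h5 : (⟪t, v.2⟫ : ℂ) = ∑ i, (v.2 i : ℂ) * (t i : ℂ) := by
      rw [PiLp.inner_apply]; simp
    simp only [hF', ofPartials_apply, Fintype.sum_sum_type, stdBasis₂_repr_inl, stdBasis₂_repr_inr,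
      hg, ftCoeff, ftOp, Pi.smul_apply, smul_eq_mul, add_apply, smul_apply,
      ContinuousLinearMap.comp_apply, ContinuousLinearMap.prod_apply, zero_apply,
      ContinuousLinearMap.coe_fst', h4, ContinuousLinearMap.smulRight_apply,
      ContinuousLinearMap.coe_snd', Complex.ofRealCLM_apply, innerSL_apply_apply]
    push_cast
    rw [h5, Finset.mul_sum]
    congr 1
    · exact Finset.sum_congr rfl fun i _ => by simp only [he]; push_cast; ring
    · rw [Finset.mul_sum, Finset.sum_mul, Finset.mul_sum, Finset.mul_sum]
      exact Finset.sum_congr rfl fun i _ => by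
        simp only [he, op, stdBasis₂_repr_inr]; push_cast; ring
  have hmain := hasFDerivAt_integral_of_dominated_of_fderiv_le (𝕜 := ℝ) (μ := volume)
    (F := fun z t => e z t * Φ (z.1, t)) (F' := F') (x₀ := z) (s := Set.univ)
    (bound := fun t => K * ((∑ s, C s) * jap t)) univ_mem
    (Eventually.of_forall fun z => ((hec z).mul
      (hΦ.1.continuous.comp (by fun_prop))).aestronglyMeasurable)
    ((hΦ.integrable_slice z.1).bdd_mul (hec z).aestronglyMeasurable
      (Eventually.of_forall fun t => (hen z t).le))
    (hF'c z).aestronglyMeasurable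
    (Eventually.of_forall fun t z _ => hK _ _ fun s => by
      rw [norm_mul, hen, one_mul]
      refine (hC s z.1 t).trans (mul_le_mul_of_nonneg_right ?_ (jap_pos t).le)
      exact Finset.single_le_sum (f := C) (fun s _ => hC0 s) (Finset.mem_univ s))
    ((integrable_jap.const_mul _).const_mul _)
    (Eventually.of_forall fun t z _ => hder t z)
  have hfun : pFT Φ = fun z => ∫ t, e z t * Φ (z.1, t) := by
    funext z; rw [pFT_apply]
  rw [hfun]
  refine hmain.congr_fderiv ?_
  simp only [hF', ofPartials]
  rw [integral_finsetSum]
  · refine Finset.sum_congr rfl fun s _ => ?_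
    have := (ContinuousLinearMap.smulRightL ℝ (Rn d × Rn d) ℂ
      (coordL (stdBasis₂ d) s)).integral_comp_comm (hint s z)
    refine Eq.trans this ?_
    have h5 : ∫ t, e z t * g s (z.1, t) =
        ftCoeff (.inr s) * pFT (op (stdBasis₂ d) (ftOp (.inr s)) Φ) z := by
      rw [pFT_apply, ← integral_const_mul]
      refine integral_congr_ae (Eventually.of_forall fun t => ?_)
      simp only [hg, he, Pi.smul_apply, smul_eq_mul]; ring
    rw [h5]; rfl
  · intro s _
    exact (ContinuousLinearMap.smulRightL ℝ (Rn d × Rn d) ℂ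
      (coordL (stdBasis₂ d) s)).integrable_comp (hint s z)

lemma contDiff_pFT {Φ : Rn d × Rn d → ℂ} (hΦ : Rapid (stdBasis₂ d) Φ) : ContDiff ℝ ∞ (pFT Φ) := by
  refine contDiff_of_closed (b := stdBasis₂ d) {F | ∃ Φ, Rapid (stdBasis₂ d) Φ ∧ F = pFT Φ} ?_
    ⟨Φ, hΦ, rfl⟩
  rintro _ ⟨Φ, hΦ, rfl⟩
  refine ⟨fun s => pFT (ftCoeff (.inr s) • op (stdBasis₂ d) (ftOp (.inr s)) Φ),
    fun s => ⟨_, (hΦ.op _).smul _, rfl⟩, fun z => ?_⟩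
  refine (hasFDerivAt_pFT hΦ z).congr_fderiv ?_
  congr 1
  funext s
  simp only [pFT_smul, Pi.smul_apply, smul_eq_mul]

/-- The partial Fourier transform intertwines the elementary operators. -/
lemma op_pFT {Φ : Rn d × Rn d → ℂ} (hΦ : Rapid (stdBasis₂ d) Φ)
    (P : (Fin d ⊕ Fin d) ⊕ (Fin d ⊕ Fin d)) :
    op (stdBasis₂ d) P (pFT Φ) = ftCoeff P • pFT (op (stdBasis₂ d) (ftOp P) Φ) := by
  funext z
  rcases P with (i | i) | s
  · simp only [op, ftCoeff, ftOp, one_smul]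
    rw [pFT_apply, pFT_apply, ← integral_const_mul]
    refine integral_congr_ae (Eventually.of_forall fun t => ?_)
    simp only [stdBasis₂_repr_inl]; ring
  · have hs := hΦ.slice z.1
    have hD := hs.integrable_fderiv
    have h1 := congrFun (Real.fourier_fderiv hs.integrable (hs.1.differentiable (by simp)) hD) z.2
    have h2 := congrArg (fun L => L (stdBasis d i)) h1
    rw [Real.fourier_continuousLinearMap_apply hD] at h2
    have h3 : (fun t => fderiv ℝ (fun t => Φ (z.1, t)) t (stdBasis d i)) =
        fun t => op (stdBasis₂ d) (.inr (.inr i)) Φ (z.1, t) := op_slice hΦ.1 z.1 (.inr i)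
    rw [h3] at h2
    have h4 : ⟪z.2, stdBasis d i⟫ = z.2 i := by
      rw [stdBasis, OrthonormalBasis.coe_toBasis, EuclideanSpace.basisFun_apply,
        EuclideanSpace.inner_single_right]
      simp
    simp only [op, ftCoeff, ftOp, stdBasis₂_repr_inr, Pi.smul_apply, smul_eq_mul]
    rw [pFT, pFT, eq_inv_mul_iff_mul_eq₀ (by simp [Real.pi_ne_zero])]
    refine Eq.trans ?_ h2.symm
    rw [VectorFourier.fourierSMulRight, smul_apply, ContinuousLinearMap.smulRight_apply, neg_apply,
      neg_apply, innerSL_apply_apply, h4]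
    simp only [smul_eq_mul, Complex.real_smul]
    push_cast; ring
  · exact (dirDeriv_of_hasFDerivAt (hasFDerivAt_pFT hΦ z) _).trans (ofPartials_basis _ s)

/-- Fourier inversion in the second variable. -/
lemma pFT_pFT {Φ : Rn d × Rn d → ℂ} (hΦ : Rapid (stdBasis₂ d) Φ)
    (hΦ' : Rapid (stdBasis₂ d) (pFT Φ)) (z : Rn d × Rn d) : pFT (pFT Φ) z = Φ (z.1, -z.2) := by
  have h1 : 𝓕⁻ (𝓕 fun t => Φ (z.1, t)) = fun t => Φ (z.1, t) :=
    (contDiff_slice hΦ.1 z.1).continuous.fourierInv_fourier_eq (hΦ.integrable_slice z.1)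
      (hΦ'.integrable_slice z.1)
  have h2 := congrFun h1 (-z.2)
  rwa [Real.fourierInv_eq_fourier_neg, neg_neg] at h2

lemma integral_fourier_mul {f g : Rn d → ℂ} (hf : Integrable f) (hg : Integrable g) :
    ∫ w, 𝓕 f w * g w = ∫ t, f t * 𝓕 g t := by
  have := VectorFourier.integral_fourierIntegral_smul_eq_flip (μ := volume) (ν := volume)
    (L := innerₗ (Rn d)) Real.continuous_fourierChar continuous_inner hf hg
  rwa [flip_innerₗ] at this

/-- The partial Fourier transform is symmetric with respect to the bilinear pairing. -/
lemma integral_pFT_mul {Φ Ψ : Rn d × Rn d → ℂ} (hΦ : Rapid (stdBasis₂ d) Φ)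
    (hΦ' : Rapid (stdBasis₂ d) (pFT Φ)) (hΨ : Rapid (stdBasis₂ d) Ψ)
    (hΨ' : Rapid (stdBasis₂ d) (pFT Ψ)) : ∫ z, pFT Φ z * Ψ z = ∫ z, Φ z * pFT Ψ z := by
  obtain ⟨C, hC⟩ := hΨ.2 []
  obtain ⟨C', hC'⟩ := hΨ'.2 []
  have h1 : Integrable fun z => pFT Φ z * Ψ z :=
    hΦ'.integrable₂.mul_bdd (c := C) hΨ.1.continuous.aestronglyMeasurable (Eventually.of_forall hC)
  have h2 : Integrable fun z => Φ z * pFT Ψ z :=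
    hΦ.integrable₂.mul_bdd (c := C') hΨ'.1.continuous.aestronglyMeasurable
      (Eventually.of_forall hC')
  rw [Measure.volume_eq_prod] at h1 h2 ⊢
  rw [integral_prod _ h1, integral_prod _ h2]
  congr 1
  funext x
  exact integral_fourier_mul (hΦ.integrable_slice x) (hΨ.integrable_slice x)

end

section

variable {d : ℕ} {M N : WeightSeq}

/-! ### The types of the operators on `ℝ^d` and `ℝ^{2d}` -/

/-- On `ℝ^{2d}`, the types for the space in which `TFR (f, g)` lies: `x` and `∂_ω` are counted by
`M`, while `ω` and `∂_x` are counted by `N`. The partial Fourier transform leads to it from the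
space in which both coordinates are counted by `M` and both derivatives by `N`, whose types are
given by `Sum.isLeft`. -/
def mixType : (Fin d ⊕ Fin d) ⊕ (Fin d ⊕ Fin d) → Bool
  | .inl (.inl _) => true
  | .inl (.inr _) => false
  | .inr (.inl _) => false
  | .inr (.inr _) => true

lemma compat_GS (M N : WeightSeq) :
    Compat (Sum.isLeft (α := Fin d) (β := Fin d)) (weight d M) (weight d N) M N where
  swap i := rfl
  le α β := by simp [weight, cnt]
  ge := ⟨1, 1, one_pos, le_rfl, fun α β => by simp [weight, cnt]⟩

lemma exists_four_le (M N : WeightSeq) : ∃ K H : ℝ, 0 < K ∧ 1 ≤ H ∧ ∀ p p' q q',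
    M.M (p + p') * N.M (q + q') ≤
      K * H ^ (p + p' + (q + q')) * ((M.M p * M.M p') * (N.M q * N.M q')) := by
  obtain ⟨K, κ, hK, hκ, h⟩ := exists_wtc_add_le M N
  refine ⟨K, κ, by positivity, hκ, fun p p' q q' => ?_⟩
  have := h 1 one_pos p q p' q'
  simp only [wtc, one_pow, one_mul, mul_one] at this
  refine this.trans (le_of_eq ?_)
  simp only [pow_add]; ring

lemma compat_GS₂ (M N : WeightSeq) :
    Compat (Sum.isLeft (α := Fin d ⊕ Fin d) (β := Fin d ⊕ Fin d))
      (weight₂ d M M) (weight₂ d N N) M N where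
  swap i := rfl
  le α β := by
    simp only [weight₂, cnt, Sum.isLeft_inl, Sum.isLeft_inr, if_true, Bool.false_eq_true, if_false,
      add_zero, zero_add, Fintype.sum_sum_type, Bool.not_true, Bool.not_false]
    have := N.pos (∑ i, β (.inl i) + ∑ i, β (.inr i))
    have := N.pos (∑ i, β (.inl i))
    have := N.pos (∑ i, β (.inr i))
    have := M.pos (∑ i, α (.inl i) + ∑ i, α (.inr i))
    exact mul_le_mul (M.mul_le_add _ _) (N.mul_le_add _ _) (by positivity) (by positivity)
  ge := by
    obtain ⟨K, H, hK, hH, h⟩ := exists_four_le M N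
    refine ⟨K, H, hK, hH, fun α β => ?_⟩
    simp only [weight₂, cnt, Sum.isLeft_inl, Sum.isLeft_inr, if_true, Bool.false_eq_true, if_false,
      add_zero, zero_add, Fintype.sum_sum_type, Bool.not_true, Bool.not_false]
    exact h _ _ _ _

/-- By (M.2) the weights `M_{|α₁|} N_{|α₂|} N_{|β₁|} M_{|β₂|}` are equivalent to
`M_{|α₁| + |β₂|} N_{|α₂| + |β₁|}`, up to geometric factors. -/
lemma compat_mix (M N : WeightSeq) :
    Compat (mixType (d := d)) (weight₂ d M N) (weight₂ d N M) M N where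
  swap i := by cases i <;> rfl
  le α β := by
    simp only [weight₂, cnt, mixType, if_true, Bool.false_eq_true, if_false,
      add_zero, zero_add, Fintype.sum_sum_type, Bool.not_true, Bool.not_false]
    have := N.pos (∑ i, α (.inr i) + ∑ i, β (.inl i))
    have := N.pos (∑ i, α (.inr i))
    have := N.pos (∑ i, β (.inl i))
    have := M.pos (∑ i, α (.inl i) + ∑ i, β (.inr i))
    rw [add_comm (∑ i, β (.inl i))]
    calc _ = (M.M (∑ i, α (.inl i)) * M.M (∑ i, β (.inr i))) *
          (N.M (∑ i, α (.inr i)) * N.M (∑ i, β (.inl i))) := by ring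
      _ ≤ _ := mul_le_mul (M.mul_le_add _ _) (N.mul_le_add _ _) (by positivity) (by positivity)
  ge := by
    obtain ⟨K, H, hK, hH, h⟩ := exists_four_le M N
    refine ⟨K, H, hK, hH, fun α β => ?_⟩
    simp only [weight₂, cnt, mixType, if_true, Bool.false_eq_true, if_false,
      add_zero, zero_add, Fintype.sum_sum_type, Bool.not_true, Bool.not_false]
    rw [add_comm (∑ i, β (.inl i)) (∑ i, α (.inr i))]
    refine (h _ _ _ _).trans (le_of_eq ?_)
    simp only [pow_add]; ring

/-! ### Isomorphisms between Gelfand-Shilov spaces -/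

section WTame

variable {ι ι' ι'' : Type} [Fintype ι] [Fintype ι'] [Fintype ι'']
  {E E' E'' : Type} [NormedAddCommGroup E] [NormedSpace ℝ E]
  [NormedAddCommGroup E'] [NormedSpace ℝ E'] [NormedAddCommGroup E''] [NormedSpace ℝ E'']
  {b : Module.Basis ι ℝ E} {b' : Module.Basis ι' ℝ E'} {b'' : Module.Basis ι'' ℝ E''}
  {τ : ι ⊕ ι → Bool} {τ' : ι' ⊕ ι' → Bool} {τ'' : ι'' ⊕ ι'' → Bool}

/-- The operator `U` preserves the estimates for words, the parameter changing at most by a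
constant factor. -/
def WTame (b : Module.Basis ι ℝ E) (τ : ι ⊕ ι → Bool) (b' : Module.Basis ι' ℝ E')
    (τ' : ι' ⊕ ι' → Bool) (M N : WeightSeq) (U : (E → ℂ) → E' → ℂ) : Prop :=
  ∃ κ : ℝ, 0 < κ ∧ ∀ A, 0 < A → ∃ K : ℝ, 0 ≤ K ∧ ∀ C f, WBound b τ M N A C f →
    WBound b' τ' M N (κ * A) (K * C) (U f)

lemma WTame.comp {U : (E → ℂ) → E' → ℂ} {V : (E' → ℂ) → E'' → ℂ}
    (hV : WTame b' τ' b'' τ'' M N V) (hU : WTame b τ b' τ' M N U) :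
    WTame b τ b'' τ'' M N fun f => V (U f) := by
  obtain ⟨κ, hκ, h⟩ := hU
  obtain ⟨κ', hκ', h'⟩ := hV
  refine ⟨κ' * κ, by positivity, fun A hA => ?_⟩
  obtain ⟨K, hK, h⟩ := h A hA
  obtain ⟨K', hK', h'⟩ := h' (κ * A) (by positivity)
  refine ⟨K' * K, by positivity, fun C f hf => ?_⟩
  rw [mul_assoc κ', mul_assoc K']
  exact h' _ _ (h _ _ hf)

lemma WTame.smul {U : (E → ℂ) → E' → ℂ} (hU : WTame b τ b' τ' M N U) (a : ℂ) :
    WTame b τ b' τ' M N fun f => a • U f := by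
  obtain ⟨κ, hκ, h⟩ := hU
  refine ⟨κ, hκ, fun A hA => ?_⟩
  obtain ⟨K, hK, h⟩ := h A hA
  refine ⟨‖a‖ * K, by positivity, fun C f hf => ?_⟩
  rw [mul_assoc]
  exact (h _ _ hf).smul a

lemma WTame.tame {U : (E → ℂ) → E' → ℂ} (hU : WTame b τ b' τ' M N U) (c : GSType) :
    c.Tame fun A A' => ∃ K : ℝ, 0 ≤ K ∧ ∀ C f, WBound b τ M N A C f →
      WBound b' τ' M N A' (K * C) (U f) :=
  let ⟨_, hκ, h⟩ := hU
  GSType.tame_of_linear hκ h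

lemma WTame.quant {U : (E → ℂ) → E' → ℂ} (hU : WTame b τ b' τ' M N U) {c : GSType} {f : E → ℂ}
    (hf : c.quant₁ fun A => ∃ C, WBound b τ M N A C f) :
    c.quant₁ fun A => ∃ C, WBound b' τ' M N A C (U f) :=
  (hU.tame c).quant₁ hf fun _ _ _ _ ⟨K, _, hK⟩ ⟨C, hC⟩ => ⟨K * C, hK C f hC⟩

/-- Linear changes of variables preserve the estimates if all coordinates have the same type. -/
lemma wtame_comp_linear (b : Module.Basis ι ℝ E) (b' : Module.Basis ι' ℝ E') (L : E' ≃L[ℝ] E) :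
    WTame b Sum.isLeft b' Sum.isLeft M N fun f => f ∘ L := by
  classical
  refine WBound.transfer M N (fun f => f ∘ L) (fun P Q => match P, Q with
    | .inl i, .inl j => (b'.repr (L.symm (b j)) i : ℂ)
    | .inr i, .inr j => (b.repr (L (b' i)) j : ℂ)
    | _, _ => 0) 0 1 ?_ ?_ ?_ ?_
  · rintro (i | i) (j | j) h <;> simp_all
  · exact fun f hf => hf.1.comp L.contDiff
  · intro f hf P
    funext y
    rw [Finset.sum_apply, Fintype.sum_sum_type]
    cases P with
    | inl i =>
      simp only [op, Pi.smul_apply, Function.comp_apply, smul_eq_mul, zero_mul,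
        Finset.sum_const_zero, add_zero]
      have h1 : b'.repr y i = ∑ j, b'.repr (L.symm (b j)) i * b.repr (L y) j := by
        have h2 : y = L.symm (∑ j, b.repr (L y) j • b j) := by
          rw [b.sum_repr, L.symm_apply_apply]
        conv_lhs => rw [h2]
        simp only [map_sum, map_smul, Finsupp.finsetSum_apply, Finsupp.smul_apply, smul_eq_mul]
        exact Finset.sum_congr rfl fun j _ => mul_comm _ _
      rw [h1]
      push_cast
      rw [Finset.sum_mul]
      exact Finset.sum_congr rfl fun j _ => by ring
    | inr i =>
      have h1 : HasFDerivAt (f ∘ L) ((fderiv ℝ f (L y)).comp (L : E' →L[ℝ] E)) y :=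
        (hf.1.differentiable (by simp) (L y)).hasFDerivAt.comp y L.hasFDerivAt
      simp only [Pi.smul_apply, Function.comp_apply, smul_eq_mul, zero_mul, Finset.sum_const_zero,
        zero_add]
      exact (dirDeriv_of_hasFDerivAt h1 _).trans (fderiv_eq_sum (b := b) f (L y) (L (b' i)))
  · intro f hf R h y
    simpa using h [] le_rfl (L y)

end WTame

/-- The partial Fourier transform preserves the estimates, exchanging the types in the second
variable. -/
lemma wtame_pFT (τ τ' : (Fin d ⊕ Fin d) ⊕ (Fin d ⊕ Fin d) → Bool)
    (h : ∀ P, τ (ftOp P) = τ' P) : WTame (stdBasis₂ d) τ (stdBasis₂ d) τ' M N pFT := by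
  refine WBound.transfer M N pFT (fun P Q => if Q = ftOp P then ftCoeff P else 0) (d + 1)
    ((d + 1) ^ (d + 1) * ∫ t : Rn d, jap t) ?_ ?_ ?_ ?_
  · intro P Q hPQ
    have : Q = ftOp P := by by_contra hne; simp [hne] at hPQ
    rw [this, h]
  · exact fun f hf => contDiff_pFT hf
  · intro f hf P
    rw [op_pFT hf]
    simp
  · exact fun f hf R hR y => norm_pFT_le hR y

lemma wtame_pFT_mix : WTame (stdBasis₂ d) Sum.isLeft (stdBasis₂ d) mixType M N pFT :=
  wtame_pFT _ _ (by rintro ((i | i) | (i | i)) <;> rfl)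

lemma wtame_pFT_unmix : WTame (stdBasis₂ d) mixType (stdBasis₂ d) Sum.isLeft M N pFT :=
  wtame_pFT _ _ (by rintro ((i | i) | (i | i)) <;> rfl)

/-! ### Complex conjugation and tensor products -/

/-- The pointwise complex conjugate. -/
def cj {E : Type} (f : E → ℂ) : E → ℂ := fun x => starRingEnd ℂ (f x)

@[simp] lemma cj_cj {E : Type} (f : E → ℂ) : cj (cj f) = f := by funext x; simp [cj]

lemma cj_add {E : Type} (f g : E → ℂ) : cj (f + g) = cj f + cj g := by funext x; simp [cj]

lemma cj_smul {E : Type} (a : ℂ) (f : E → ℂ) : cj (a • f) = starRingEnd ℂ a • cj f := by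
  funext x; simp [cj]

section Conj

variable {ι : Type} [Fintype ι] {E : Type} [NormedAddCommGroup E] [NormedSpace ℝ E]
  {b : Module.Basis ι ℝ E} {τ : ι ⊕ ι → Bool}

lemma contDiff_cj {f : E → ℂ} (hf : ContDiff ℝ ∞ f) : ContDiff ℝ ∞ (cj f) :=
  Complex.conjCLE.contDiff.comp hf

lemma act_cj {f : E → ℂ} (hf : ContDiff ℝ ∞ f) (l : List (ι ⊕ ι)) :
    act b l (cj f) = cj (act b l f) := by
  induction l with
  | nil => rfl
  | cons s l ih =>
    rw [act_cons, act_cons, ih]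
    funext x
    cases s with
    | inl i => simp [op, cj]
    | inr i =>
      have h1 : HasFDerivAt (cj (act b l f)) ((Complex.conjCLE : ℂ →L[ℝ] ℂ).comp
          (fderiv ℝ (act b l f) x)) x :=
        Complex.conjCLE.hasFDerivAt.comp x
          ((contDiff_act l hf).differentiable (by simp) x).hasFDerivAt
      exact dirDeriv_of_hasFDerivAt h1 _

lemma WBound.cj {A C : ℝ} {f : E → ℂ} (hf : WBound b τ M N A C f) :
    WBound b τ M N A C (cj f) := by
  refine ⟨contDiff_cj hf.1, fun l x => ?_⟩
  rw [act_cj hf.1]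
  simpa [GelfandShilov.cj] using hf.2 l x

end Conj

/-- The tensor product `(x, y) ↦ f x * g y`. -/
def tensor (f g : Rn d → ℂ) : Rn d × Rn d → ℂ := fun z => f z.1 * g z.2

lemma contDiff_tensor {f g : Rn d → ℂ} (hf : ContDiff ℝ ∞ f) (hg : ContDiff ℝ ∞ g) :
    ContDiff ℝ ∞ (tensor f g) :=
  (hf.comp contDiff_fst).mul (hg.comp contDiff_snd)

lemma op_tensor {f g : Rn d → ℂ} (hf : ContDiff ℝ ∞ f) (hg : ContDiff ℝ ∞ g)
    (P : (Fin d ⊕ Fin d) ⊕ (Fin d ⊕ Fin d)) :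
    (∃ s, P = fstOp s ∧ op (stdBasis₂ d) P (tensor f g) = tensor (op (stdBasis d) s f) g) ∨
    (∃ s, P = sndOp s ∧ op (stdBasis₂ d) P (tensor f g) = tensor f (op (stdBasis d) s g)) := by
  have h : ∀ z, HasFDerivAt (tensor f g) (f z.1 • (fderiv ℝ g z.2).comp
      (ContinuousLinearMap.snd ℝ (Rn d) (Rn d)) + g z.2 • (fderiv ℝ f z.1).comp
      (ContinuousLinearMap.fst ℝ (Rn d) (Rn d))) z := fun z =>
    ((hf.differentiable (by simp) z.1).hasFDerivAt.comp z hasFDerivAt_fst).mul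
      ((hg.differentiable (by simp) z.2).hasFDerivAt.comp z hasFDerivAt_snd)
  rcases P with (i | i) | (i | i)
  · exact Or.inl ⟨.inl i, rfl, by funext z; simp [op, tensor, mul_assoc]⟩
  · exact Or.inr ⟨.inl i, rfl, funext fun z => by
      simp only [op, tensor, stdBasis₂_repr_inr, stdBasis_repr]; ring⟩
  · refine Or.inl ⟨.inr i, rfl, ?_⟩
    funext z
    refine (dirDeriv_of_hasFDerivAt (h z) _).trans ?_
    rw [stdBasis₂_inl]
    simp [op, tensor, dirDeriv, mul_comm]
  · refine Or.inr ⟨.inr i, rfl, ?_⟩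
    funext z
    refine (dirDeriv_of_hasFDerivAt (h z) _).trans ?_
    rw [stdBasis₂_inr]
    simp [op, tensor, dirDeriv]

@[simp] lemma isLeft_fstOp (s : Fin d ⊕ Fin d) : (fstOp s).isLeft = s.isLeft := by
  cases s <;> rfl

@[simp] lemma isLeft_sndOp (s : Fin d ⊕ Fin d) : (sndOp s).isLeft = s.isLeft := by
  cases s <;> rfl

lemma act_tensor {f g : Rn d → ℂ} (hf : ContDiff ℝ ∞ f) (hg : ContDiff ℝ ∞ g)
    (l : List ((Fin d ⊕ Fin d) ⊕ (Fin d ⊕ Fin d))) : ∃ l₁ l₂,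
      act (stdBasis₂ d) l (tensor f g) = tensor (act (stdBasis d) l₁ f) (act (stdBasis d) l₂ g) ∧
      nT Sum.isLeft l = nT Sum.isLeft l₁ + nT Sum.isLeft l₂ ∧
      nF Sum.isLeft l = nF Sum.isLeft l₁ + nF Sum.isLeft l₂ := by
  induction l with
  | nil => exact ⟨[], [], rfl, rfl, rfl⟩
  | cons P l ih =>
    obtain ⟨l₁, l₂, h, h1, h2⟩ := ih
    rw [act_cons, h]
    rcases op_tensor (contDiff_act (b := stdBasis d) l₁ hf) (contDiff_act (b := stdBasis d) l₂ hg) P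
      with ⟨s, rfl, hs⟩ | ⟨s, rfl, hs⟩
    · exact ⟨s :: l₁, l₂, hs, by rw [nT_cons, nT_cons, h1, isLeft_fstOp]; omega,
        by rw [nF_cons, nF_cons, h2, isLeft_fstOp]; omega⟩
    · exact ⟨l₁, s :: l₂, hs, by rw [nT_cons, nT_cons, h1, isLeft_sndOp]; omega,
        by rw [nF_cons, nF_cons, h2, isLeft_sndOp]; omega⟩

lemma WBound.tensor {A C D : ℝ} (hA : 0 < A) {f g : Rn d → ℂ}
    (hf : WBound (stdBasis d) Sum.isLeft M N A C f)
    (hg : WBound (stdBasis d) Sum.isLeft M N A D g) :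
    WBound (stdBasis₂ d) Sum.isLeft M N A (C * D) (tensor f g) := by
  refine ⟨contDiff_tensor hf.1 hg.1, fun l z => ?_⟩
  obtain ⟨l₁, l₂, h, h1, h2⟩ := act_tensor hf.1 hg.1 l
  rw [h, h1, h2, GelfandShilov.tensor, norm_mul]
  have e1 := hf.nonneg
  have e2 := hg.nonneg
  have e3 := wtc_pos (M := M) (N := N) hA (nT Sum.isLeft l₁) (nF Sum.isLeft l₁)
  calc _ ≤ (C * wtc M N A (nT Sum.isLeft l₁) (nF Sum.isLeft l₁)) *
        (D * wtc M N A (nT Sum.isLeft l₂) (nF Sum.isLeft l₂)) :=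
        mul_le_mul (hf.2 _ _) (hg.2 _ _) (norm_nonneg _) (by positivity)
    _ = C * D * (wtc M N A (nT Sum.isLeft l₁) (nF Sum.isLeft l₁) *
        wtc M N A (nT Sum.isLeft l₂) (nF Sum.isLeft l₂)) := by ring
    _ ≤ _ := by
      have := wtc_mul_le (M := M) (N := N) hA (nT Sum.isLeft l₁) (nF Sum.isLeft l₁)
        (nT Sum.isLeft l₂) (nF Sum.isLeft l₂)
      gcongr

/-! ### Linear changes of variables that mix the two variables -/

/-- The map `(x, t) ↦ (a x + b t, a' x + b' t)`. -/
def blockMap (a b a' b' : ℝ) : Rn d × Rn d →L[ℝ] Rn d × Rn d :=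
  (a • ContinuousLinearMap.fst ℝ (Rn d) (Rn d) + b • ContinuousLinearMap.snd ℝ (Rn d) (Rn d)).prod
    (a' • ContinuousLinearMap.fst ℝ (Rn d) (Rn d) + b' • ContinuousLinearMap.snd ℝ (Rn d) (Rn d))

lemma blockMap_apply (a b a' b' : ℝ) (z : Rn d × Rn d) :
    blockMap a b a' b' z = (a • z.1 + b • z.2, a' • z.1 + b' • z.2) := rfl

lemma blockMap_blockMap {a b a' b' D : ℝ} (hD : D ≠ 0) (h : a * b' - b * a' = D)
    (z : Rn d × Rn d) :
    blockMap (b' / D) (-b / D) (-a' / D) (a / D) (blockMap a b a' b' z) = z := by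
  simp only [blockMap_apply, smul_add, smul_smul]
  refine Prod.ext ?_ ?_ <;> ext i <;>
    simp only [PiLp.add_apply, PiLp.smul_apply, smul_eq_mul] <;> field_simp <;> rw [← h] <;> ring

/-- The map `(x, t) ↦ (a x + b t, a' x + b' t)` as an isomorphism. -/
def blockEquiv (a b a' b' : ℝ) (h : a * b' - b * a' ≠ 0) : (Rn d × Rn d) ≃L[ℝ] Rn d × Rn d :=
  ContinuousLinearEquiv.equivOfInverse (blockMap a b a' b')
    (blockMap (b' / (a * b' - b * a')) (-b / (a * b' - b * a'))
      (-a' / (a * b' - b * a')) (a / (a * b' - b * a')))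
    (blockMap_blockMap h rfl)
    (fun z => by
      set D := a * b' - b * a' with hD
      have h1 : b' / D * (a / D) - -b / D * (-a' / D) = D⁻¹ := by
        field_simp; rw [hD]; ring
      have h2 := blockMap_blockMap (inv_ne_zero h) h1 z
      have e1 : a / D / D⁻¹ = a := by field_simp
      have e2 : -(-b / D) / D⁻¹ = b := by field_simp
      have e3 : -(-a' / D) / D⁻¹ = a' := by field_simp
      have e4 : b' / D / D⁻¹ = b' := by field_simp
      rwa [e1, e2, e3, e4] at h2)

lemma blockEquiv_apply (a b a' b' : ℝ) (h : a * b' - b * a' ≠ 0) (z : Rn d × Rn d) :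
    blockEquiv a b a' b' h z = (a • z.1 + b • z.2, a' • z.1 + b' • z.2) := rfl

/-- Linear changes of variables multiply integrals by a constant, also if the integrals diverge and
both sides are zero by convention. -/
lemma exists_integral_comp (L : (Rn d × Rn d) ≃L[ℝ] Rn d × Rn d) : ∃ r : ℝ, r ≠ 0 ∧
    ∀ F : Rn d × Rn d → ℂ, ∫ z, F (L z) = r * ∫ z, F z := by
  have hdet : LinearMap.det (L : (Rn d × Rn d) →ₗ[ℝ] Rn d × Rn d) ≠ 0 :=
    (LinearEquiv.isUnit_det' L.toLinearEquiv).ne_zero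
  refine ⟨|(LinearMap.det (L : (Rn d × Rn d) →ₗ[ℝ] Rn d × Rn d))⁻¹|,
    abs_ne_zero.2 (inv_ne_zero hdet), fun F => ?_⟩
  have h1 := Measure.map_linearMap_addHaar_eq_smul_addHaar
    (volume : Measure (Rn d × Rn d)) hdet
  have h2 := L.toHomeomorph.measurableEmbedding.integral_map (μ := volume) F
  have h3 : Measure.map L.toHomeomorph (volume : Measure (Rn d × Rn d)) =
      Measure.map (L : (Rn d × Rn d) →ₗ[ℝ] Rn d × Rn d) volume := rfl
  rw [h3, h1, integral_smul_measure, ENNReal.toReal_ofReal (abs_nonneg _)] at h2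
  rw [← Complex.real_smul]
  exact h2.symm

/-! ### The representations as a partial Fourier transform of a tensor product -/

/-- Coefficients `(a, b, a', b')` such that, up to a constant, the representation is the Fourier
transform of `t ↦ f (a x + b t) * conj (g (a' x + b' t))`. -/
def coeffs : TFRKind → ℝ × ℝ × ℝ × ℝ
  | .grossmannRoyer => (1, 1 / 2, 1, -1 / 2)
  | .shortTimeFourier => (0, 1, -1, 1)
  | .crossWigner => (1, 1 / 2, 1, -1 / 2)
  | .crossAmbiguity => (1 / 2, 1, -1 / 2, 1)

lemma coeffs_det (k : TFRKind) :
    (coeffs k).1 * (coeffs k).2.2.2 - (coeffs k).2.1 * (coeffs k).2.2.1 ≠ 0 := by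
  cases k <;> norm_num [coeffs]

lemma coeffs_ne (k : TFRKind) : (coeffs k).2.1 ≠ 0 ∧ (coeffs k).2.2.2 ≠ 0 := by
  cases k <;> norm_num [coeffs]

/-- The normalizing constant of a representation. The Grossmann-Royer transform is `2^(-d)` times the
cross-Wigner distribution. -/
def tfrConst (d : ℕ) : TFRKind → ℂ
  | .grossmannRoyer => (1 / 2) ^ d
  | _ => 1

lemma tfrConst_ne (d : ℕ) (k : TFRKind) : tfrConst d k ≠ 0 := by
  cases k <;> simp [tfrConst]

/-- The change of variables attached to a representation. -/
def tfrEquiv (d : ℕ) (k : TFRKind) : (Rn d × Rn d) ≃L[ℝ] Rn d × Rn d :=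
  blockEquiv (coeffs k).1 (coeffs k).2.1 (coeffs k).2.2.1 (coeffs k).2.2.2 (coeffs_det k)

open RealInnerProductSpace in
/-- Each representation is a constant times the partial Fourier transform of `f ⊗ conj g` composed with
a linear map. No integrability is needed, since the integrals are transformed by bijective affine
changes of the variable of integration only. -/
lemma TFR_eq (k : TFRKind) (f g : Rn d → ℂ) :
    TFR k f g = tfrConst d k • pFT (tensor f (cj g) ∘ tfrEquiv d k) := by
  have hexp : ∀ w t : Rn d, Complex.exp (↑(-2 * Real.pi * ⟪t, w⟫) * Complex.I) =
      expi (-⟪w, t⟫) := by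
    intro w t
    rw [expi, real_inner_comm]
    congr 1; push_cast; ring
  have hW : TFR .crossWigner f g = pFT (tensor f (cj g) ∘ tfrEquiv d .crossWigner) := by
    funext z
    simp only [pFT_apply, hexp, TFR]
    refine integral_congr_ae (Eventually.of_forall fun t => ?_)
    simp only [Function.comp_apply, tfrEquiv, blockEquiv_apply, coeffs, tensor, cj, one_smul]
    rw [mul_assoc, sub_eq_add_neg, ← neg_smul, neg_div]
  cases k with
  | grossmannRoyer =>
    rw [show tfrEquiv d .grossmannRoyer = tfrEquiv d .crossWigner from rfl, ← hW]
    funext z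
    simp only [TFR, tfrConst, Pi.smul_apply, smul_eq_mul]
    set F : Rn d → ℂ := fun t =>
      expi (2 * ⟪z.2, t - z.1⟫) * f ((2 : ℝ) • z.1 - t) * starRingEnd ℂ (g t) with hF
    have h1 := Measure.integral_comp_smul (volume : Measure (Rn d)) (fun t => F (z.1 - t))
      (1 / 2 : ℝ)
    rw [integral_sub_left_eq_self F volume z.1, finrank_euclideanSpace_fin] at h1
    have h2 : ∫ t, F (z.1 - (1 / 2 : ℝ) • t) = ∫ t, expi (-⟪z.2, t⟫) *
        f (z.1 + (1 / 2 : ℝ) • t) * starRingEnd ℂ (g (z.1 - (1 / 2 : ℝ) • t)) := by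
      refine integral_congr_ae (Eventually.of_forall fun t => ?_)
      have e1 : z.1 - (1 / 2 : ℝ) • t - z.1 = -((1 / 2 : ℝ) • t) := by abel
      have e2 : (2 : ℝ) • z.1 - (z.1 - (1 / 2 : ℝ) • t) = z.1 + (1 / 2 : ℝ) • t := by
        rw [two_smul]; abel
      have e3 : 2 * ⟪z.2, -((1 / 2 : ℝ) • t)⟫ = -⟪z.2, t⟫ := by
        rw [inner_neg_right, real_inner_smul_right]; ring
      simp only [hF, e1, e2, e3]
    rw [← h2, h1, abs_of_pos (by positivity), Complex.real_smul]
    push_cast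
    rw [← mul_assoc, mul_inv_cancel₀ (pow_ne_zero d (by norm_num)), one_mul]
  | shortTimeFourier =>
    funext z
    simp only [tfrConst, one_smul, pFT_apply, hexp, TFR]
    refine integral_congr_ae (Eventually.of_forall fun t => ?_)
    simp only [Function.comp_apply, tfrEquiv, blockEquiv_apply, coeffs, tensor, cj, one_smul,
      zero_smul, zero_add, neg_smul]
    rw [mul_assoc, sub_eq_add_neg, add_comm]
  | crossWigner => simp [hW, tfrConst]
  | crossAmbiguity =>
    funext z
    simp only [tfrConst, one_smul, pFT_apply, hexp, TFR]
    refine integral_congr_ae (Eventually.of_forall fun t => ?_)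
    simp only [Function.comp_apply, tfrEquiv, blockEquiv_apply, coeffs, tensor, cj, one_smul]
    rw [mul_assoc, sub_eq_add_neg, ← neg_smul, neg_div, add_comm t, add_comm t]

/-- The estimates for the representation of test functions. -/
lemma TFR_mem {c : GSType} (hM : M.Nontrivial c) (hN : N.Nontrivial c) (k : TFRKind)
    {f g : Rn d → ℂ} (hf : f ∈ GS c d M N) (hg : g ∈ GS c d M N) :
    TFR k f g ∈ GS₂ c d M N N M := by
  have hf' := (mem_space_iff (compat_GS M N) hM hN).1 hf
  have hg' := (mem_space_iff (compat_GS M N) hM hN).1 hg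
  refine (mem_space_iff (compat_mix M N) hM hN).2 ?_
  have h := (hf'.and hg' (fun A A' hA hAA ⟨C, hC⟩ => ⟨C, hC.mono hA hAA⟩)
    (fun A A' hA hAA ⟨C, hC⟩ => ⟨C, hC.mono hA hAA⟩)).imp
    fun A hA ⟨⟨C, hC⟩, ⟨D, hD⟩⟩ => (⟨C * D, hC.tensor hA hD.cj⟩ :
      ∃ C, WBound (stdBasis₂ d) Sum.isLeft M N A C (tensor f (cj g)))
  rw [TFR_eq]
  exact ((wtame_pFT_mix.comp (wtame_comp_linear (stdBasis₂ d) (stdBasis₂ d)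
    (tfrEquiv d k))).smul _).quant h

end

section

variable {d : ℕ} {M N : WeightSeq}

/-! ### Gaussians are test functions -/

open RealInnerProductSpace

/-- The Gaussian `exp (-π |x|²)` modulated with frequency `w`. -/
def gauss (w : Rn d) : Rn d → ℂ := fun x =>
  Complex.exp (↑(-Real.pi * ⟪x, x⟫) + ↑(2 * Real.pi * ⟪w, x⟫) * Complex.I)

lemma contDiff_gauss (w : Rn d) : ContDiff ℝ ∞ (gauss w) := by
  refine ContDiff.cexp (ContDiff.add ?_ (ContDiff.mul ?_ contDiff_const))
  · exact Complex.ofRealCLM.contDiff.comp (contDiff_const.mul (contDiff_id.inner ℝ contDiff_id))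
  · exact Complex.ofRealCLM.contDiff.comp (contDiff_const.mul (contDiff_const.inner ℝ contDiff_id))

lemma norm_gauss (w x : Rn d) : ‖gauss w x‖ = Real.exp (-Real.pi * ‖x‖ ^ 2) := by
  rw [gauss, Complex.norm_exp]
  simp
  norm_cast

lemma dirDeriv_gauss (w : Rn d) (i : Fin d) (x : Rn d) :
    dirDeriv (stdBasis d i) (gauss w) x =
      (-(2 * Real.pi) * x i + 2 * Real.pi * w i * Complex.I) * gauss w x := by
  have hi : ∀ y : Rn d, ⟪y, stdBasis d i⟫ = y i := fun y => by
    rw [stdBasis, OrthonormalBasis.coe_toBasis, EuclideanSpace.basisFun_apply,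
      EuclideanSpace.inner_single_right]
    simp
  have h1 : HasFDerivAt (fun x : Rn d => -Real.pi * ⟪x, x⟫)
      (-Real.pi • ((innerSL ℝ x) + (innerSL ℝ x))) x := by
    have h := ((hasFDerivAt_id (𝕜 := ℝ) x).inner ℝ (hasFDerivAt_id x)).const_mul (-Real.pi)
    refine h.congr_fderiv (ContinuousLinearMap.ext fun v => ?_)
    simp [real_inner_comm]
    ring
  have h2 : HasFDerivAt (fun x : Rn d => 2 * Real.pi * ⟪w, x⟫) ((2 * Real.pi) • innerSL ℝ w) x :=
    ((innerSL ℝ w).hasFDerivAt (x := x)).const_mul (2 * Real.pi)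
  have h3 := (Complex.ofRealCLM.hasFDerivAt.comp x h1).add
    ((Complex.ofRealCLM.hasFDerivAt.comp x h2).mul_const Complex.I)
  refine (dirDeriv_of_hasFDerivAt h3.cexp _).trans ?_
  simp only [gauss, smul_apply, add_apply, ContinuousLinearMap.comp_apply, innerSL_apply_apply, hi,
    Complex.ofRealCLM_apply, smul_eq_mul, Function.comp_apply, Pi.add_apply]
  push_cast
  ring

lemma abs_monomial_le (α : Fin d → ℕ) (x : Rn d) :
    |monomial (stdBasis d) α x| ≤ ‖x‖ ^ ∑ i, α i := by
  rw [monomial, Finset.abs_prod, ← Finset.prod_pow_eq_pow_sum]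
  refine Finset.prod_le_prod (fun _ _ => abs_nonneg _) fun i _ => ?_
  rw [abs_pow, stdBasis_repr]
  exact pow_le_pow_left₀ (abs_nonneg _) (PiLp.norm_apply_le x i) _

lemma pow_mul_exp_le (t : ℝ) (n : ℕ) :
    t ^ n * Real.exp (-Real.pi * t ^ 2) ≤ √(n.factorial : ℝ) := by
  have h1 := Real.pow_div_factorial_le_exp (t ^ 2) (by positivity) n
  have h2 : (0 : ℝ) < n.factorial := by positivity
  rw [div_le_iff₀ h2] at h1
  refine Real.le_sqrt_of_sq_le ?_
  have h3 : Real.exp (-Real.pi * t ^ 2) ^ 2 * Real.exp (t ^ 2) ≤ 1 := by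
    rw [← Real.exp_nat_mul, ← Real.exp_add, Real.exp_le_one_iff]
    have := Real.pi_gt_three
    have := sq_nonneg t
    push_cast
    nlinarith
  calc (t ^ n * Real.exp (-Real.pi * t ^ 2)) ^ 2
      = (t ^ 2) ^ n * Real.exp (-Real.pi * t ^ 2) ^ 2 := by ring
    _ ≤ (Real.exp (t ^ 2) * n.factorial) * Real.exp (-Real.pi * t ^ 2) ^ 2 := by gcongr
    _ = n.factorial * (Real.exp (-Real.pi * t ^ 2) ^ 2 * Real.exp (t ^ 2)) := by ring
    _ ≤ n.factorial * 1 := by gcongr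
    _ = _ := mul_one _

lemma mul_sqrt_factorial_le (a m : ℕ) (h : a ≤ m + 1) :
    (a : ℝ) * √(m.factorial : ℝ) ≤ √((m + 2).factorial : ℝ) := by
  refine Real.le_sqrt_of_sq_le ?_
  rw [mul_pow, Real.sq_sqrt (by positivity)]
  have h1 : a ^ 2 * m.factorial ≤ (m + 2).factorial := by
    rw [Nat.factorial_succ, Nat.factorial_succ, ← mul_assoc]
    refine Nat.mul_le_mul_right _ ?_
    nlinarith
  exact_mod_cast h1

lemma sqrt_factorial_mono {m n : ℕ} (h : m ≤ n) :
    √(m.factorial : ℝ) ≤ √(n.factorial : ℝ) :=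
  Real.sqrt_le_sqrt (by exact_mod_cast Nat.factorial_le h)

/-- A derivative applied to `x^α γ` either lowers or raises the power of `x` by one, up to the
effect of the modulation; a lowering costs a factor `α i`, which is absorbed by the square roots of
the factorials. -/
lemma norm_act_nrm_gauss_le (w x : Rn d) (l : List (Fin d ⊕ Fin d)) : ∀ α : Fin d → ℕ,
    ‖act (stdBasis d) l (nrm (stdBasis d) α 0 (gauss w)) x‖ ≤
      (2 * Real.pi * (1 + ‖w‖) + 1) ^ l.length * √((l.length + ∑ i, α i).factorial : ℝ) := by
  set K : ℝ := 2 * Real.pi * (1 + ‖w‖) + 1 with hK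
  have hK1 : 1 ≤ K := by
    have : 0 ≤ 2 * Real.pi * (1 + ‖w‖) := by positivity
    linarith
  induction l using List.reverseRecOn with
  | nil =>
    intro α
    rw [act_nil, norm_nrm, iterDeriv_zero, norm_gauss]
    simp only [List.length_nil, pow_zero, one_mul, zero_add]
    exact (mul_le_mul_of_nonneg_right (abs_monomial_le α x) (Real.exp_pos _).le).trans
      (pow_mul_exp_le _ _)
  | append_singleton l P ih =>
    intro α
    rw [act_append, act_cons, act_nil]
    have hsum : ∀ i, ∑ j, (α + Pi.single i 1 : Fin d → ℕ) j = ∑ j, α j + 1 := fun i => by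
      simp [Finset.sum_add_distrib]
    rw [List.length_append, List.length_singleton, pow_succ]
    set n := l.length + ∑ i, α i with hn
    rw [show l.length + 1 + ∑ i, α i = n + 1 by omega]
    cases P with
    | inl i =>
      rw [op_inl_nrm]
      refine (ih _).trans ?_
      rw [hsum, show l.length + (∑ i, α i + 1) = n + 1 by omega, mul_assoc]
      refine mul_le_mul_of_nonneg_left ?_ (by positivity)
      exact le_mul_of_one_le_left (Real.sqrt_nonneg _) hK1
    | inr i =>
      have hγ := contDiff_gauss w
      have e1 : nrm (stdBasis d) α (0 + Pi.single i 1) (gauss w) =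
          (-(2 * Real.pi) : ℂ) • nrm (stdBasis d) (α + Pi.single i 1) 0 (gauss w) +
            (2 * Real.pi * w i * Complex.I : ℂ) • nrm (stdBasis d) α 0 (gauss w) := by
        funext y
        simp only [nrm, Pi.add_apply, Pi.smul_apply, smul_eq_mul, monomial_add_single]
        rw [← dirDeriv_iterDeriv _ _ hγ, iterDeriv_zero, dirDeriv_gauss, stdBasis_repr]
        push_cast; ring
      have s : ∀ β : Fin d → ℕ, ContDiff ℝ ∞ (nrm (stdBasis d) β 0 (gauss w)) :=
        fun β => contDiff_nrm _ _ hγ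
      have s2 : ContDiff ℝ ∞ ((-(2 * Real.pi) : ℂ) • nrm (stdBasis d) (α + Pi.single i 1) 0
          (gauss w) + (2 * Real.pi * w i * Complex.I : ℂ) • nrm (stdBasis d) α 0 (gauss w)) :=
        (contDiff_smul' _ (s _)).add (contDiff_smul' _ (s _))
      rw [op_inr_nrm _ _ _ hγ, e1, act_add l s2
        (contDiff_smul' _ (s _)), act_add l (contDiff_smul' _ (s _)) (contDiff_smul' _ (s _)),
        act_smul l _ (s _), act_smul l _ (s _), act_smul l _ (s _)]
      have b1 : ‖(-(2 * Real.pi) : ℂ) • act (stdBasis d) l (nrm (stdBasis d) (α + Pi.single i 1) 0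
          (gauss w)) x‖ ≤ 2 * Real.pi * (K ^ l.length * √((n + 1).factorial : ℝ)) := by
        rw [norm_smul]
        have : ‖(-(2 * Real.pi) : ℂ)‖ = 2 * Real.pi := by
          rw [norm_neg, norm_mul, Complex.norm_real, Real.norm_of_nonneg Real.pi_pos.le]; simp
        rw [this]
        have h := ih (α + Pi.single i 1)
        rw [hsum, show l.length + (∑ i, α i + 1) = n + 1 by omega] at h
        gcongr
      have b2 : ‖(2 * Real.pi * w i * Complex.I : ℂ) • act (stdBasis d) l (nrm (stdBasis d) α 0
          (gauss w)) x‖ ≤ 2 * Real.pi * ‖w‖ * (K ^ l.length * √((n + 1).factorial : ℝ)) := by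
        rw [norm_smul]
        have : ‖(2 * Real.pi * w i * Complex.I : ℂ)‖ ≤ 2 * Real.pi * ‖w‖ := by
          simp only [norm_mul, Complex.norm_real, Complex.norm_I, mul_one, Complex.norm_ofNat,
            Real.norm_of_nonneg Real.pi_pos.le]
          have := PiLp.norm_apply_le w i
          gcongr
        have h := ih α
        have h' := sqrt_factorial_mono (show n ≤ n + 1 by omega)
        gcongr
        exact h.trans (by gcongr)
      have b3 : ‖(α i : ℂ) • act (stdBasis d) l (nrm (stdBasis d) (α - Pi.single i 1) 0
          (gauss w)) x‖ ≤ K ^ l.length * √((n + 1).factorial : ℝ) := by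
        by_cases hα : α i = 0
        · rw [hα]
          simp only [Nat.cast_zero, zero_smul, norm_zero]; positivity
        · have hle : α i ≤ ∑ j, α j :=
            Finset.single_le_sum (f := α) (by simp) (Finset.mem_univ i)
          have hs : ∑ j, α j = ∑ j, (α - Pi.single i 1 : Fin d → ℕ) j + 1 := by
            conv_lhs => rw [← sub_single_add_single hα]
            simp [Finset.sum_add_distrib]
          have h := ih (α - Pi.single i 1)
          rw [norm_smul, Complex.norm_natCast]
          have h4 := mul_sqrt_factorial_le (α i) (n - 1) (by omega)
          rw [show n - 1 + 2 = n + 1 by omega] at h4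
          rw [show l.length + ∑ j, (α - Pi.single i 1 : Fin d → ℕ) j = n - 1 by omega] at h
          calc _ ≤ (α i : ℝ) * (K ^ l.length * √((n - 1).factorial : ℝ)) := by gcongr
            _ = K ^ l.length * (α i * √((n - 1).factorial : ℝ)) := by ring
            _ ≤ _ := by gcongr
      simp only [Pi.add_apply, Pi.smul_apply] at b1 b2 b3 ⊢
      refine (norm_add_le _ _).trans ((add_le_add ((norm_add_le _ _).trans (add_le_add b1 b2))
        b3).trans (le_of_eq ?_))
      rw [hK]; ring

lemma sqrt_factorial_add_le (p q : ℕ) :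
    √((p + q).factorial : ℝ) ≤ 2 ^ (p + q) * (√(p.factorial : ℝ) * √(q.factorial : ℝ)) := by
  rw [← Real.sqrt_mul (by positivity)]
  refine Real.sqrt_le_iff.2 ⟨by positivity, ?_⟩
  rw [mul_pow, Real.sq_sqrt (by positivity)]
  have h1 : (p + q).factorial ≤ (2 ^ (p + q)) ^ 2 * (p.factorial * q.factorial) := by
    rw [← Nat.add_choose_mul_factorial_mul_factorial p q, mul_assoc]
    refine Nat.mul_le_mul_right _ ((Nat.choose_le_two_pow _ _).trans ?_)
    exact Nat.le_self_pow (by norm_num) _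
  exact_mod_cast h1

/-- The nontriviality conditions guarantee that Gaussians belong to the Gelfand-Shilov space. -/
lemma gauss_mem {c : GSType} (hM : M.Nontrivial c) (hN : N.Nontrivial c) (w : Rn d) :
    gauss w ∈ GS c d M N := by
  refine (mem_space_iff (compat_GS M N) hM hN).2 ?_
  set K : ℝ := 2 * Real.pi * (1 + ‖w‖) + 1 with hK
  have hK0 : 0 < K := by positivity
  have key : ∀ A B h : ℝ, 0 < A → 0 < B → 0 < h →
      (∀ p : ℕ, √(p.factorial : ℝ) ≤ A * h ^ p * M.M p) →
      (∀ p : ℕ, √(p.factorial : ℝ) ≤ B * h ^ p * N.M p) →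
      WBound (stdBasis d) Sum.isLeft M N (2 * K * h) (A * B) (gauss w) := by
    intro A B h hA hB hh h1 h2
    refine ⟨contDiff_gauss w, fun l x => ?_⟩
    have h0 : gauss w = nrm (stdBasis d) 0 0 (gauss w) := by
      funext x; simp [nrm, monomial, iterDeriv_zero]
    rw [h0]
    refine (norm_act_nrm_gauss_le w x l 0).trans ?_
    simp only [Pi.zero_apply, Finset.sum_const_zero, add_zero]
    rw [← nT_add_nF Sum.isLeft l]
    set p := nT Sum.isLeft l
    set q := nF Sum.isLeft l
    have e1 := M.pos p
    calc K ^ (p + q) * √((p + q).factorial : ℝ)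
        ≤ K ^ (p + q) * (2 ^ (p + q) * ((A * h ^ p * M.M p) * (B * h ^ q * N.M q))) := by
          refine mul_le_mul_of_nonneg_left ((sqrt_factorial_add_le p q).trans ?_) (by positivity)
          exact mul_le_mul_of_nonneg_left (mul_le_mul (h1 p) (h2 q) (Real.sqrt_nonneg _)
            (by positivity)) (by positivity)
      _ = _ := by rw [wtc, mul_pow, mul_pow, pow_add h]; ring
  cases c
  · obtain ⟨A, H, hA, hH, h1⟩ := hM
    obtain ⟨B, L, hB, hL, h2⟩ := hN
    refine ⟨2 * K * max H L, by positivity, A * B, key A B _ hA hB (by positivity)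
      (fun p => (h1 p).trans ?_) fun p => (h2 p).trans ?_⟩
    · have := M.pos p
      have := le_max_left H L
      gcongr
    · have := N.pos p
      have := le_max_right H L
      gcongr
  · intro A' hA'
    obtain ⟨A, hA, h1⟩ := hM (A' / (2 * K)) (by positivity)
    obtain ⟨B, hB, h2⟩ := hN (A' / (2 * K)) (by positivity)
    have := key A B _ hA hB (by positivity) h1 h2
    rw [mul_div_cancel₀ _ (by positivity)] at this
    exact ⟨A * B, this⟩

/-! ### Test functions separate square integrable functions -/

lemma memLp_jap : MemLp (jap : Rn d → ℝ) 2 := by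
  rw [memLp_two_iff_integrable_sq continuous_jap.aestronglyMeasurable]
  refine integrable_jap.mono' (continuous_jap.pow 2).aestronglyMeasurable
    (Eventually.of_forall fun x => ?_)
  rw [Real.norm_of_nonneg (by positivity), sq]
  exact mul_le_of_le_one_left (jap_pos x).le (jap_le_one x)

lemma integrable_mul_jap {f : Rn d → ℂ} (hf : MemLp f 2) : Integrable fun x => ‖f x‖ * jap x :=
  hf.norm.integrable_mul memLp_jap

lemma integrable_mul_of_le_jap {f φ : Rn d → ℂ} {C : ℝ} (hf : MemLp f 2) (hφ : Continuous φ)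
    (h : ∀ x, ‖φ x‖ ≤ C * jap x) : Integrable fun x => f x * φ x := by
  refine ((integrable_mul_jap hf).const_mul C).mono'
    (hf.1.mul hφ.aestronglyMeasurable) (Eventually.of_forall fun x => ?_)
  rw [norm_mul]
  have := mul_le_mul_of_nonneg_left (h x) (norm_nonneg (f x))
  linarith

open FourierTransform in
/-- An integrable function with vanishing Fourier transform vanishes almost everywhere. -/
lemma ae_eq_zero_of_fourier {u : Rn d → ℂ} (hu : Integrable u) (h : ∀ w, 𝓕 u w = 0) :
    u =ᵐ[volume] 0 := by
  refine ae_eq_zero_of_integral_contDiff_smul_eq_zero hu.locallyIntegrable fun g hg hgc => ?_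
  have hgc' : HasCompactSupport fun x => (g x : ℂ) := hgc.comp_left Complex.ofReal_zero
  set G : SchwartzMap (Rn d) ℂ :=
    hgc'.toSchwartzMap (Complex.ofRealCLM.contDiff.comp hg) with hG
  have h1 : 𝓕 (𝓕⁻ G) = G := FourierTransform.fourier_fourierInv_eq G
  have h2 := integral_fourier_mul hu (𝓕⁻ G).integrable
  rw [← SchwartzMap.fourier_coe, h1] at h2
  simp only [h, zero_mul, integral_zero] at h2
  rw [h2]
  refine integral_congr_ae (Eventually.of_forall fun x => ?_)
  simp only [Complex.real_smul]
  rw [mul_comm]; rfl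

/-- Test functions separate square integrable functions: pairing with modulated Gaussians gives
the Fourier transform of the product with the unmodulated one. -/
lemma ae_eq_zero_of_forall_mem {c : GSType} (hM : M.Nontrivial c) (hN : N.Nontrivial c)
    {f : Rn d → ℂ} (hf : MemLp f 2) (h : ∀ φ ∈ GS c d M N, ∫ x, f x * φ x = 0) :
    f =ᵐ[volume] 0 := by
  have hγ : Rapid (stdBasis d) (gauss (0 : Rn d)) := by
    obtain ⟨A, -, ⟨C, hC⟩, -⟩ := ((mem_space_iff (compat_GS M N) hM hN).1
      (gauss_mem hM hN (0 : Rn d))).and_coquant₁ (Q := fun _ => True) (by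
        cases c
        · exact fun _ _ => trivial
        · exact ⟨1, one_pos, trivial⟩)
    exact hC.rapid
  obtain ⟨C, -, hC⟩ := hγ.exists_norm_le_jap
  have hu := integrable_mul_of_le_jap hf hγ.1.continuous hC
  have h1 := ae_eq_zero_of_fourier hu fun w => by
    rw [Real.fourier_eq', ← h _ (gauss_mem hM hN (-w))]
    refine integral_congr_ae (Eventually.of_forall fun x => ?_)
    simp only [gauss, smul_eq_mul, inner_zero_left, mul_zero, Complex.ofReal_zero, zero_mul,
      add_zero, inner_neg_left]
    rw [mul_left_comm, ← Complex.exp_add, real_inner_comm]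
    congr 2
    push_cast; ring
  filter_upwards [h1] with x hx
  simp only [Pi.zero_apply, mul_eq_zero] at hx
  exact hx.resolve_right (Complex.exp_ne_zero _)

end

section

/-! ### Taylor estimates -/

section Taylor

variable {ι : Type} [Fintype ι] {E : Type} [NormedAddCommGroup E] [NormedSpace ℝ E]

lemma exists_norm_sub_le (b : Module.Basis ι ℝ E) : ∃ K, 0 ≤ K ∧ ∀ (f : E → ℂ) (R : ℝ),
    ContDiff ℝ ∞ f → (∀ i x, ‖op b (.inr i) f x‖ ≤ R) → ∀ x y, ‖f y - f x‖ ≤ K * R * ‖y - x‖ := by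
  obtain ⟨K, hK, h⟩ := norm_ofPartials_le b
  refine ⟨K, hK, fun f R hf hR x y => ?_⟩
  refine convex_univ.norm_image_sub_le_of_norm_fderiv_le (𝕜 := ℝ)
    (fun z _ => hf.differentiable (by simp) z) (fun z _ => ?_) (Set.mem_univ x) (Set.mem_univ y)
  rw [fderiv_eq_ofPartials (b := b)]
  exact h _ _ fun i => hR i z

/-- Taylor's formula of first order, with a remainder estimated by the second partial derivatives. -/
lemma exists_taylor (b : Module.Basis ι ℝ E) : ∃ K, 0 ≤ K ∧ ∀ (f : E → ℂ) (R : ℝ),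
    ContDiff ℝ ∞ f → (∀ i j x, ‖op b (.inr i) (op b (.inr j) f) x‖ ≤ R) →
      ∀ x y, ‖f y - f x - ∑ i, (b.repr (y - x) i : ℂ) * op b (.inr i) f x‖
        ≤ K * R * ‖y - x‖ ^ 2 := by
  obtain ⟨K, hK, h⟩ := norm_ofPartials_le b
  obtain ⟨L, hL, h'⟩ := exists_norm_sub_le b
  refine ⟨K * L, by positivity, fun f R hf hR x y => ?_⟩
  by_cases hR0 : 0 ≤ R
  · rw [← fderiv_eq_sum, show K * L * R * ‖y - x‖ ^ 2 = K * (L * R * ‖y - x‖) * ‖y - x‖ by ring]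
    refine (convex_closedBall x ‖y - x‖).norm_image_sub_le_of_norm_fderiv_le' (𝕜 := ℝ)
      (fun z _ => hf.differentiable (by simp) z) (fun z hz => ?_)
      (Metric.mem_closedBall_self (norm_nonneg _)) (by simp [dist_eq_norm])
    have e : fderiv ℝ f z - fderiv ℝ f x =
        ofPartials b fun i => op b (.inr i) f z - op b (.inr i) f x := by
      rw [fderiv_eq_ofPartials (b := b), fderiv_eq_ofPartials (b := b)]
      ext v
      simp only [sub_apply, ofPartials_apply, mul_sub, Finset.sum_sub_distrib]
    rw [e]
    refine h _ _ fun i => (h' _ R (contDiff_op _ hf) (fun j w => hR j i w) x z).trans ?_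
    rw [Metric.mem_closedBall, dist_eq_norm] at hz
    gcongr
  · have : IsEmpty ι := ⟨fun i => hR0 ((norm_nonneg _).trans (hR i i 0))⟩
    have : Subsingleton E := b.repr.toEquiv.subsingleton
    simp [Subsingleton.elim y x]

end Taylor

/-! ### Functionals extended by zero to all functions -/

section Eval

variable {ι : Type} [Fintype ι] {E : Type} [NormedAddCommGroup E] [NormedSpace ℝ E]
  {b : Module.Basis ι ℝ E} {m n : MultiWeight ι} {c : GSType} {τ : ι ⊕ ι → Bool} {M N : WeightSeq}

open Classical in
/-- The value of a functional at a function, which is `0` unless it is a test function. -/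
def Dual.ev (u : Dual c b m n) (f : E → ℂ) : ℂ :=
  if h : f ∈ Space c b m n then u.lin ⟨f, h⟩ else 0

variable {u : Dual c b m n} {f g : E → ℂ}

lemma Dual.ev_of_mem (hf : f ∈ Space c b m n) : u.ev f = u.lin ⟨f, hf⟩ := dif_pos hf

lemma Dual.ev_coe (φ : Space c b m n) : u.ev φ = u.lin φ := Dual.ev_of_mem φ.2

lemma Dual.ev_add (hf : f ∈ Space c b m n) (hg : g ∈ Space c b m n) :
    u.ev (f + g) = u.ev f + u.ev g := by
  rw [ev_of_mem hf, ev_of_mem hg, ev_of_mem (add_mem hf hg), ← map_add]; rfl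

lemma Dual.ev_smul (a : ℂ) (hf : f ∈ Space c b m n) : u.ev (a • f) = a * u.ev f := by
  rw [ev_of_mem hf, ev_of_mem (Submodule.smul_mem _ a hf), ← smul_eq_mul, ← map_smul]; rfl

lemma Dual.ev_sub (hf : f ∈ Space c b m n) (hg : g ∈ Space c b m n) :
    u.ev (f - g) = u.ev f - u.ev g := by
  rw [ev_of_mem hf, ev_of_mem hg, ev_of_mem (sub_mem hf hg), ← map_sub]; rfl

lemma Dual.ev_sum {κ : Type*} (s : Finset κ) (a : κ → ℂ) {F : κ → E → ℂ}
    (hF : ∀ k, F k ∈ Space c b m n) : u.ev (∑ k ∈ s, a k • F k) = ∑ k ∈ s, a k * u.ev (F k) := by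
  have : ∑ k ∈ s, a k • F k = ((∑ k ∈ s, a k • ⟨F k, hF k⟩ : Space c b m n) : E → ℂ) := by
    simp
  rw [this, ev_coe, map_sum]
  simp only [map_smul, smul_eq_mul, ev_of_mem (hF _)]

lemma Dual.ev_le {A K C : ℝ} (hf : f ∈ Space c b m n) (hu : WDual τ M N u.lin A K)
    (h : WBound b τ M N A C f) : ‖u.ev f‖ ≤ K * C := by
  rw [ev_of_mem hf]; exact hu ⟨f, hf⟩ C h

lemma WBound.act {A C K κ : ℝ} (l : List (ι ⊕ ι))
    (hK : ∀ p q p' q', p + q ≤ l.length →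
      wtc M N A (p + p') (q + q') ≤ K * wtc M N (κ * A) p' q')
    (hf : WBound b τ M N A C f) : WBound b τ M N (κ * A) (C * K) (act b l f) := by
  refine ⟨contDiff_act l hf.1, fun l' x => ?_⟩
  rw [← act_append]
  refine (hf.2 (l' ++ l) x).trans ?_
  rw [mul_assoc, nT_append, nF_append, add_comm (nT τ l'), add_comm (nF τ l')]
  exact mul_le_mul_of_nonneg_left (hK _ _ _ _ (nT_add_nF τ l).le) hf.nonneg

lemma act_mem (hτ : Compat τ m n M N) (hM : M.Nontrivial c) (hN : N.Nontrivial c)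
    (hf : f ∈ Space c b m n) (l : List (ι ⊕ ι)) : act b l f ∈ Space c b m n := by
  classical
  obtain ⟨κ, hκ, h⟩ := exists_wtc_add_le_of_le M N
  refine (mem_space_iff hτ hM hN).2 ((GSType.tame_of_linear (R := fun A A' => A' = κ * A)
    (by positivity) fun A _ => rfl).quant₁ ((mem_space_iff hτ hM hN).1 hf) ?_)
  rintro A _ hA - rfl ⟨C, hC⟩
  obtain ⟨K, -, hK⟩ := h A hA l.length
  exact ⟨_, hC.act l hK⟩

lemma op_mem (hτ : Compat τ m n M N) (hM : M.Nontrivial c) (hN : N.Nontrivial c)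
    (hf : f ∈ Space c b m n) (s : ι ⊕ ι) : op b s f ∈ Space c b m n :=
  act_mem hτ hM hN hf [s]

/-- A test function and a functional have bounds with parameters that differ by a given factor. -/
lemma exists_wbound_wdual {ι' : Type} [Fintype ι'] {E' : Type} [NormedAddCommGroup E']
    [NormedSpace ℝ E'] {b' : Module.Basis ι' ℝ E'} {m' n' : MultiWeight ι'} {τ' : ι' ⊕ ι' → Bool}
    (hτ : Compat τ m n M N) (hτ' : Compat τ' m' n' M N)
    (hM : M.Nontrivial c) (hN : N.Nontrivial c) {κ : ℝ} (hκ : 0 < κ)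
    (hf : f ∈ Space c b m n) (u : Dual c b' m' n') : ∃ A, 0 < A ∧
      (∃ C, WBound b τ M N A C f) ∧ ∃ K, 0 ≤ K ∧ WDual τ' M N u.lin (κ * A) K := by
  classical
  refine ((mem_space_iff hτ hM hN).1 hf).and_coquant₁
    ((GSType.tame_of_linear (R := fun A A' => A' = κ * A) hκ fun A _ => rfl).coquant₁
      ((mem_dual_iff hτ' hM hN).1 u.2) ?_)
  rintro A _ - - rfl h
  exact h

lemma exists_wbound (hτ : Compat τ m n M N) (hM : M.Nontrivial c) (hN : N.Nontrivial c)
    (hf : f ∈ Space c b m n) : ∃ A, 0 < A ∧ ∃ C, WBound b τ M N A C f := by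
  obtain ⟨A, hA, h, -⟩ := exists_wbound_wdual hτ hτ hM hN one_pos hf (0 : Dual c b m n)
  exact ⟨A, hA, h⟩

end Eval

variable {d : ℕ} {M N : WeightSeq} {c : GSType}

/-! ### Operators in the two variables -/

lemma op_inr_op_inl {ι : Type} [Fintype ι] [DecidableEq ι] {E : Type} [NormedAddCommGroup E]
    [NormedSpace ℝ E] {b : Module.Basis ι ℝ E} {f : E → ℂ} (hf : ContDiff ℝ ∞ f) {i j : ι}
    (hij : i ≠ j) : op b (.inr i) (op b (.inl j) f) = op b (.inl j) (op b (.inr i) f) := by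
  funext x
  have h1 : HasFDerivAt (fun y => ((b.repr y j : ℝ) : ℂ))
      (Complex.ofRealCLM.comp (coordL b j)) x :=
    Complex.ofRealCLM.hasFDerivAt.comp x (coordL b j).hasFDerivAt
  have h2 := h1.mul (hf.differentiable (by simp) x).hasFDerivAt
  refine (dirDeriv_of_hasFDerivAt h2 _).trans ?_
  simp [op, dirDeriv, Finsupp.single_eq_of_ne hij.symm]

lemma op_fstOp_sndOp {Ψ : Rn d × Rn d → ℂ} (hΨ : ContDiff ℝ ∞ Ψ) (s t : Fin d ⊕ Fin d) :
    op (stdBasis₂ d) (fstOp s) (op (stdBasis₂ d) (sndOp t) Ψ) =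
      op (stdBasis₂ d) (sndOp t) (op (stdBasis₂ d) (fstOp s) Ψ) := by
  cases s with
  | inl i => cases t with
    | inl j => funext z; simp only [op, fstOp, sndOp]; ring
    | inr j => exact (op_inr_op_inl hΨ (by simp)).symm
  | inr i => cases t with
    | inl j => exact op_inr_op_inl hΨ (by simp)
    | inr j => exact dirDeriv_comm _ _ hΨ

lemma op_fstOp_act_sndOp {Ψ : Rn d × Rn d → ℂ} (hΨ : ContDiff ℝ ∞ Ψ) (s : Fin d ⊕ Fin d)
    (l : List (Fin d ⊕ Fin d)) :
    op (stdBasis₂ d) (fstOp s) (act (stdBasis₂ d) (l.map sndOp) Ψ) =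
      act (stdBasis₂ d) (l.map sndOp) (op (stdBasis₂ d) (fstOp s) Ψ) := by
  induction l with
  | nil => rfl
  | cons t l ih => rw [List.map_cons, act_cons, act_cons, op_fstOp_sndOp (contDiff_act _ hΨ), ih]

@[simp] lemma nT_map_sndOp (l : List (Fin d ⊕ Fin d)) :
    nT Sum.isLeft (l.map sndOp) = nT Sum.isLeft l := by
  induction l with
  | nil => rfl
  | cons s l ih => rw [List.map_cons, nT_cons, nT_cons, ih, isLeft_sndOp]

@[simp] lemma nF_map_sndOp (l : List (Fin d ⊕ Fin d)) :
    nF Sum.isLeft (l.map sndOp) = nF Sum.isLeft l := by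
  induction l with
  | nil => rfl
  | cons s l ih => rw [List.map_cons, nF_cons, nF_cons, ih, isLeft_sndOp]

@[simp] lemma nT_map_fstOp (l : List (Fin d ⊕ Fin d)) :
    nT Sum.isLeft (l.map fstOp) = nT Sum.isLeft l := by
  induction l with
  | nil => rfl
  | cons s l ih => rw [List.map_cons, nT_cons, nT_cons, ih, isLeft_fstOp]

@[simp] lemma nF_map_fstOp (l : List (Fin d ⊕ Fin d)) :
    nF Sum.isLeft (l.map fstOp) = nF Sum.isLeft l := by
  induction l with
  | nil => rfl
  | cons s l ih => rw [List.map_cons, nF_cons, nF_cons, ih, isLeft_fstOp]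

lemma contDiff_slice_fst {Ψ : Rn d × Rn d → ℂ} (hΨ : ContDiff ℝ ∞ Ψ) (y : Rn d) :
    ContDiff ℝ ∞ fun x => Ψ (x, y) :=
  hΨ.comp (contDiff_id.prodMk contDiff_const)

lemma op_slice_fst {Ψ : Rn d × Rn d → ℂ} (hΨ : ContDiff ℝ ∞ Ψ) (y : Rn d) (s : Fin d ⊕ Fin d) :
    op (stdBasis d) s (fun x => Ψ (x, y)) = fun x => op (stdBasis₂ d) (fstOp s) Ψ (x, y) := by
  funext x
  cases s with
  | inl i => simp [op, fstOp]
  | inr i =>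
    have h1 : HasFDerivAt (fun x => Ψ (x, y)) ((fderiv ℝ Ψ (x, y)).comp
        (ContinuousLinearMap.inl ℝ (Rn d) (Rn d))) x :=
      (hΨ.differentiable (by simp) (x, y)).hasFDerivAt.comp x (hasFDerivAt_prodMk_left x y)
    simp only [op, fstOp]
    rw [dirDeriv_of_hasFDerivAt h1, dirDeriv, stdBasis₂_inl]
    rfl

lemma act_slice_fst {Ψ : Rn d × Rn d → ℂ} (hΨ : ContDiff ℝ ∞ Ψ) (y : Rn d)
    (l : List (Fin d ⊕ Fin d)) : act (stdBasis d) l (fun x => Ψ (x, y)) =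
      fun x => act (stdBasis₂ d) (l.map fstOp) Ψ (x, y) := by
  induction l with
  | nil => rfl
  | cons s l ih => rw [act_cons, ih, op_slice_fst (contDiff_act _ hΨ), List.map_cons, act_cons]

/-! ### Functionals applied to slices -/

lemma WBound.slice {A C : ℝ} {Ψ : Rn d × Rn d → ℂ}
    (h : WBound (stdBasis₂ d) Sum.isLeft M N A C Ψ) (x : Rn d) :
    WBound (stdBasis d) Sum.isLeft M N A C fun t => Ψ (x, t) := by
  refine ⟨contDiff_slice h.1 x, fun l t => ?_⟩
  rw [act_slice h.1]
  simpa using h.2 (l.map sndOp) (x, t)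

lemma WBound.slice_fst {A C : ℝ} {Ψ : Rn d × Rn d → ℂ}
    (h : WBound (stdBasis₂ d) Sum.isLeft M N A C Ψ) (y : Rn d) :
    WBound (stdBasis d) Sum.isLeft M N A C fun x => Ψ (x, y) := by
  refine ⟨contDiff_slice_fst h.1 y, fun l t => ?_⟩
  rw [act_slice_fst h.1]
  simpa using h.2 (l.map fstOp) (t, y)

lemma slice_mem (hM : M.Nontrivial c) (hN : N.Nontrivial c) {Ψ : Rn d × Rn d → ℂ}
    (hΨ : Ψ ∈ GS₂ c d M M N N) (x : Rn d) : (fun t => Ψ (x, t)) ∈ GS c d M N :=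
  (mem_space_iff (compat_GS M N) hM hN).2 (((mem_space_iff (compat_GS₂ M N) hM hN).1 hΨ).imp
    fun _ _ ⟨C, hC⟩ => ⟨C, hC.slice x⟩)

lemma slice_fst_mem (hM : M.Nontrivial c) (hN : N.Nontrivial c) {Ψ : Rn d × Rn d → ℂ}
    (hΨ : Ψ ∈ GS₂ c d M M N N) (y : Rn d) : (fun x => Ψ (x, y)) ∈ GS c d M N :=
  (mem_space_iff (compat_GS M N) hM hN).2 (((mem_space_iff (compat_GS₂ M N) hM hN).1 hΨ).imp
    fun _ _ ⟨C, hC⟩ => ⟨C, hC.slice_fst y⟩)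

/-- The functional `u` applied in the second variable of `Ψ`. -/
def pair (u : GSDual c d M N) (Ψ : Rn d × Rn d → ℂ) : Rn d → ℂ := fun x => u.ev fun t => Ψ (x, t)

/-- Functionals applied to slices may be differentiated under the functional. -/
lemma hasFDerivAt_pair (hM : M.Nontrivial c) (hN : N.Nontrivial c) (u : GSDual c d M N)
    {Ψ : Rn d × Rn d → ℂ} (hΨ : Ψ ∈ GS₂ c d M M N N) (x : Rn d) :
    HasFDerivAt (pair u Ψ) (ofPartials (stdBasis d) fun i =>
      pair u (op (stdBasis₂ d) (fstOp (.inr i)) Ψ) x) x := by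
  obtain ⟨κ, hκ, hw⟩ := exists_wtc_add_le_of_le M N
  obtain ⟨T, hT, hTay⟩ := exists_taylor (stdBasis₂ d)
  obtain ⟨A, hA, ⟨C, hC⟩, L, hL, hu⟩ := exists_wbound_wdual (compat_GS₂ M N) (compat_GS M N) hM hN
    (κ := κ) (by positivity) hΨ u
  obtain ⟨K, hK1, hK⟩ := hw A hA 2
  have hC0 := hC.nonneg
  have hmem := slice_mem hM hN hΨ
  have hmem' : ∀ i, (fun t => op (stdBasis₂ d) (fstOp (.inr i)) Ψ (x, t)) ∈ GS c d M N :=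
    fun i => slice_mem hM hN (op_mem (compat_GS₂ M N) hM hN hΨ _) x
  set D : ℝ := L * (T * (C * K)) with hD
  -- the remainder of first order is estimated in the norm for which `u` is bounded
  have key : ∀ y, ‖pair u Ψ y - pair u Ψ x - ofPartials (stdBasis d) (fun i =>
      pair u (op (stdBasis₂ d) (fstOp (.inr i)) Ψ) x) (y - x)‖ ≤ D * ‖y - x‖ ^ 2 := by
    intro y
    set G : Rn d → ℂ := (fun t => Ψ (y, t)) - (fun t => Ψ (x, t)) -
      ∑ i, ((y - x) i : ℂ) • fun t => op (stdBasis₂ d) (fstOp (.inr i)) Ψ (x, t) with hG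
    have s1 : (∑ i, ((y - x) i : ℂ) • fun t => op (stdBasis₂ d) (fstOp (.inr i)) Ψ (x, t)) ∈
        GS c d M N := Submodule.sum_mem _ fun i _ => Submodule.smul_mem _ _ (hmem' i)
    have e : pair u Ψ y - pair u Ψ x - ofPartials (stdBasis d) (fun i =>
        pair u (op (stdBasis₂ d) (fstOp (.inr i)) Ψ) x) (y - x) = u.ev G := by
      rw [hG, Dual.ev_sub (sub_mem (hmem y) (hmem x)) s1, Dual.ev_sub (hmem y) (hmem x),
        Dual.ev_sum _ _ hmem', ofPartials_apply]
      rfl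
    rw [e]
    have hb : WBound (stdBasis d) Sum.isLeft M N (κ * A) (T * (C * K) * ‖y - x‖ ^ 2) G := by
      have c1 := fun x => contDiff_slice hC.1 x
      have c2 : ∀ i, ContDiff ℝ ∞ fun t => op (stdBasis₂ d) (fstOp (.inr i)) Ψ (x, t) :=
        fun i => contDiff_slice (contDiff_op _ hC.1) x
      have c3 : ContDiff ℝ ∞ (∑ i, ((y - x) i : ℂ) •
          fun t => op (stdBasis₂ d) (fstOp (.inr i)) Ψ (x, t)) :=
        contDiff_sum' _ fun i _ => contDiff_smul' _ (c2 i)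
      refine ⟨((c1 y).sub (c1 x)).sub c3, fun l t => ?_⟩
      have c4 : ContDiff ℝ ∞ ((fun t => Ψ (y, t)) - fun t => Ψ (x, t)) := (c1 y).sub (c1 x)
      rw [hG, act_sub l c4 c3, act_sub l (c1 y) (c1 x), act_sum l _ fun i _ =>
        contDiff_smul' _ (c2 i)]
      have h1 := hTay (act (stdBasis₂ d) (l.map sndOp) Ψ)
        (C * K * wtc M N (κ * A) (nT Sum.isLeft l) (nF Sum.isLeft l)) (contDiff_act _ hC.1)
        (fun i j z => by
          have := hC.act_act_le hK [.inr i, .inr j] (l.map sndOp) (by simp) z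
          simpa using this) (x, t) (y, t)
      have e2 : ‖((y, t) : Rn d × Rn d) - (x, t)‖ = ‖y - x‖ := by
        simp [Prod.norm_def]
      rw [e2] at h1
      refine le_trans (le_of_eq ?_) (h1.trans (le_of_eq (by ring)))
      congr 1
      simp only [Pi.sub_apply, Finset.sum_apply, act_slice hC.1, act_smul l _ (c2 _),
        act_slice (contDiff_op _ hC.1), Pi.smul_apply, smul_eq_mul, Fintype.sum_sum_type,
        stdBasis₂_repr_inl, stdBasis₂_repr_inr, Prod.mk_sub_mk, sub_self, PiLp.zero_apply,
        Complex.ofReal_zero, zero_mul, Finset.sum_const_zero, add_zero]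
      congr 1
      refine Finset.sum_congr rfl fun i _ => ?_
      rw [← op_fstOp_act_sndOp hC.1 (.inr i) l]
      rfl
    refine (Dual.ev_le (sub_mem (sub_mem (hmem y) (hmem x)) s1) hu hb).trans (le_of_eq ?_)
    rw [hD]; ring
  refine HasFDerivAt.of_isLittleO ?_
  refine (Asymptotics.IsBigO.of_bound D (Eventually.of_forall fun y => ?_)).trans_isLittleO
    (Asymptotics.isLittleO_pow_sub_sub x (m := 2) (by norm_num))
  rw [norm_pow, norm_norm]
  exact key y

lemma contDiff_pair (hM : M.Nontrivial c) (hN : N.Nontrivial c) (u : GSDual c d M N)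
    {Ψ : Rn d × Rn d → ℂ} (hΨ : Ψ ∈ GS₂ c d M M N N) : ContDiff ℝ ∞ (pair u Ψ) := by
  refine contDiff_of_closed (b := stdBasis d) {f | ∃ Ψ ∈ GS₂ c d M M N N, f = pair u Ψ} ?_
    ⟨Ψ, hΨ, rfl⟩
  rintro _ ⟨Ψ, hΨ, rfl⟩
  exact ⟨fun i => pair u (op (stdBasis₂ d) (fstOp (.inr i)) Ψ),
    fun i => ⟨_, op_mem (compat_GS₂ M N) hM hN hΨ _, rfl⟩, hasFDerivAt_pair hM hN u hΨ⟩

lemma act_pair (hM : M.Nontrivial c) (hN : N.Nontrivial c) (u : GSDual c d M N)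
    {Ψ : Rn d × Rn d → ℂ} (hΨ : Ψ ∈ GS₂ c d M M N N) (l : List (Fin d ⊕ Fin d)) :
    act (stdBasis d) l (pair u Ψ) = pair u (act (stdBasis₂ d) (l.map fstOp) Ψ) := by
  induction l with
  | nil => rfl
  | cons s l ih =>
    have h := act_mem (compat_GS₂ M N) hM hN hΨ (l.map fstOp)
    rw [act_cons, ih, List.map_cons, act_cons]
    funext x
    cases s with
    | inl i =>
      have e : (fun t => op (stdBasis₂ d) (fstOp (.inl i))
          (act (stdBasis₂ d) (l.map fstOp) Ψ) (x, t)) =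
          (x i : ℂ) • fun t => act (stdBasis₂ d) (l.map fstOp) Ψ (x, t) := by
        funext t; simp [op, fstOp]
      rw [pair, e, Dual.ev_smul _ (slice_mem hM hN h x)]
      simp [op, pair]
    | inr i =>
      rw [op, dirDeriv_of_hasFDerivAt (hasFDerivAt_pair hM hN u h x), ofPartials_basis]

/-- Estimates for functionals applied to slices, uniform in the functional. -/
lemma exists_wbound_pair (c : GSType) (d : ℕ) {M N : WeightSeq} (hM : M.Nontrivial c)
    (hN : N.Nontrivial c) : ∃ L κ : ℝ, 0 ≤ L ∧ 0 < κ ∧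
    ∀ A, 0 < A → ∀ (u : GSDual c d M N) (Ψ : Rn d × Rn d → ℂ) (K C : ℝ), 0 ≤ K →
      Ψ ∈ GS₂ c d M M N N → WDual Sum.isLeft M N u.lin (κ * A) K →
      WBound (stdBasis₂ d) Sum.isLeft M N A C Ψ →
      WBound (stdBasis d) Sum.isLeft M N (κ * A) (L * K * C) (pair u Ψ) := by
  obtain ⟨L, κ, hL, hκ, h⟩ := exists_wtc_add_le M N
  refine ⟨L, κ, by positivity, by positivity, fun A hA u Ψ K C hK hΨ hu hC =>
    ⟨contDiff_pair hM hN u hΨ, fun l x => ?_⟩⟩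
  have hC0 := hC.nonneg
  have hw := wtc_pos (M := M) (N := N) (show 0 < κ * A by positivity) (nT Sum.isLeft l)
    (nF Sum.isLeft l)
  rw [act_pair hM hN u hΨ]
  have h1 : WBound (stdBasis d) Sum.isLeft M N (κ * A)
      (C * (L * wtc M N (κ * A) (nT Sum.isLeft l) (nF Sum.isLeft l)))
      fun t => act (stdBasis₂ d) (l.map fstOp) Ψ (x, t) := by
    refine ⟨contDiff_slice (contDiff_act _ hC.1) x, fun l' t => ?_⟩
    rw [act_slice (contDiff_act _ hC.1), ← act_append]
    refine (hC.2 _ _).trans ?_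
    rw [mul_assoc]
    refine mul_le_mul_of_nonneg_left ((le_of_eq ?_).trans ((h A hA (nT Sum.isLeft l)
      (nF Sum.isLeft l) (nT Sum.isLeft l') (nF Sum.isLeft l')).trans (le_of_eq ?_))) hC0
    · simp [add_comm]
    · ring
  refine (Dual.ev_le (slice_mem hM hN (act_mem (compat_GS₂ M N) hM hN hΨ _) x) hu h1).trans
    (le_of_eq (by ring))

/-- A functional applied in the second variable of a test function gives a test function of the first
variable. In the Beurling case the functional is bounded for one parameter only, but the estimates
for the test function are available for all parameters. -/
lemma pair_mem (hM : M.Nontrivial c) (hN : N.Nontrivial c) (u : GSDual c d M N)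
    {Ψ : Rn d × Rn d → ℂ} (hΨ : Ψ ∈ GS₂ c d M M N N) : pair u Ψ ∈ GS c d M N := by
  obtain ⟨L, κ, hL, hκ, h⟩ := exists_wbound_pair c d hM hN
  refine (mem_space_iff (compat_GS M N) hM hN).2 ?_
  have h1 := (mem_space_iff (compat_GS₂ M N) hM hN).1 hΨ
  have h2 := (mem_dual_iff (compat_GS M N) hM hN).1 u.2
  cases c
  · obtain ⟨A, hA, C, hC⟩ := h1
    obtain ⟨K, hK, hu⟩ := h2 (κ * A) (by positivity)
    exact ⟨κ * A, by positivity, _, h A hA u Ψ K C hK hΨ hu hC⟩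
  · obtain ⟨B, hB, K, hK, hu⟩ := h2
    intro A' hA'
    set A := min (A' / κ) (B / κ) with hAdef
    have hA : 0 < A := lt_min (by positivity) (by positivity)
    have e1 : κ * A ≤ A' := by
      rw [mul_comm]; exact (le_div_iff₀ hκ).1 (min_le_left _ _)
    have e2 : κ * A ≤ B := by
      rw [mul_comm]; exact (le_div_iff₀ hκ).1 (min_le_right _ _)
    obtain ⟨C, hC⟩ := h1 A hA
    exact ⟨_, (h A hA u Ψ K C hK hΨ (hu.mono (by positivity) e2 le_rfl) hC).mono
      (by positivity) e1⟩

end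

section

variable {d : ℕ} {M N : WeightSeq} {c : GSType}

/-! ### Functionals commute with integrals over a parameter -/

/-- The integral over the second variable. -/
def marg (Θ : Rn d × Rn d → ℂ) : Rn d → ℂ := fun x => ∫ y, Θ (x, y)

/-- The integral over the second variable is the partial Fourier transform at frequency zero, so it
inherits smoothness and the commutation with operators in the first variable. -/
lemma marg_eq_pFT (Θ : Rn d × Rn d → ℂ) (x : Rn d) : marg Θ x = pFT Θ (x, 0) := by
  simp [pFT_apply, marg]

lemma contDiff_marg {Θ : Rn d × Rn d → ℂ} (hΘ : Rapid (stdBasis₂ d) Θ) :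
    ContDiff ℝ ∞ (marg Θ) := by
  rw [show marg Θ = fun x => pFT Θ (x, 0) from funext (marg_eq_pFT Θ)]
  exact contDiff_slice_fst (contDiff_pFT hΘ) 0

lemma op_marg {Θ : Rn d × Rn d → ℂ} (hΘ : Rapid (stdBasis₂ d) Θ) (s : Fin d ⊕ Fin d) :
    op (stdBasis d) s (marg Θ) = marg (op (stdBasis₂ d) (fstOp s) Θ) := by
  rw [show marg Θ = fun x => pFT Θ (x, 0) from funext (marg_eq_pFT Θ),
    op_slice_fst (contDiff_pFT hΘ), op_pFT hΘ]
  funext x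
  rw [marg_eq_pFT]
  cases s <;> simp [fstOp, ftOp, ftCoeff]

lemma act_marg {Θ : Rn d × Rn d → ℂ} (hΘ : Rapid (stdBasis₂ d) Θ) (l : List (Fin d ⊕ Fin d)) :
    act (stdBasis d) l (marg Θ) = marg (act (stdBasis₂ d) (l.map fstOp) Θ) := by
  induction l with
  | nil => rfl
  | cons s l ih => rw [act_cons, ih, op_marg (hΘ.act _), List.map_cons, act_cons]

lemma wtame_marg : WTame (stdBasis₂ d) Sum.isLeft (stdBasis d) Sum.isLeft M N marg := by
  classical
  refine WBound.transfer M N marg (fun P Q => if Q = fstOp P then 1 else 0) (d + 1)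
    ((d + 1) ^ (d + 1) * ∫ t : Rn d, jap t) ?_ ?_ ?_ ?_
  · intro P Q h
    simp only [ne_eq, ite_eq_right_iff, one_ne_zero, imp_false, not_not] at h
    rw [h, isLeft_fstOp]
  · exact fun f hf => contDiff_marg hf
  · intro f hf P
    rw [op_marg hf]
    simp
  · intro f hf R hR x
    rw [marg_eq_pFT]
    exact norm_pFT_le hR _

lemma marg_mem (hM : M.Nontrivial c) (hN : N.Nontrivial c) {Θ : Rn d × Rn d → ℂ}
    (hΘ : Θ ∈ GS₂ c d M M N N) : marg Θ ∈ GS c d M N :=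
  (mem_space_iff (compat_GS M N) hM hN).2
    (wtame_marg.quant ((mem_space_iff (compat_GS₂ M N) hM hN).1 hΘ))

section Embedding

open scoped ENNReal

/-- The test functions with estimates for a fixed parameter. -/
def boundedSub (c : GSType) (d : ℕ) (M N : WeightSeq) (A : ℝ) : Submodule ℂ (GS c d M N) where
  carrier := {φ | ∃ C, WBound (stdBasis d) Sum.isLeft M N A C (φ : Rn d → ℂ)}
  zero_mem' := ⟨0, contDiff_const, fun l x => by simp [act_zero]⟩
  add_mem' := fun ⟨C, hC⟩ ⟨D, hD⟩ => ⟨C + D, hC.add hD⟩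
  smul_mem' := fun a _ ⟨C, hC⟩ => ⟨‖a‖ * C, hC.smul a⟩

/-- The values of all words applied to `φ`, divided by their weights. -/
def wordValues (M N : WeightSeq) (A : ℝ) (φ : Rn d → ℂ) :
    (p : List (Fin d ⊕ Fin d) × Rn d) → (fun _ => ℂ) p := fun p =>
  act (stdBasis d) p.1 φ p.2 / (wtc M N A (nT Sum.isLeft p.1) (nF Sum.isLeft p.1) : ℂ)

variable {A C : ℝ} {φ ψ : Rn d → ℂ}

lemma norm_wordValues_le (hA : 0 < A) {R : ℝ} {p : List (Fin d ⊕ Fin d) × Rn d}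
    (h : ‖act (stdBasis d) p.1 φ p.2‖ ≤ R * wtc M N A (nT Sum.isLeft p.1) (nF Sum.isLeft p.1)) :
    ‖wordValues M N A φ p‖ ≤ R := by
  have hw := wtc_pos (M := M) (N := N) hA (nT Sum.isLeft p.1) (nF Sum.isLeft p.1)
  rw [wordValues, norm_div, Complex.norm_real, Real.norm_of_nonneg hw.le, div_le_iff₀ hw]
  exact h

lemma WBound.memℓp (hA : 0 < A) (h : WBound (stdBasis d) Sum.isLeft M N A C φ) :
    Memℓp (wordValues M N A φ) ∞ :=
  memℓp_infty ⟨C, by rintro _ ⟨p, rfl⟩; exact norm_wordValues_le hA (h.2 p.1 p.2)⟩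

lemma wordValues_add (hφ : ContDiff ℝ ∞ φ) (hψ : ContDiff ℝ ∞ ψ) :
    wordValues M N A (φ + ψ) = wordValues M N A φ + wordValues M N A ψ := by
  funext p; simp [wordValues, act_add _ hφ hψ, add_div]

lemma wordValues_smul (a : ℂ) (hφ : ContDiff ℝ ∞ φ) :
    wordValues M N A (a • φ) = a • wordValues M N A φ := by
  funext p; simp [wordValues, act_smul _ a hφ, mul_div_assoc]

/-- The test functions with estimates for a fixed parameter, as bounded families. -/
def embed (c : GSType) (d : ℕ) (M N : WeightSeq) {A : ℝ} (hA : 0 < A) :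
    boundedSub c d M N A →ₗ[ℂ] lp (fun _ : List (Fin d ⊕ Fin d) × Rn d => ℂ) ∞ where
  toFun φ := ⟨wordValues M N A (φ.1 : Rn d → ℂ), φ.2.choose_spec.memℓp hA⟩
  map_add' φ ψ := Subtype.ext (wordValues_add φ.2.choose_spec.1 ψ.2.choose_spec.1)
  map_smul' a φ := Subtype.ext (wordValues_smul a φ.2.choose_spec.1)

lemma embed_injective (hA : 0 < A) : Function.Injective (embed c d M N hA) := by
  intro φ ψ h
  refine Subtype.ext (Subtype.ext (funext fun x => ?_))
  have := congrFun (congrArg Subtype.val h) ([], x)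
  simpa [embed, wordValues, wtc_zero] using this

/-- A functional that is bounded for the norm with parameter `A` extends to all bounded families,
by the Hahn-Banach theorem. -/
lemma WDual.exists_extension (hA : 0 < A) {u : GSDual c d M N} {K : ℝ}
    (hu : WDual Sum.isLeft M N u.lin A K) :
    ∃ v : lp (fun _ : List (Fin d ⊕ Fin d) × Rn d => ℂ) ∞ →L[ℂ] ℂ, ∀ φ ∈ GS c d M N, ∀ C,
      WBound (stdBasis d) Sum.isLeft M N A C φ → ∀ F, (∀ p, F p = wordValues M N A φ p) →
        v F = u.ev φ := by
  let e := LinearEquiv.ofInjective (embed c d M N hA) (embed_injective hA)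
  let f : LinearMap.range (embed c d M N hA) →ₗ[ℂ] ℂ :=
    u.lin ∘ₗ (boundedSub c d M N A).subtype ∘ₗ (e.symm : _ →ₗ[ℂ] _)
  have hf : ∀ y, ‖f y‖ ≤ K * ‖y‖ := by
    intro y
    obtain ⟨φ, rfl⟩ := e.surjective y
    obtain ⟨C, hC⟩ := φ.2
    have e1 : f (e φ) = u.lin φ.1 := by simp [f]
    rw [e1]
    refine hu φ.1 _ ⟨hC.1, fun l x => ?_⟩
    have h1 := lp.norm_apply_le_norm (by simp) (embed c d M N hA φ) (l, x)
    have hw := wtc_pos (M := M) (N := N) hA (nT Sum.isLeft l) (nF Sum.isLeft l)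
    change ‖wordValues M N A (φ.1 : Rn d → ℂ) (l, x)‖ ≤ _ at h1
    rw [wordValues, norm_div, Complex.norm_real, Real.norm_of_nonneg hw.le, div_le_iff₀ hw] at h1
    exact h1
  obtain ⟨v, hv, -⟩ := exists_extension_norm_eq _ (f.mkContinuous K hf)
  refine ⟨v, fun φ hφ C hC F hF => ?_⟩
  let φ' : boundedSub c d M N A := ⟨⟨φ, hφ⟩, C, hC⟩
  have e1 : F = (e φ' : lp (fun _ : List (Fin d ⊕ Fin d) × Rn d => ℂ) ∞) :=
    Subtype.ext (funext hF)
  rw [e1, hv, LinearMap.mkContinuous_apply, Dual.ev_of_mem hφ]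
  simp [f, φ']

/-- Functionals commute with integration over a parameter. -/
theorem Dual.ev_marg (hM : M.Nontrivial c) (hN : N.Nontrivial c) (u : GSDual c d M N)
    {Θ : Rn d × Rn d → ℂ} (hΘ : Θ ∈ GS₂ c d M M N N) :
    u.ev (marg Θ) = ∫ y, u.ev fun x => Θ (x, y) := by
  obtain ⟨κ, hκ, hw⟩ := exists_wtc_add_le_of_le M N
  obtain ⟨κ', hκ', hmarg⟩ := wtame_marg (d := d) (M := M) (N := N)
  obtain ⟨T, hT, hLip⟩ := exists_norm_sub_le (stdBasis₂ d)
  have hm : 0 < max κ κ' := lt_max_of_lt_right hκ'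
  obtain ⟨A, hA, ⟨C, hC⟩, L, hL, hu⟩ := exists_wbound_wdual (compat_GS₂ M N) (compat_GS M N) hM hN
    hm hΘ u
  have hC0 := hC.nonneg
  set B := max κ κ' * A with hB
  have hB0 : 0 < B := by positivity
  have hκB : κ * A ≤ B := mul_le_mul_of_nonneg_right (le_max_left _ _) hA.le
  have hκB' : κ' * A ≤ B := mul_le_mul_of_nonneg_right (le_max_right _ _) hA.le
  have hAB : A ≤ B := (le_mul_of_one_le_left hA.le hκ).trans hκB
  obtain ⟨v, hv⟩ := hu.exists_extension hB0
  obtain ⟨K, hK1, hK⟩ := hw A hA (d + 1)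
  have hact : ∀ (m : List ((Fin d ⊕ Fin d) ⊕ (Fin d ⊕ Fin d))) (l : List (Fin d ⊕ Fin d)),
      m.length ≤ d + 1 → ∀ z, ‖act (stdBasis₂ d) m (act (stdBasis₂ d) (l.map fstOp) Θ) z‖ ≤
        C * K * wtc M N B (nT Sum.isLeft l) (nF Sum.isLeft l) := by
    intro m l hm z
    refine (hC.act_act_le hK m (l.map fstOp) hm z).trans ?_
    rw [nT_map_fstOp, nF_map_fstOp]
    have := wtc_mono (M := M) (N := N) (show 0 < κ * A by positivity) hκB
      (nT Sum.isLeft l) (nF Sum.isLeft l)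
    gcongr
  have hslice : ∀ y, WBound (stdBasis d) Sum.isLeft M N B C fun x => Θ (x, y) :=
    fun y => (hC.slice_fst y).mono hA hAB
  -- the slices as a function with values in a Banach space
  let G : Rn d → lp (fun _ : List (Fin d ⊕ Fin d) × Rn d => ℂ) ∞ := fun y =>
    ⟨wordValues M N B fun x => Θ (x, y), (hslice y).memℓp hB0⟩
  have hGapp : ∀ y p, G y p = wordValues M N B (fun x => Θ (x, y)) p := fun y p => rfl
  have hGcont : Continuous G := by
    refine LipschitzWith.continuous (K := (T * (C * K)).toNNReal) (LipschitzWith.of_dist_le_mul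
      fun y y' => ?_)
    rw [dist_eq_norm, dist_eq_norm, Real.coe_toNNReal _ (by positivity)]
    refine lp.norm_le_of_forall_le (by positivity) fun p => ?_
    have e1 : (G y - G y') p = wordValues M N B ((fun x => Θ (x, y)) - fun x => Θ (x, y')) p := by
      rw [lp.coeFn_sub, Pi.sub_apply, hGapp, hGapp, wordValues, wordValues, wordValues,
        act_sub _ (hslice y).1 (hslice y').1, Pi.sub_apply, sub_div]
    rw [e1]
    refine norm_wordValues_le hB0 ?_
    rw [act_sub _ (hslice y).1 (hslice y').1, Pi.sub_apply, act_slice_fst hC.1, act_slice_fst hC.1]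
    have h1 := hLip _ _ (contDiff_act (p.1.map fstOp) hC.1)
      (fun i z => hact [.inr i] p.1 (by simp) z) (p.2, y') (p.2, y)
    have e2 : ‖((p.2, y) : Rn d × Rn d) - (p.2, y')‖ = ‖y - y'‖ := by simp [Prod.norm_def]
    rw [e2] at h1
    exact h1.trans (le_of_eq (by ring))
  have hGint : Integrable G := by
    refine (integrable_jap.const_mul ((d + 1) ^ (d + 1) * (C * K))).mono'
      hGcont.aestronglyMeasurable (Eventually.of_forall fun y => ?_)
    have hj := jap_pos y
    refine lp.norm_le_of_forall_le (by positivity) fun p => ?_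
    rw [hGapp]
    refine norm_wordValues_le hB0 ?_
    rw [act_slice_fst hC.1]
    refine (norm_le_jap_snd fun m hm => hact m p.1 hm _).trans (le_of_eq (by ring))
  obtain ⟨K', -, hK'⟩ := hmarg A hA
  have h1 := hv (marg Θ) (marg_mem hM hN hΘ) _ ((hK' C Θ hC).mono (by positivity) hκB') (∫ y, G y)
    fun p => by
      have e1 := (lp.evalCLM ℂ (fun _ : List (Fin d ⊕ Fin d) × Rn d => ℂ) ∞ p).integral_comp_comm
        hGint
      refine e1.symm.trans ?_
      rw [wordValues, act_marg hC.rapid, marg, ← integral_div]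
      refine integral_congr_ae (Eventually.of_forall fun y => ?_)
      change G y p = _
      rw [hGapp, wordValues, act_slice_fst hC.1]
  rw [← h1, ← v.integral_comp_comm hGint]
  exact integral_congr_ae (Eventually.of_forall fun y =>
    hv _ (slice_fst_mem hM hN hΘ y) C (hslice y) (G y) (hGapp y))

end Embedding

end

section

/-! ### Regularization -/

section RapidTransfer

variable {ι ι' ι₂ : Type} [Fintype ι] [Fintype ι'] [Fintype ι₂]
  {E E' E₂ : Type} [NormedAddCommGroup E] [NormedSpace ℝ E]
  [NormedAddCommGroup E'] [NormedSpace ℝ E'] [NormedAddCommGroup E₂] [NormedSpace ℝ E₂]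
  {b : Module.Basis ι ℝ E} {b' : Module.Basis ι' ℝ E'} {b₂ : Module.Basis ι₂ ℝ E₂}

/-- Bilinear operators that satisfy a product rule for the elementary operators preserve rapid
decrease. -/
lemma rapid_bitransfer {U : (E → ℂ) → (E₂ → ℂ) → E' → ℂ} {k : ι' ⊕ ι' → ι ⊕ ι → ℂ}
    {k₂ : ι' ⊕ ι' → ι₂ ⊕ ι₂ → ℂ}
    (hsmooth : ∀ f g, Rapid b f → Rapid b₂ g → ContDiff ℝ ∞ (U f g))
    (hop : ∀ f g, Rapid b f → Rapid b₂ g → ∀ P, op b' P (U f g) =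
      ∑ Q, k P Q • U (op b Q f) g + ∑ Q, k₂ P Q • U f (op b₂ Q g))
    (hbdd : ∀ f g, Rapid b f → Rapid b₂ g → ∃ C, ∀ y, ‖U f g y‖ ≤ C) {f : E → ℂ} {g : E₂ → ℂ}
    (hf : Rapid b f) (hg : Rapid b₂ g) : Rapid b' (U f g) := by
  refine ⟨hsmooth f g hf hg, fun l => ?_⟩
  induction l using List.reverseRecOn generalizing f g with
  | nil => exact hbdd f g hf hg
  | append_singleton l P ih =>
    choose C hC using fun Q => ih (hf.op Q) hg
    choose D hD using fun Q => ih hf (hg.op Q)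
    have s1 : ∀ Q ∈ Finset.univ, ContDiff ℝ ∞ (k P Q • U (op b Q f) g) :=
      fun Q _ => contDiff_smul' _ (hsmooth _ _ (hf.op Q) hg)
    have s2 : ∀ Q ∈ Finset.univ, ContDiff ℝ ∞ (k₂ P Q • U f (op b₂ Q g)) :=
      fun Q _ => contDiff_smul' _ (hsmooth _ _ hf (hg.op Q))
    refine ⟨∑ Q, ‖k P Q‖ * C Q + ∑ Q, ‖k₂ P Q‖ * D Q, fun y => ?_⟩
    rw [act_append, act_cons, act_nil, hop f g hf hg, act_add l (contDiff_sum' _ s1)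
      (contDiff_sum' _ s2), act_sum l _ s1, act_sum l _ s2, Pi.add_apply, Finset.sum_apply,
      Finset.sum_apply]
    refine (norm_add_le _ _).trans (add_le_add ((norm_sum_le _ _).trans (Finset.sum_le_sum
      fun Q _ => ?_)) ((norm_sum_le _ _).trans (Finset.sum_le_sum fun Q _ => ?_)))
    · rw [act_smul _ _ (hsmooth _ _ (hf.op Q) hg), Pi.smul_apply, norm_smul]
      exact mul_le_mul_of_nonneg_left (hC Q y) (norm_nonneg _)
    · rw [act_smul _ _ (hsmooth _ _ hf (hg.op Q)), Pi.smul_apply, norm_smul]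
      exact mul_le_mul_of_nonneg_left (hD Q y) (norm_nonneg _)

end RapidTransfer

variable {d : ℕ} {M N : WeightSeq} {c : GSType} {ε : ℝ} {φ : Rn d → ℂ} {Γ : Rn d × Rn d → ℂ}

/-- The integrand of the regularization of `φ`: the function `Γ` provides both the mollifier (in
the second variable) and the cut-off (in the first variable). -/
def regInt (ε : ℝ) (φ : Rn d → ℂ) (Γ : Rn d × Rn d → ℂ) : Rn d × Rn d → ℂ := fun z =>
  Γ (ε • z.1, z.2) * φ (z.1 - ε • z.2)

/-- The regularization `x ↦ ∫ Γ(ε x, s) φ(x - ε s) ds`. -/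
def reg (ε : ℝ) (φ : Rn d → ℂ) (Γ : Rn d × Rn d → ℂ) : Rn d → ℂ := marg (regInt ε φ Γ)

lemma contDiff_regInt (ε : ℝ) (hφ : ContDiff ℝ ∞ φ) (hΓ : ContDiff ℝ ∞ Γ) :
    ContDiff ℝ ∞ (regInt ε φ Γ) :=
  (hΓ.comp ((contDiff_fst.const_smul ε).prodMk contDiff_snd)).mul
    (hφ.comp (contDiff_fst.sub (contDiff_snd.const_smul ε)))

lemma hasFDerivAt_regInt (ε : ℝ) (hφ : ContDiff ℝ ∞ φ) (hΓ : ContDiff ℝ ∞ Γ) (z : Rn d × Rn d) :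
    HasFDerivAt (regInt ε φ Γ)
      (Γ (ε • z.1, z.2) • (fderiv ℝ φ (z.1 - ε • z.2)).comp
        (ContinuousLinearMap.fst ℝ (Rn d) (Rn d) - ε • ContinuousLinearMap.snd ℝ (Rn d) (Rn d)) +
      φ (z.1 - ε • z.2) • (fderiv ℝ Γ (ε • z.1, z.2)).comp
        ((ε • ContinuousLinearMap.fst ℝ (Rn d) (Rn d)).prod
          (ContinuousLinearMap.snd ℝ (Rn d) (Rn d)))) z := by
  have h1 : HasFDerivAt (fun z : Rn d × Rn d => (ε • z.1, z.2))
      ((ε • ContinuousLinearMap.fst ℝ (Rn d) (Rn d)).prod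
        (ContinuousLinearMap.snd ℝ (Rn d) (Rn d))) z :=
    (hasFDerivAt_fst.const_smul ε).prodMk hasFDerivAt_snd
  have h2 : HasFDerivAt (fun z : Rn d × Rn d => z.1 - ε • z.2)
      (ContinuousLinearMap.fst ℝ (Rn d) (Rn d) - ε • ContinuousLinearMap.snd ℝ (Rn d) (Rn d)) z :=
    hasFDerivAt_fst.sub (hasFDerivAt_snd.const_smul ε)
  have h3 : HasFDerivAt Γ (fderiv ℝ Γ (ε • z.1, z.2)) (ε • z.1, z.2) :=
    (hΓ.differentiable (by simp) _).hasFDerivAt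
  have h4 : HasFDerivAt φ (fderiv ℝ φ (z.1 - ε • z.2)) (z.1 - ε • z.2) :=
    (hφ.differentiable (by simp) _).hasFDerivAt
  exact (HasFDerivAt.comp z h3 h1).mul (HasFDerivAt.comp z h4 h2)

/-- The coefficients of `regInt ε (Q φ) Γ` in the image of `regInt ε φ Γ` under `P`. Multiplications by
coordinates are all attributed to `Γ`. -/
def regCoeff (ε : ℝ) (P : (Fin d ⊕ Fin d) ⊕ (Fin d ⊕ Fin d)) (Q : Fin d ⊕ Fin d) : ℂ :=
  match P with
  | .inl _ => 0
  | .inr (.inl i) => if Q = .inr i then 1 else 0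
  | .inr (.inr i) => if Q = .inr i then -(ε : ℂ) else 0

/-- The coefficients of `regInt ε φ (Q Γ)` in the image of `regInt ε φ Γ` under `P`. The factor `ε⁻¹` is
harmless where `ε` is fixed; estimates uniform in `ε` come from `op_reg`. -/
def regCoeff₂ (ε : ℝ) (P Q : (Fin d ⊕ Fin d) ⊕ (Fin d ⊕ Fin d)) : ℂ :=
  if Q = P then
    match P with
    | .inl (.inl _) => (ε : ℂ)⁻¹
    | .inr (.inl _) => ε
    | _ => 1
  else 0

lemma isLeft_of_regCoeff (P : (Fin d ⊕ Fin d) ⊕ (Fin d ⊕ Fin d)) (Q : Fin d ⊕ Fin d)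
    (h : regCoeff ε P Q ≠ 0) : Q.isLeft = P.isLeft := by
  rcases P with (i | i) | (i | i) <;> rcases Q with j | j <;> simp [regCoeff] at h ⊢

lemma isLeft_of_regCoeff₂ (P Q : (Fin d ⊕ Fin d) ⊕ (Fin d ⊕ Fin d))
    (h : regCoeff₂ ε P Q ≠ 0) : Q.isLeft = P.isLeft := by
  by_cases hPQ : Q = P
  · rw [hPQ]
  · simp [regCoeff₂, hPQ] at h

lemma op_regInt (hε : ε ≠ 0) (hφ : ContDiff ℝ ∞ φ) (hΓ : ContDiff ℝ ∞ Γ)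
    (P : (Fin d ⊕ Fin d) ⊕ (Fin d ⊕ Fin d)) : op (stdBasis₂ d) P (regInt ε φ Γ) =
      ∑ Q, regCoeff ε P Q • regInt ε (op (stdBasis d) Q φ) Γ +
        ∑ Q, regCoeff₂ ε P Q • regInt ε φ (op (stdBasis₂ d) Q Γ) := by
  have hε' : (ε : ℂ) ≠ 0 := by exact_mod_cast hε
  funext z
  have e2 : ∀ v, fderiv ℝ Γ (ε • z.1, z.2) (ε • v, 0) =
      ε * fderiv ℝ Γ (ε • z.1, z.2) (v, 0) := fun v => by
    rw [show ((ε • v, 0) : Rn d × Rn d) = ε • (v, 0) by simp, map_smul]; simp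
  rcases P with (i | i) | (i | i)
  · simp [op, regCoeff, regCoeff₂, regInt]
    field_simp
  · simp [op, regCoeff, regCoeff₂, regInt]
    ring
  · refine (dirDeriv_of_hasFDerivAt (hasFDerivAt_regInt ε hφ hΓ z) _).trans ?_
    simp [op, regCoeff, regCoeff₂, regInt, dirDeriv, stdBasis₂_inl, e2]
    ring
  · refine (dirDeriv_of_hasFDerivAt (hasFDerivAt_regInt ε hφ hΓ z) _).trans ?_
    simp [op, regCoeff, regCoeff₂, regInt, dirDeriv, stdBasis₂_inr]
    ring

lemma rapid_regInt (hε : ε ≠ 0) (hφ : Rapid (stdBasis d) φ) (hΓ : Rapid (stdBasis₂ d) Γ) :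
    Rapid (stdBasis₂ d) (regInt ε φ Γ) := by
  refine rapid_bitransfer (b := stdBasis d) (b₂ := stdBasis₂ d) (U := regInt ε)
    (fun f g hf hg => contDiff_regInt ε hf.1 hg.1)
    (fun f g hf hg P => op_regInt hε hf.1 hg.1 P) (fun f g hf hg => ?_) hφ hΓ
  obtain ⟨C, hC⟩ := hf.2 []
  obtain ⟨D, hD⟩ := hg.2 []
  refine ⟨D * C, fun z => ?_⟩
  rw [regInt, norm_mul]
  exact mul_le_mul (hD _) (hC _) (norm_nonneg _) ((norm_nonneg _).trans (hD 0))

lemma regInt_mem (hM : M.Nontrivial c) (hN : N.Nontrivial c) (hε : ε ≠ 0)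
    (hφ : φ ∈ GS c d M N) (hΓ : Γ ∈ GS₂ c d M M N N) : regInt ε φ Γ ∈ GS₂ c d M M N N := by
  have h := ((mem_space_iff (compat_GS M N) hM hN).1 hφ).and
    ((mem_space_iff (compat_GS₂ M N) hM hN).1 hΓ)
    (fun A A' hA h ⟨C, hC⟩ => ⟨C, hC.mono hA h⟩) (fun A A' hA h ⟨C, hC⟩ => ⟨C, hC.mono hA h⟩)
  refine (mem_space_iff (compat_GS₂ M N) hM hN).2 ?_
  obtain ⟨L, hL1, hLP⟩ : ∃ L : ℝ, 1 ≤ L ∧ ∀ P, ∑ Q, ‖regCoeff (d := d) ε P Q‖ +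
      ∑ Q, ‖regCoeff₂ (d := d) ε P Q‖ ≤ L := by
    obtain ⟨L, hL⟩ := Finite.exists_le fun P => ∑ Q, ‖regCoeff (d := d) ε P Q‖ +
      ∑ Q, ‖regCoeff₂ (d := d) ε P Q‖
    exact ⟨max 1 L, le_max_left _ _, fun P => (hL P).trans (le_max_right _ _)⟩
  obtain ⟨κ, hκ, haux⟩ := WBound.bitransfer_aux (b := stdBasis d) (b' := stdBasis₂ d)
    (b₂ := stdBasis₂ d) (τ := Sum.isLeft) (τ₂ := Sum.isLeft) (τ' := Sum.isLeft) M N 0 L hL1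
  refine (GSType.tame_of_linear (R := fun A A' => A' = (L * κ) * A)
    (by positivity) fun A _ => rfl).quant₁ h ?_
  rintro A _ hA - rfl ⟨⟨C, hC⟩, D, hD⟩
  obtain ⟨K, hK, h1⟩ := haux A hA
  have h2 := h1 (regInt ε) (regCoeff ε) (regCoeff₂ ε) 1 zero_le_one
    isLeft_of_regCoeff isLeft_of_regCoeff₂
    hLP (fun f g hf hg => contDiff_regInt ε hf.1 hg.1)
    (fun f g hf hg P => op_regInt hε hf.1 hg.1 P)
    (fun f g hf hg R R₂ hR hR₂ z => by
      rw [regInt, norm_mul, one_mul, mul_comm]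
      exact mul_le_mul (hR [] (by simp) _) (hR₂ [] (by simp) _) (norm_nonneg _)
        ((norm_nonneg _).trans (hR [] (by simp) 0))) C D φ Γ hC hD
  refine ⟨K * (C * D), contDiff_regInt ε hC.1 hD.1, fun l z => (h2 l [] [] z).trans (le_of_eq ?_)⟩
  simp only [nT_nil, nF_nil, add_zero]
  rw [mul_assoc L, wtc_smul L, nT_add_nF]
  ring

/-- The operator that falls on `Γ` when an operator is applied to the regularization. -/
def regOp : Fin d ⊕ Fin d → (Fin d ⊕ Fin d) ⊕ (Fin d ⊕ Fin d)
  | .inl i => .inl (.inr i)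
  | .inr i => .inr (.inl i)

@[simp] lemma isLeft_regOp (s : Fin d ⊕ Fin d) : (regOp s).isLeft = s.isLeft := by
  cases s <;> rfl

lemma contDiff_reg (hε : ε ≠ 0) (hφ : Rapid (stdBasis d) φ) (hΓ : Rapid (stdBasis₂ d) Γ) :
    ContDiff ℝ ∞ (reg ε φ Γ) := contDiff_marg (rapid_regInt hε hφ hΓ)

/-- Up to an error of order `ε`, regularization commutes with the elementary operators. -/
lemma op_reg (hε : ε ≠ 0) (hφ : Rapid (stdBasis d) φ) (hΓ : Rapid (stdBasis₂ d) Γ)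
    (s : Fin d ⊕ Fin d) : op (stdBasis d) s (reg ε φ Γ) =
      reg ε (op (stdBasis d) s φ) Γ + (ε : ℂ) • reg ε φ (op (stdBasis₂ d) (regOp s) Γ) := by
  have e1 : op (stdBasis₂ d) (fstOp s) (regInt ε φ Γ) =
      regInt ε (op (stdBasis d) s φ) Γ + (ε : ℂ) • regInt ε φ (op (stdBasis₂ d) (regOp s) Γ) := by
    cases s with
    | inl i =>
      funext z
      simp [op, fstOp, regOp, regInt]
      ring
    | inr i =>
      rw [op_regInt hε hφ.1 hΓ.1]
      simp [fstOp, regOp, regCoeff, regCoeff₂]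
  have i1 := rapid_regInt hε (hφ.op s) hΓ
  have i2 := rapid_regInt hε hφ (hΓ.op (regOp s))
  rw [reg, op_marg (rapid_regInt hε hφ hΓ), e1]
  funext x
  simp only [reg, marg, Pi.add_apply, Pi.smul_apply, smul_eq_mul]
  rw [integral_add (i1.integrable_slice x) ((i2.integrable_slice x).const_mul _),
    integral_const_mul]

end

section

variable {d : ℕ} {M N : WeightSeq} {c : GSType} {ε : ℝ} {φ : Rn d → ℂ} {Γ : Rn d × Rn d → ℂ}

lemma norm_mul_norm_le {f : Rn d → ℂ} {R : ℝ} {x : Rn d}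
    (h : ∀ i, ‖op (stdBasis d) (.inl i) f x‖ ≤ R) : ‖x‖ * ‖f x‖ ≤ d * R := by
  refine (mul_le_mul_of_nonneg_right (norm_le_sum_abs x) (norm_nonneg _)).trans ?_
  rw [Finset.sum_mul]
  refine (Finset.sum_le_card_nsmul _ _ R fun i _ => ?_).trans (by simp)
  have := h i
  rwa [op, norm_mul, Complex.norm_real, stdBasis_repr, Real.norm_eq_abs] at this

/-- The regularization is bounded uniformly in `ε`, and it differs from a multiple of the original
function by a term of order `ε`. -/
lemma exists_norm_reg_le (d : ℕ) : ∃ c₀, 0 ≤ c₀ ∧ ∀ (ε : ℝ) (φ : Rn d → ℂ)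
    (Γ : Rn d × Rn d → ℂ) (R R₂ : ℝ), 0 < ε → Rapid (stdBasis d) φ → Rapid (stdBasis₂ d) Γ →
    (∀ m : List (Fin d ⊕ Fin d), m.length ≤ d + 2 → ∀ x, ‖act (stdBasis d) m φ x‖ ≤ R) →
    (∀ m : List ((Fin d ⊕ Fin d) ⊕ (Fin d ⊕ Fin d)), m.length ≤ d + 2 → ∀ z,
      ‖act (stdBasis₂ d) m Γ z‖ ≤ R₂) → ∀ x, ‖reg ε φ Γ x‖ ≤ c₀ * (R * R₂) ∧
        ‖reg ε φ Γ x - marg Γ 0 * φ x‖ ≤ ε * (c₀ * (R * R₂)) := by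
  obtain ⟨T, hT, hLip⟩ := exists_norm_sub_le (stdBasis d)
  set q : ℝ := (d + 1) ^ (d + 1) with hq
  have hq0 : 0 ≤ q := by positivity
  have hj0 : 0 ≤ ∫ t : Rn d, jap t := integral_nonneg fun t => (jap_pos t).le
  refine ⟨(1 + 2 * T * d) * q * ∫ t : Rn d, jap t, by positivity, ?_⟩
  intro ε φ Γ R R₂ hε hφ hΓ hR hR₂ x
  have hR0 : 0 ≤ R := (norm_nonneg _).trans (hR [] (by simp) 0)
  have hR₂0 : 0 ≤ R₂ := (norm_nonneg _).trans (hR₂ [] (by simp) 0)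
  have hΓj : ∀ z : Rn d × Rn d, ‖Γ z‖ ≤ q * R₂ * jap z.2 := fun z =>
    norm_le_jap_snd fun m hm => hR₂ m (by omega) _
  have hΓj' : ∀ P (z : Rn d × Rn d), ‖op (stdBasis₂ d) P Γ z‖ ≤ q * R₂ * jap z.2 := fun P z =>
    norm_le_jap_snd fun m hm => by
      have := hR₂ (m ++ [P]) (by simp; omega) z
      rwa [act_append] at this
  constructor
  · refine (norm_integral_le_of_norm_le (integrable_jap.const_mul (R * R₂ * q))
      (Eventually.of_forall fun s => ?_)).trans ?_
    · rw [regInt, norm_mul]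
      have h1 := hΓj (ε • x, s)
      have h2 := hR [] (by simp) (x - ε • s)
      have := jap_pos s
      calc _ ≤ (q * R₂ * jap s) * R := mul_le_mul h1 h2 (norm_nonneg _) (by positivity)
        _ = _ := by ring
    · rw [integral_const_mul]
      have : 0 ≤ 2 * T * d * (q * (∫ t : Rn d, jap t) * (R * R₂)) := by positivity
      linarith
  · have i1 := (rapid_regInt hε.ne' hφ hΓ).integrable_slice x
    have i2 := (hΓ.integrable_slice 0).mul_const (φ x)
    rw [reg, marg, marg, ← integral_mul_const, ← integral_sub i1 i2]
    refine (norm_integral_le_of_norm_le (integrable_jap.const_mul (ε * (2 * T * d * q * (R * R₂))))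
      (Eventually.of_forall fun s => ?_)).trans ?_
    · have hj := jap_pos s
      have h1 : ‖Γ (ε • x, s) - Γ (0, s)‖ ≤ T * (q * R₂ * jap s) * ‖ε • x - 0‖ :=
        hLip (fun y => Γ (y, s)) _ (contDiff_slice_fst hΓ.1 s) (fun i y => by
          rw [op_slice_fst hΓ.1]; exact hΓj' _ (y, s)) 0 (ε • x)
      have h2 : ‖φ (x - ε • s) - φ x‖ ≤ T * R * ‖x - ε • s - x‖ :=
        hLip φ R hφ.1 (fun i y => hR [.inr i] (by simp) y) x _
      have h3 : ‖x‖ * ‖φ x‖ ≤ d * R := norm_mul_norm_le fun i => hR [.inl i] (by simp) x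
      have h4 : ‖s‖ * ‖Γ (ε • x, s)‖ ≤ d * (q * R₂ * jap s) :=
        norm_mul_norm_le (f := fun s => Γ (ε • x, s)) fun i => by
          rw [op_slice hΓ.1]; exact hΓj' _ (ε • x, s)
      rw [sub_zero, norm_smul, Real.norm_of_nonneg hε.le] at h1
      rw [sub_sub_cancel_left, norm_neg, norm_smul, Real.norm_of_nonneg hε.le] at h2
      have e : regInt ε φ Γ (x, s) - Γ (0, s) * φ x =
          (Γ (ε • x, s) - Γ (0, s)) * φ x + Γ (ε • x, s) * (φ (x - ε • s) - φ x) := by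
        rw [regInt]; ring
      rw [e]
      refine (norm_add_le _ _).trans ?_
      rw [norm_mul, norm_mul]
      calc _ ≤ (T * (q * R₂ * jap s) * (ε * ‖x‖)) * ‖φ x‖ +
            ‖Γ (ε • x, s)‖ * (T * R * (ε * ‖s‖)) := by gcongr
        _ = T * (q * R₂ * jap s) * ε * (‖x‖ * ‖φ x‖) +
            T * R * ε * (‖s‖ * ‖Γ (ε • x, s)‖) := by ring
        _ ≤ T * (q * R₂ * jap s) * ε * (d * R) + T * R * ε * (d * (q * R₂ * jap s)) := by gcongr
        _ = _ := by ring
    · rw [integral_const_mul]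
      have : 0 ≤ ε * (q * (∫ t : Rn d, jap t) * (R * R₂)) := by positivity
      linarith

/-- The estimates for regularization in the scale of norms. -/
lemma exists_wbound_reg_sub (d : ℕ) (M N : WeightSeq) : ∃ κ : ℝ, 0 < κ ∧ ∀ A, 0 < A →
    ∃ K : ℝ, 0 ≤ K ∧ ∀ (ε C C₂ : ℝ) (φ : Rn d → ℂ) (Γ : Rn d × Rn d → ℂ), 0 < ε → ε ≤ 1 →
      WBound (stdBasis d) Sum.isLeft M N A C φ →
      WBound (stdBasis₂ d) Sum.isLeft M N A C₂ Γ →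
      WBound (stdBasis d) Sum.isLeft M N (κ * A) (ε * (K * C₂) * C)
        (reg ε φ Γ - marg Γ 0 • φ) := by
  obtain ⟨κ, hκ, hw⟩ := exists_wtc_add_le_of_le M N
  obtain ⟨c₀, hc₀, hreg⟩ := exists_norm_reg_le d
  refine ⟨4 * κ, by positivity, fun A hA => ?_⟩
  obtain ⟨K, hK1, hK⟩ := hw A hA (d + 2)
  refine ⟨c₀ * (K * K), by positivity, fun ε C C₂ φ Γ hε hε1 hφ hΓ => ?_⟩
  have hC := hφ.nonneg
  have hC₂ := hΓ.nonneg
  have hB : 0 < κ * A := by positivity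
  set D := c₀ * ((C * K) * (C₂ * K)) with hD
  have hD0 : 0 ≤ D := by positivity
  let Y : ℕ → ℕ → ℝ := fun p q => D * wtc M N (κ * A) p q
  have hY0 : ∀ p q, 0 ≤ Y p q := fun p q => mul_nonneg hD0 (wtc_pos hB p q).le
  have s1 : ∀ m m₂, ContDiff ℝ ∞ (reg ε (act (stdBasis d) m φ) (act (stdBasis₂ d) m₂ Γ)) :=
    fun m m₂ => contDiff_reg hε.ne' (hφ.rapid.act m) (hΓ.rapid.act m₂)
  -- the words act on the regularization of images under further words, so that the product rule
  -- `op_reg` applies in the inductive step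
  have main : ∀ l m m₂ x,
      ‖act (stdBasis d) l (reg ε (act (stdBasis d) m φ) (act (stdBasis₂ d) m₂ Γ)) x‖ ≤
        2 ^ l.length * Y (nT Sum.isLeft l + nT Sum.isLeft m + nT Sum.isLeft m₂)
          (nF Sum.isLeft l + nF Sum.isLeft m + nF Sum.isLeft m₂) ∧
      ‖act (stdBasis d) l (reg ε (act (stdBasis d) m φ) (act (stdBasis₂ d) m₂ Γ)) x -
          marg (act (stdBasis₂ d) m₂ Γ) 0 * act (stdBasis d) l (act (stdBasis d) m φ) x‖ ≤
        ε * (4 ^ l.length * Y (nT Sum.isLeft l + nT Sum.isLeft m + nT Sum.isLeft m₂)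
          (nF Sum.isLeft l + nF Sum.isLeft m + nF Sum.isLeft m₂)) := by
    intro l
    induction l using List.reverseRecOn with
    | nil =>
      intro m m₂ x
      have h1 := hreg ε _ _ _ _ hε (hφ.rapid.act m) (hΓ.rapid.act m₂) (hφ.act_act_le hK · m)
        (hΓ.act_act_le hK · m₂) x
      have h2 : c₀ * (C * K * wtc M N (κ * A) (nT Sum.isLeft m) (nF Sum.isLeft m) *
          (C₂ * K * wtc M N (κ * A) (nT Sum.isLeft m₂) (nF Sum.isLeft m₂))) ≤
          Y (nT Sum.isLeft m + nT Sum.isLeft m₂) (nF Sum.isLeft m + nF Sum.isLeft m₂) := by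
        have h3 := wtc_mul_le (M := M) (N := N) hB (nT Sum.isLeft m) (nF Sum.isLeft m)
          (nT Sum.isLeft m₂) (nF Sum.isLeft m₂)
        calc _ = D * (wtc M N (κ * A) (nT Sum.isLeft m) (nF Sum.isLeft m) *
              wtc M N (κ * A) (nT Sum.isLeft m₂) (nF Sum.isLeft m₂)) := by rw [hD]; ring
          _ ≤ _ := mul_le_mul_of_nonneg_left h3 hD0
      simp only [act_nil, List.length_nil, pow_zero, one_mul, nT_nil, nF_nil, zero_add]
      exact ⟨h1.1.trans h2, h1.2.trans (mul_le_mul_of_nonneg_left h2 hε.le)⟩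
    | append_singleton l P ih =>
      intro m m₂ x
      have e0 : op (stdBasis d) P (reg ε (act (stdBasis d) m φ) (act (stdBasis₂ d) m₂ Γ)) =
          reg ε (act (stdBasis d) (P :: m) φ) (act (stdBasis₂ d) m₂ Γ) +
            (ε : ℂ) • reg ε (act (stdBasis d) m φ) (act (stdBasis₂ d) (regOp P :: m₂) Γ) :=
        op_reg hε.ne' (hφ.rapid.act m) (hΓ.rapid.act m₂) P
      have e1 : act (stdBasis d) (l ++ [P]) (reg ε (act (stdBasis d) m φ)
          (act (stdBasis₂ d) m₂ Γ)) x =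
          act (stdBasis d) l (reg ε (act (stdBasis d) (P :: m) φ) (act (stdBasis₂ d) m₂ Γ)) x +
          ε * act (stdBasis d) l (reg ε (act (stdBasis d) m φ)
            (act (stdBasis₂ d) (regOp P :: m₂) Γ)) x := by
        rw [act_append, act_cons, act_nil, e0, act_add l (s1 (P :: m) m₂)
          (contDiff_smul' _ (s1 m (regOp P :: m₂))), act_smul l _ (s1 m (regOp P :: m₂))]
        rfl
      obtain ⟨h1, h2⟩ := ih (P :: m) m₂ x
      obtain ⟨h3, -⟩ := ih m (regOp P :: m₂) x
      rw [e1]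
      set p := nT Sum.isLeft (l ++ [P]) + nT Sum.isLeft m + nT Sum.isLeft m₂ with hp
      set q := nF Sum.isLeft (l ++ [P]) + nF Sum.isLeft m + nF Sum.isLeft m₂ with hq
      have p1 : nT Sum.isLeft l + nT Sum.isLeft (P :: m) + nT Sum.isLeft m₂ = p := by
        rw [hp, nT_append, nT_cons, nT_cons, nT_nil]; omega
      have q1 : nF Sum.isLeft l + nF Sum.isLeft (P :: m) + nF Sum.isLeft m₂ = q := by
        rw [hq, nF_append, nF_cons, nF_cons, nF_nil]; omega
      have p2 : nT Sum.isLeft l + nT Sum.isLeft m + nT Sum.isLeft (regOp P :: m₂) = p := by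
        rw [hp, nT_append, nT_cons, nT_cons, nT_nil, isLeft_regOp]; omega
      have q2 : nF Sum.isLeft l + nF Sum.isLeft m + nF Sum.isLeft (regOp P :: m₂) = q := by
        rw [hq, nF_append, nF_cons, nF_cons, nF_nil, isLeft_regOp]; omega
      rw [p1, q1] at h1 h2
      rw [p2, q2] at h3
      have hY := hY0 p q
      rw [List.length_append, List.length_singleton, pow_succ, pow_succ]
      have h24 : (2 : ℝ) ^ l.length ≤ 4 ^ l.length := by gcongr; norm_num
      have h4 : ‖(ε : ℂ) * act (stdBasis d) l (reg ε (act (stdBasis d) m φ)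
          (act (stdBasis₂ d) (regOp P :: m₂) Γ)) x‖ ≤ ε * (2 ^ l.length * Y p q) := by
        rw [norm_mul, Complex.norm_real, Real.norm_of_nonneg hε.le]
        gcongr
      constructor
      · refine (norm_add_le _ _).trans ((add_le_add h1 h4).trans ?_)
        have : ε * (2 ^ l.length * Y p q) ≤ 2 ^ l.length * Y p q :=
          mul_le_of_le_one_left (by positivity) hε1
        linarith
      · rw [act_append l [P], add_sub_right_comm]
        refine (norm_add_le _ _).trans ((add_le_add h2 h4).trans ?_)
        have h5 : ε * (2 ^ l.length * Y p q) ≤ ε * (4 ^ l.length * Y p q) := by gcongr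
        have h6 : 0 ≤ ε * (4 ^ l.length * Y p q) := by positivity
        linarith
  refine ⟨(contDiff_reg hε.ne' hφ.rapid hΓ.rapid).sub (contDiff_smul' _ hφ.1), fun l x => ?_⟩
  rw [act_sub l (contDiff_reg hε.ne' hφ.rapid hΓ.rapid) (contDiff_smul' _ hφ.1),
    act_smul l _ hφ.1]
  refine ((main l [] [] x).2).trans (le_of_eq ?_)
  simp only [nT_nil, nF_nil, add_zero, Y]
  rw [mul_assoc (4 : ℝ), wtc_smul 4, nT_add_nF, hD]
  ring

/-! ### Test functions are dense in the dual -/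

lemma tensor_mem (hM : M.Nontrivial c) (hN : N.Nontrivial c) {f g : Rn d → ℂ}
    (hf : f ∈ GS c d M N) (hg : g ∈ GS c d M N) : tensor f g ∈ GS₂ c d M M N N := by
  have h := ((mem_space_iff (compat_GS M N) hM hN).1 hf).and
    ((mem_space_iff (compat_GS M N) hM hN).1 hg)
    (fun A A' hA h ⟨C, hC⟩ => ⟨C, hC.mono hA h⟩) (fun A A' hA h ⟨C, hC⟩ => ⟨C, hC.mono hA h⟩)
  exact (mem_space_iff (compat_GS₂ M N) hM hN).2
    (h.imp fun A hA ⟨⟨C, hC⟩, D, hD⟩ => ⟨C * D, hC.tensor hA hD⟩)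

lemma comp_linear_mem (hM : M.Nontrivial c) (hN : N.Nontrivial c) {Ψ : Rn d × Rn d → ℂ}
    (hΨ : Ψ ∈ GS₂ c d M M N N) (L : (Rn d × Rn d) ≃L[ℝ] Rn d × Rn d) :
    Ψ ∘ L ∈ GS₂ c d M M N N :=
  (mem_space_iff (compat_GS₂ M N) hM hN).2 ((wtame_comp_linear (stdBasis₂ d) (stdBasis₂ d) L).quant
    ((mem_space_iff (compat_GS₂ M N) hM hN).1 hΨ))

lemma marg_tensor_gauss : marg (tensor (gauss (0 : Rn d)) (gauss 0)) 0 = 1 := by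
  have h : ∀ x : Rn d, gauss 0 x = ((Real.exp (-Real.pi * ‖x‖ ^ 2) : ℝ) : ℂ) := fun x => by
    simp [gauss]
  simp only [marg, tensor, integral_const_mul, h]
  rw [integral_complex_ofReal, GaussianFourier.integral_rexp_neg_mul_sq_norm Real.pi_pos]
  simp

/-- Every functional, composed with the regularization operator, is given by a test function. -/
lemma exists_ev_reg (hM : M.Nontrivial c) (hN : N.Nontrivial c) (hε : 0 < ε)
    (hΓ : Γ ∈ GS₂ c d M M N N) (u : GSDual c d M N) :
    ∃ g : GS c d M N, ∀ φ : GS c d M N, u.ev (reg ε φ Γ) = (toDual g).lin φ := by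
  have hne : -(ε⁻¹) ≠ 0 := by simp [hε.ne']
  set a : ℂ := ((|(ε ^ d)⁻¹| : ℝ) : ℂ) with ha
  -- the substitution `y = x - ε s` turns `regInt ε φ Γ` into `Γ (ε x, (x - y) / ε) * φ y`, whose
  -- dependence on `φ` is by the factor `φ y` only
  let L₁ : (Rn d × Rn d) ≃L[ℝ] Rn d × Rn d := blockEquiv 1 0 ε⁻¹ (-ε⁻¹) (by simp [hε.ne'])
  let L₂ : (Rn d × Rn d) ≃L[ℝ] Rn d × Rn d := blockEquiv ε 0 ε⁻¹ (-ε⁻¹) (by simp [hε.ne'])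
  let L₃ : (Rn d × Rn d) ≃L[ℝ] Rn d × Rn d := blockEquiv 0 ε (-ε⁻¹) ε⁻¹ (by simp [hε.ne'])
  have hK := comp_linear_mem hM hN hΓ L₂
  have hK' := comp_linear_mem hM hN hΓ L₃
  refine ⟨⟨a • pair u (Γ ∘ L₃), Submodule.smul_mem _ a (pair_mem hM hN u hK')⟩, fun φ => ?_⟩
  have hΘ : a • (regInt ε φ Γ ∘ L₁) ∈ GS₂ c d M M N N :=
    Submodule.smul_mem _ a (comp_linear_mem hM hN (regInt_mem hM hN hε.ne' φ.2 hΓ) L₁)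
  have e0 : ∀ x y, regInt ε φ Γ (L₁ (x, y)) = Γ (L₂ (x, y)) * (φ : Rn d → ℂ) y := by
    intro x y
    simp only [L₁, L₂, blockEquiv_apply, regInt, one_smul, zero_smul, add_zero, smul_add, smul_smul,
      mul_inv_cancel₀ hε.ne', mul_neg]
    congr 2
    simp
  have e1 : reg ε φ Γ = marg (a • (regInt ε φ Γ ∘ L₁)) := by
    funext x
    have h1 : ∀ s, regInt ε φ Γ (x, s) =
        (fun y => regInt ε φ Γ (L₁ (x, x - y))) (ε • s) := by
      intro s
      simp only [L₁, blockEquiv_apply, one_smul, zero_smul, add_zero]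
      congr 2
      rw [neg_smul, smul_sub, smul_smul, inv_mul_cancel₀ hε.ne', one_smul]
      abel
    simp only [reg, marg, h1]
    rw [Measure.integral_comp_smul volume (fun y => regInt ε φ Γ (L₁ (x, x - y))) ε,
      integral_sub_left_eq_self (fun y => regInt ε φ Γ (L₁ (x, y))) volume x]
    simp only [Pi.smul_apply, Function.comp_apply, integral_smul]
    rw [finrank_euclideanSpace_fin, ha, Complex.real_smul]
    rfl
  rw [e1, u.ev_marg hM hN hΘ]
  refine integral_congr_ae (Eventually.of_forall fun y => ?_)
  have e2 : (fun x => (a • (regInt ε φ Γ ∘ L₁)) (x, y)) =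
      (a * (φ : Rn d → ℂ) y) • fun x => (Γ ∘ L₂) (x, y) := by
    funext x
    simp only [Pi.smul_apply, Function.comp_apply, e0, smul_eq_mul]; ring
  have e3 : (fun x => (Γ ∘ L₂) (x, y)) = fun t => (Γ ∘ L₃) (y, t) := by
    funext x
    simp only [Function.comp_apply, L₂, L₃, blockEquiv_apply]
    congr 2
    · simp
    · abel
  simp only [e2]
  rw [Dual.ev_smul _ (slice_fst_mem hM hN hK y), e3]
  simp only [Pi.smul_apply, smul_eq_mul, pair]
  ring

/-- Test functions are dense in the dual. -/
theorem exists_tendsto_toDual (hM : M.Nontrivial c) (hN : N.Nontrivial c) (u : GSDual c d M N) :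
    ∃ g : ℕ → GS c d M N, Tendsto (fun n => toDual (g n)) atTop (𝓝 u) := by
  -- the integral of `Γ (0, ·)` is `1`, so that the regularizations converge to the identity
  set Γ : Rn d × Rn d → ℂ := tensor (gauss 0) (gauss 0) with hΓdef
  have hΓ : Γ ∈ GS₂ c d M M N N := tensor_mem hM hN (gauss_mem hM hN 0) (gauss_mem hM hN 0)
  obtain ⟨κ, hκ, hreg⟩ := exists_wbound_reg_sub d M N
  have hε : ∀ n : ℕ, 0 < 1 / ((n : ℝ) + 1) := fun n => by positivity
  have hε1 : ∀ n : ℕ, 1 / ((n : ℝ) + 1) ≤ 1 := fun n => by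
    rw [div_le_one (by positivity)]; linarith [(Nat.cast_nonneg n : (0 : ℝ) ≤ n)]
  choose g hg using fun n => exists_ev_reg hM hN (hε n) hΓ u
  refine ⟨g, (withSeminorms_dual c).tendsto_nhds _ _ |>.2 fun q r hr => ?_⟩
  have tame : c.Tame fun A A' => ∃ K : ℝ, 0 ≤ K ∧ ∀ (n : ℕ) (C : ℝ) (φ : GS c d M N),
      WBound (stdBasis d) Sum.isLeft M N A C (φ : Rn d → ℂ) →
      WBound (stdBasis d) Sum.isLeft M N A' (1 / ((n : ℝ) + 1) * K * C)
        (reg (1 / ((n : ℝ) + 1)) φ Γ - (φ : Rn d → ℂ)) := by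
    have hm : marg Γ 0 = 1 := marg_tensor_gauss
    have h1 := (mem_space_iff (compat_GS₂ M N) hM hN).1 hΓ
    cases c
    · intro A hA
      obtain ⟨A₀, hA₀, C₂, hC₂⟩ := h1
      obtain ⟨K, hK, h⟩ := hreg (max A A₀) (lt_max_of_lt_left hA)
      refine ⟨κ * max A A₀, by positivity, K * C₂, mul_nonneg hK hC₂.nonneg, fun n C φ hφ => ?_⟩
      have := h _ C C₂ φ Γ (hε n) (hε1 n) (hφ.mono hA (le_max_left _ _))
        (hC₂.mono hA₀ (le_max_right _ _))
      rwa [hm, one_smul] at this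
    · intro A' hA'
      obtain ⟨K, hK, h⟩ := hreg (A' / κ) (by positivity)
      obtain ⟨C₂, hC₂⟩ := h1 (A' / κ) (by positivity)
      refine ⟨A' / κ, by positivity, K * C₂, mul_nonneg hK hC₂.nonneg, fun n C φ hφ => ?_⟩
      have := h _ C C₂ φ Γ (hε n) (hε1 n) hφ hC₂
      rwa [hm, one_smul, mul_div_cancel₀ _ hκ.ne'] at this
  have hco : c.coquant₁ fun A => ∃ K : ℝ, 0 ≤ K ∧ ∀ n : ℕ,
      WDual Sum.isLeft M N (toDual (g n) - u).lin A (1 / ((n : ℝ) + 1) * K) := by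
    refine tame.coquant₁ ((mem_dual_iff (compat_GS M N) hM hN).1 u.2) ?_
    rintro A A' - - ⟨K, hK, h⟩ ⟨L, hL, hu⟩
    refine ⟨L * K, by positivity, fun n φ C hφ => ?_⟩
    have hr : reg (1 / ((n : ℝ) + 1)) φ Γ ∈ GS c d M N :=
      marg_mem hM hN (regInt_mem hM hN (hε n).ne' φ.2 hΓ)
    rw [Dual.lin_sub, LinearMap.sub_apply, ← hg n φ, ← Dual.ev_coe φ, ← Dual.ev_sub hr φ.2]
    exact (Dual.ev_le (sub_mem hr φ.2) hu (h n C φ hφ)).trans (le_of_eq (by ring))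
  obtain ⟨A, hA, ⟨K, hK, hq⟩, L, hL, hg'⟩ :=
    ((isDualSeminorm_iff (compat_GS M N) hM hN).1 q.2).and_coquant₁ hco
  have hlim : Tendsto (fun n : ℕ => K * (1 / ((n : ℝ) + 1) * L)) atTop (𝓝 0) := by
    simpa using (tendsto_one_div_add_atTop_nhds_zero_nat.mul_const L).const_mul K
  filter_upwards [hlim.eventually_lt_const hr] with n hn
  exact (seminorm_le_mul hq (by positivity) (hg' n)).trans_lt hn

end

section

variable {d : ℕ} {M N : WeightSeq} {c : GSType}

/-! ### The partial Fourier transform on test functions -/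

lemma pFT_mem_mix (hM : M.Nontrivial c) (hN : N.Nontrivial c) {Ψ : Rn d × Rn d → ℂ}
    (hΨ : Ψ ∈ GS₂ c d M M N N) : pFT Ψ ∈ GS₂ c d M N N M :=
  (mem_space_iff (compat_mix M N) hM hN).2
    (wtame_pFT_mix.quant ((mem_space_iff (compat_GS₂ M N) hM hN).1 hΨ))

lemma pFT_mem_unmix (hM : M.Nontrivial c) (hN : N.Nontrivial c) {Φ : Rn d × Rn d → ℂ}
    (hΦ : Φ ∈ GS₂ c d M N N M) : pFT Φ ∈ GS₂ c d M M N N :=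
  (mem_space_iff (compat_GS₂ M N) hM hN).2
    (wtame_pFT_unmix.quant ((mem_space_iff (compat_mix M N) hM hN).1 hΦ))

lemma rapid_of_mem {ι : Type} [Fintype ι] {E : Type} [NormedAddCommGroup E] [NormedSpace ℝ E]
    {b : Module.Basis ι ℝ E} {m n : MultiWeight ι} {τ : ι ⊕ ι → Bool} {f : E → ℂ}
    (hτ : Compat τ m n M N) (hM : M.Nontrivial c) (hN : N.Nontrivial c)
    (hf : f ∈ Space c b m n) : Rapid b f := by
  classical
  obtain ⟨A, hA, C, hC⟩ := exists_wbound hτ hM hN hf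
  exact hC.rapid

lemma pFT_add {Φ Ψ : Rn d × Rn d → ℂ} (hΦ : Rapid (stdBasis₂ d) Φ) (hΨ : Rapid (stdBasis₂ d) Ψ) :
    pFT (Φ + Ψ) = pFT Φ + pFT Ψ := by
  funext z
  simp only [pFT, Pi.add_apply, Real.fourier_eq, smul_add]
  have h := fun (f : Rn d → ℂ) (hf : Integrable f) =>
    (Real.fourierIntegral_convergent_iff (μ := volume) (f := f) z.2).2 hf
  exact integral_add (h _ (hΦ.integrable_slice z.1)) (h _ (hΨ.integrable_slice z.1))

/-! ### The tensor product of two functionals -/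

lemma Dual.add_ev {ι : Type} [Fintype ι] {E : Type} [NormedAddCommGroup E] [NormedSpace ℝ E]
    {b : Module.Basis ι ℝ E} {m n : MultiWeight ι} (u v : Dual c b m n) (f : E → ℂ) :
    (u + v).ev f = u.ev f + v.ev f := by
  unfold Dual.ev
  split <;> simp [Dual.lin_add]

lemma Dual.smul_ev {ι : Type} [Fintype ι] {E : Type} [NormedAddCommGroup E] [NormedSpace ℝ E]
    {b : Module.Basis ι ℝ E} {m n : MultiWeight ι} (a : ℂ) (u : Dual c b m n) (f : E → ℂ) :
    (a • u).ev f = a * u.ev f := by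
  unfold Dual.ev
  split <;> simp [Dual.lin_smul]

variable {Ψ Ψ' : Rn d × Rn d → ℂ}

lemma pair_add (hM : M.Nontrivial c) (hN : N.Nontrivial c) (u : GSDual c d M N)
    (hΨ : Ψ ∈ GS₂ c d M M N N) (hΨ' : Ψ' ∈ GS₂ c d M M N N) :
    pair u (Ψ + Ψ') = pair u Ψ + pair u Ψ' :=
  funext fun x => Dual.ev_add (slice_mem hM hN hΨ x) (slice_mem hM hN hΨ' x)

lemma pair_smul (hM : M.Nontrivial c) (hN : N.Nontrivial c) (u : GSDual c d M N) (a : ℂ)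
    (hΨ : Ψ ∈ GS₂ c d M M N N) : pair u (a • Ψ) = a • pair u Ψ :=
  funext fun x => Dual.ev_smul a (slice_mem hM hN hΨ x)

lemma add_pair (u v : GSDual c d M N) : pair (u + v) Ψ = pair u Ψ + pair v Ψ :=
  funext fun _ => Dual.add_ev u v _

lemma smul_pair (a : ℂ) (u : GSDual c d M N) : pair (a • u) Ψ = a • pair u Ψ :=
  funext fun _ => Dual.smul_ev a u _

lemma pair_tensor {f g : Rn d → ℂ} (u : GSDual c d M N) (hg : g ∈ GS c d M N) :
    pair u (tensor f g) = u.ev g • f := by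
  funext x
  have : (fun t => tensor f g (x, t)) = f x • g := rfl
  rw [pair, this, Dual.ev_smul _ hg, Pi.smul_apply, smul_eq_mul, mul_comm]

/-! ### Complex conjugation of functionals -/

lemma cj_mem (hM : M.Nontrivial c) (hN : N.Nontrivial c) {f : Rn d → ℂ} (hf : f ∈ GS c d M N) :
    cj f ∈ GS c d M N :=
  (mem_space_iff (compat_GS M N) hM hN).2 (((mem_space_iff (compat_GS M N) hM hN).1 hf).imp
    fun _ _ ⟨C, hC⟩ => ⟨C, hC.cj⟩)

/-- The complex conjugate of a functional as a linear functional. -/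
def cjLin (hM : M.Nontrivial c) (hN : N.Nontrivial c) (u : GSDual c d M N) :
    GS c d M N →ₗ[ℂ] ℂ where
  toFun φ := starRingEnd ℂ (u.ev (cj φ))
  map_add' φ ψ := by
    rw [Submodule.coe_add, cj_add, Dual.ev_add (cj_mem hM hN φ.2) (cj_mem hM hN ψ.2), map_add]
  map_smul' a φ := by
    rw [Submodule.coe_smul, cj_smul, Dual.ev_smul _ (cj_mem hM hN φ.2), map_mul,
      Complex.conj_conj]
    rfl

lemma WDual.cjLin (hM : M.Nontrivial c) (hN : N.Nontrivial c) {u : GSDual c d M N} {A K : ℝ}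
    (hu : WDual Sum.isLeft M N u.lin A K) : WDual Sum.isLeft M N (cjLin hM hN u) A K := by
  intro φ C hφ
  change ‖starRingEnd ℂ (u.ev (cj φ))‖ ≤ _
  rw [RCLike.norm_conj]
  exact Dual.ev_le (cj_mem hM hN φ.2) hu hφ.cj

/-- The complex conjugate of a functional: `φ ↦ conj (u (conj φ))`. -/
def cjDual (hM : M.Nontrivial c) (hN : N.Nontrivial c) (u : GSDual c d M N) : GSDual c d M N :=
  ⟨cjLin hM hN u, (mem_dual_iff (compat_GS M N) hM hN).2
    (((mem_dual_iff (compat_GS M N) hM hN).1 u.2).imp fun _ _ ⟨K, hK, h⟩ =>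
      ⟨K, hK, h.cjLin hM hN⟩)⟩

lemma cjDual_lin (hM : M.Nontrivial c) (hN : N.Nontrivial c) (u : GSDual c d M N)
    (φ : GS c d M N) : (cjDual hM hN u).lin φ = starRingEnd ℂ (u.ev (cj φ)) := rfl

lemma cjDual_ev (hM : M.Nontrivial c) (hN : N.Nontrivial c) (u : GSDual c d M N)
    {f : Rn d → ℂ} (hf : f ∈ GS c d M N) :
    (cjDual hM hN u).ev f = starRingEnd ℂ (u.ev (cj f)) := by
  rw [Dual.ev_of_mem hf, cjDual_lin]

lemma cjDual_cjDual (hM : M.Nontrivial c) (hN : N.Nontrivial c) (u : GSDual c d M N) :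
    cjDual hM hN (cjDual hM hN u) = u := by
  refine Dual.ext fun φ => ?_
  rw [cjDual_lin, cjDual_ev hM hN u (cj_mem hM hN φ.2), cj_cj, Complex.conj_conj, Dual.ev_coe]

lemma cjDual_add (hM : M.Nontrivial c) (hN : N.Nontrivial c) (u v : GSDual c d M N) :
    cjDual hM hN (u + v) = cjDual hM hN u + cjDual hM hN v :=
  Dual.ext fun φ => by
    rw [Dual.lin_add, LinearMap.add_apply, cjDual_lin, cjDual_lin, cjDual_lin, Dual.add_ev, map_add]

lemma cjDual_smul (hM : M.Nontrivial c) (hN : N.Nontrivial c) (a : ℂ) (u : GSDual c d M N) :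
    cjDual hM hN (a • u) = starRingEnd ℂ a • cjDual hM hN u :=
  Dual.ext fun φ => by
    rw [Dual.lin_smul, LinearMap.smul_apply, cjDual_lin, cjDual_lin, Dual.smul_ev, map_mul,
      smul_eq_mul]

/-! ### The representations of pairs of functionals -/

/-- The constant relating the pairing of `TFR k f g` with that of `f ⊗ conj g`. -/
def tfrFactor (d : ℕ) (k : TFRKind) : ℂ :=
  tfrConst d k * ((exists_integral_comp (tfrEquiv d k)).choose : ℝ)

lemma tfrFactor_ne (d : ℕ) (k : TFRKind) : tfrFactor d k ≠ 0 :=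
  mul_ne_zero (tfrConst_ne d k)
    (by exact_mod_cast (exists_integral_comp (tfrEquiv d k)).choose_spec.1)

/-- The transpose of the linear map `f ⊗ conj g ↦ TFR k f g`. -/
def tfrTranspose (k : TFRKind) (Φ : Rn d × Rn d → ℂ) : Rn d × Rn d → ℂ :=
  tfrFactor d k • (pFT Φ ∘ (tfrEquiv d k).symm)

lemma tfrTranspose_mem (hM : M.Nontrivial c) (hN : N.Nontrivial c) (k : TFRKind)
    {Φ : Rn d × Rn d → ℂ} (hΦ : Φ ∈ GS₂ c d M N N M) :
    tfrTranspose k Φ ∈ GS₂ c d M M N N :=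
  Submodule.smul_mem _ _ (comp_linear_mem hM hN (pFT_mem_unmix hM hN hΦ) _)

lemma wtame_tfrTranspose (k : TFRKind) :
    WTame (stdBasis₂ d) mixType (stdBasis₂ d) Sum.isLeft M N (tfrTranspose k) :=
  ((wtame_comp_linear (stdBasis₂ d) (stdBasis₂ d) (tfrEquiv d k).symm).comp
    wtame_pFT_unmix).smul _

/-- The representation of a pair of functionals as a linear functional: `f ⊗ conj g` applied to the
transpose. -/
def tfrLin (hM : M.Nontrivial c) (hN : N.Nontrivial c) (k : TFRKind) (f g : GSDual c d M N) :
    GS₂ c d M N N M →ₗ[ℂ] ℂ where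
  toFun Φ := f.ev (pair (cjDual hM hN g) (tfrTranspose k Φ))
  map_add' Φ Ψ := by
    have h1 := rapid_of_mem (compat_mix M N) hM hN Φ.2
    have h2 := rapid_of_mem (compat_mix M N) hM hN Ψ.2
    have e : tfrTranspose k ((Φ : Rn d × Rn d → ℂ) + (Ψ : Rn d × Rn d → ℂ)) =
        tfrTranspose k Φ + tfrTranspose k Ψ := by
      funext z
      simp [tfrTranspose, pFT_add h1 h2, mul_add]
    rw [Submodule.coe_add, e, pair_add hM hN _ (tfrTranspose_mem hM hN k Φ.2)
      (tfrTranspose_mem hM hN k Ψ.2), Dual.ev_add (pair_mem hM hN _ (tfrTranspose_mem hM hN k Φ.2))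
      (pair_mem hM hN _ (tfrTranspose_mem hM hN k Ψ.2))]
  map_smul' a Φ := by
    have e : tfrTranspose k (a • (Φ : Rn d × Rn d → ℂ)) = a • tfrTranspose k Φ := by
      funext z
      simp only [tfrTranspose, pFT_smul, Pi.smul_apply, Function.comp_apply, smul_eq_mul]; ring
    rw [Submodule.coe_smul, e, pair_smul hM hN _ _ (tfrTranspose_mem hM hN k Φ.2),
      Dual.ev_smul _ (pair_mem hM hN _ (tfrTranspose_mem hM hN k Φ.2))]
    rfl

/-- The basic estimate for the representation of a pair of functionals. -/
lemma exists_wdual_tfrLin (d : ℕ) (hM : M.Nontrivial c) (hN : N.Nontrivial c) (k : TFRKind) :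
    ∃ κ : ℝ, 0 < κ ∧ ∀ A, 0 < A → ∃ K : ℝ, 0 ≤ K ∧ ∀ (f g : GSDual c d M N) (K₁ K₂ : ℝ), 0 ≤ K₂ →
      WDual Sum.isLeft M N f.lin (κ * A) K₁ → WDual Sum.isLeft M N g.lin (κ * A) K₂ →
      WDual mixType M N (tfrLin hM hN k f g) A (K₁ * K₂ * K) := by
  obtain ⟨κ₁, hκ₁, h1⟩ := wtame_tfrTranspose (d := d) (M := M) (N := N) k
  obtain ⟨L, κ₂, hL, hκ₂, h2⟩ := exists_wbound_pair c d hM hN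
  refine ⟨κ₂ * κ₁, by positivity, fun A hA => ?_⟩
  obtain ⟨K, hK, h1⟩ := h1 A hA
  refine ⟨L * K, by positivity, fun f g K₁ K₂ hK₂ hf hg Φ C hΦ => ?_⟩
  rw [mul_assoc] at hf hg
  have hP := tfrTranspose_mem hM hN k Φ.2
  refine (Dual.ev_le (pair_mem hM hN _ hP) hf (h2 _ (by positivity) (cjDual hM hN g) _ K₂ (K * C)
    hK₂ hP (hg.cjLin hM hN) (h1 C _ hΦ))).trans (le_of_eq (by ring))

/-- The representation of a pair of functionals. -/
def tfrDual (hM : M.Nontrivial c) (hN : N.Nontrivial c) (k : TFRKind) (f g : GSDual c d M N) :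
    GSDual₂ c d M N N M :=
  ⟨tfrLin hM hN k f g, by
    obtain ⟨κ, hκ, h⟩ := exists_wdual_tfrLin d hM hN k
    have hfg := ((mem_dual_iff (compat_GS M N) hM hN).1 f.2).and
      ((mem_dual_iff (compat_GS M N) hM hN).1 g.2)
      (fun A A' hA hAA ⟨K, hK, h⟩ => ⟨K, hK, h.mono hA hAA le_rfl⟩)
      (fun A A' hA hAA ⟨K, hK, h⟩ => ⟨K, hK, h.mono hA hAA le_rfl⟩)
    refine (mem_dual_iff (compat_mix M N) hM hN).2 ((GSType.tame_of_linear
      (R := fun A A' => A' = κ * A) hκ fun A _ => rfl).coquant₁ hfg ?_)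
    rintro A _ hA - rfl ⟨⟨K₁, hK₁, hf⟩, K₂, hK₂, hg⟩
    obtain ⟨K, hK, h⟩ := h A hA
    exact ⟨_, by positivity, h f g K₁ K₂ hK₂ hf hg⟩⟩

lemma tfrDual_lin (hM : M.Nontrivial c) (hN : N.Nontrivial c) (k : TFRKind) (f g : GSDual c d M N)
    (Φ : GS₂ c d M N N M) :
    (tfrDual hM hN k f g).lin Φ = f.ev (pair (cjDual hM hN g) (tfrTranspose k Φ)) := rfl

section Sesquilinear

variable (hM : M.Nontrivial c) (hN : N.Nontrivial c) (k : TFRKind) (a : ℂ) (f f' g g' : GSDual c d M N)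

lemma tfrDual_add_left :
    tfrDual hM hN k (f + f') g = tfrDual hM hN k f g + tfrDual hM hN k f' g :=
  Dual.ext fun _ => Dual.add_ev f f' _

lemma tfrDual_smul_left : tfrDual hM hN k (a • f) g = a • tfrDual hM hN k f g :=
  Dual.ext fun _ => Dual.smul_ev a f _

lemma tfrDual_add_right :
    tfrDual hM hN k f (g + g') = tfrDual hM hN k f g + tfrDual hM hN k f g' :=
  Dual.ext fun Φ => by
    have hP := tfrTranspose_mem hM hN k Φ.2
    rw [Dual.lin_add, LinearMap.add_apply, tfrDual_lin, tfrDual_lin, tfrDual_lin, cjDual_add,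
      add_pair, Dual.ev_add (pair_mem hM hN _ hP) (pair_mem hM hN _ hP)]

lemma tfrDual_smul_right :
    tfrDual hM hN k f (a • g) = starRingEnd ℂ a • tfrDual hM hN k f g :=
  Dual.ext fun Φ => by
    have hP := tfrTranspose_mem hM hN k Φ.2
    rw [Dual.lin_smul, LinearMap.smul_apply, tfrDual_lin, tfrDual_lin, cjDual_smul,
      smul_pair, Dual.ev_smul _ (pair_mem hM hN _ hP), smul_eq_mul]

end Sesquilinear

/-! ### Square integrable functions as functionals -/

lemma exists_norm_le_jap_of_wbound (d : ℕ) (M N : WeightSeq) {A : ℝ} (hA : 0 < A) :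
    ∃ K : ℝ, 0 ≤ K ∧ ∀ (C : ℝ) (φ : Rn d → ℂ), WBound (stdBasis d) Sum.isLeft M N A C φ →
      ∀ x, ‖φ x‖ ≤ K * C * jap x := by
  obtain ⟨κ, hκ, h⟩ := exists_wtc_add_le_of_le M N
  obtain ⟨K, hK, h⟩ := h A hA (d + 1)
  refine ⟨(d + 1) ^ (d + 1) * K, by positivity, fun C φ hφ x => ?_⟩
  refine (norm_le_jap (R := C * K) fun m hm => ?_).trans (le_of_eq (by ring))
  simpa [wtc_zero] using hφ.act_act_le h m [] hm x

lemma integrable_mul_mem (hM : M.Nontrivial c) (hN : N.Nontrivial c) {f φ : Rn d → ℂ}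
    (hf : MemLp f 2) (hφ : φ ∈ GS c d M N) : Integrable fun x => f x * φ x := by
  have hr := rapid_of_mem (compat_GS M N) hM hN hφ
  obtain ⟨C, -, hC⟩ := hr.exists_norm_le_jap
  exact integrable_mul_of_le_jap hf hr.1.continuous hC

end

section

variable {d : ℕ} {M N : WeightSeq} {c : GSType}

/-- A square integrable function as a functional. -/
def l2Dual (hM : M.Nontrivial c) (hN : N.Nontrivial c) {f : Rn d → ℂ} (hf : MemLp f 2) :
    GSDual c d M N :=
  ⟨{ toFun := fun φ => ∫ x, f x * (φ : Rn d → ℂ) x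
     map_add' := fun φ ψ => by
       rw [← integral_add (integrable_mul_mem hM hN hf φ.2) (integrable_mul_mem hM hN hf ψ.2)]
       simp [mul_add]
     map_smul' := fun a φ => by
       rw [RingHom.id_apply, smul_eq_mul, ← integral_const_mul]
       congr 1
       funext x
       simp only [Submodule.coe_smul, Pi.smul_apply, smul_eq_mul]
       ring }, by
    have key : ∀ A : ℝ, 0 < A → ∃ K, 0 ≤ K ∧ ∀ (φ : GS c d M N) (C : ℝ),
        WBound (stdBasis d) Sum.isLeft M N A C (φ : Rn d → ℂ) →
          ‖∫ x, f x * (φ : Rn d → ℂ) x‖ ≤ K * C := by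
      intro A hA
      obtain ⟨K, hK, h⟩ := exists_norm_le_jap_of_wbound d M N hA
      have h0 : 0 ≤ ∫ x, ‖f x‖ * jap x :=
        integral_nonneg fun x => mul_nonneg (norm_nonneg _) (jap_pos x).le
      refine ⟨K * ∫ x, ‖f x‖ * jap x, by positivity, fun φ C hφ => ?_⟩
      refine (norm_integral_le_of_norm_le ((integrable_mul_jap hf).const_mul (K * C))
        (Eventually.of_forall fun x => ?_)).trans (le_of_eq ?_)
      · rw [norm_mul]
        refine (mul_le_mul_of_nonneg_left (h C _ hφ x) (norm_nonneg _)).trans (le_of_eq (by ring))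
      · rw [integral_const_mul]; ring
    refine (mem_dual_iff (compat_GS M N) hM hN).2 ?_
    cases c
    · exact fun A hA => key A hA
    · exact ⟨1, one_pos, key 1 one_pos⟩⟩

lemma l2Dual_ev (hM : M.Nontrivial c) (hN : N.Nontrivial c) {f : Rn d → ℂ} (hf : MemLp f 2)
    {φ : Rn d → ℂ} (hφ : φ ∈ GS c d M N) : (l2Dual hM hN hf).ev φ = ∫ x, f x * φ x := by
  rw [Dual.ev_of_mem hφ]; rfl

lemma memLp_of_mem (hM : M.Nontrivial c) (hN : N.Nontrivial c) {f : Rn d → ℂ}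
    (hf : f ∈ GS c d M N) : MemLp f 2 := by
  have hr := rapid_of_mem (compat_GS M N) hM hN hf
  obtain ⟨C, hC0, hC⟩ := hr.exists_norm_le_jap
  refine (memLp_jap.const_mul C).mono hr.1.continuous.aestronglyMeasurable
    (Eventually.of_forall fun x => ?_)
  rw [Real.norm_of_nonneg (mul_nonneg hC0 (jap_pos x).le)]
  exact hC x

lemma toDual_eq_l2Dual (hM : M.Nontrivial c) (hN : N.Nontrivial c) (f : GS c d M N) :
    toDual f = l2Dual hM hN (memLp_of_mem hM hN f.2) := rfl

lemma integrable_comp_equiv (L : (Rn d × Rn d) ≃L[ℝ] Rn d × Rn d) {F : Rn d × Rn d → ℂ}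
    (hF : Integrable F) : Integrable (F ∘ L) := by
  have hdet : LinearMap.det (L : (Rn d × Rn d) →ₗ[ℝ] Rn d × Rn d) ≠ 0 :=
    (LinearEquiv.isUnit_det' L.toLinearEquiv).ne_zero
  have h1 := Measure.map_linearMap_addHaar_eq_smul_addHaar
    (volume : Measure (Rn d × Rn d)) hdet
  have h3 : Measure.map L.toHomeomorph (volume : Measure (Rn d × Rn d)) =
      Measure.map (L : (Rn d × Rn d) →ₗ[ℝ] Rn d × Rn d) volume := rfl
  refine (L.toHomeomorph.measurableEmbedding.integrable_map_iff (μ := volume)).1 ?_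
  rw [h3, h1]
  exact hF.smul_measure ENNReal.ofReal_ne_top

lemma memLp_comp_affine {f : Rn d → ℂ} (hf : MemLp f 2) (v : Rn d) {b : ℝ} (hb : b ≠ 0) :
    MemLp (fun t => f (v + b • t)) 2 := by
  have h1 : Measure.QuasiMeasurePreserving (fun t : Rn d => v + b • t) volume volume := by
    refine (measurePreserving_add_left volume v).quasiMeasurePreserving.comp
      ⟨measurable_const_smul b, ?_⟩
    rw [Measure.map_addHaar_smul volume hb]
    exact Measure.smul_absolutelyContinuous
  have h2 := hf.1.comp_quasiMeasurePreserving h1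
  rw [memLp_two_iff_integrable_sq_norm hf.1] at hf
  exact (memLp_two_iff_integrable_sq_norm h2).2 ((hf.comp_add_left v).comp_smul hb)

lemma memLp_cj {g : Rn d → ℂ} (hg : MemLp g 2) : MemLp (cj g) 2 :=
  (Complex.conjCLE : ℂ →L[ℝ] ℂ).comp_memLp' hg

lemma integrable_tensor_slice {f g : Rn d → ℂ} (hf : MemLp f 2) (hg : MemLp g 2) (k : TFRKind)
    (x : Rn d) : Integrable fun t => (tensor f (cj g) ∘ tfrEquiv d k) (x, t) := by
  have h1 := memLp_comp_affine hf ((coeffs k).1 • x) (coeffs_ne k).1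
  have h2 := memLp_comp_affine hg ((coeffs k).2.2.1 • x) (coeffs_ne k).2
  exact h1.integrable_mul (memLp_cj h2)

lemma integrable_tensor_mul {f g : Rn d → ℂ} (hf : MemLp f 2) (hg : MemLp g 2)
    {Ψ : Rn d × Rn d → ℂ} (hΨ : Rapid (stdBasis₂ d) Ψ) :
    Integrable fun z => tensor f (cj g) z * Ψ z := by
  obtain ⟨C, hC0, hC⟩ := hΨ.exists_norm_le_jap_jap
  have hg' : MemLp (cj g) 2 := memLp_cj hg
  refine (((integrable_mul_jap hf).mul_prod (integrable_mul_jap hg)).const_mul C).mono'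
    ((hf.1.comp_fst.mul hg'.1.comp_snd).mul hΨ.1.continuous.aestronglyMeasurable)
    (Eventually.of_forall fun z => ?_)
  have h1 := hC z.1 z.2
  have h2 : ‖cj g z.2‖ = ‖g z.2‖ := by simp [cj]
  rw [norm_mul, tensor, norm_mul, h2]
  refine (mul_le_mul_of_nonneg_left h1 (by positivity)).trans (le_of_eq (by ring))

/-- For square integrable functions, the representation as functionals is given by the integral,
provided the latter is a test function. -/
theorem tfrDual_l2Dual (hM : M.Nontrivial c) (hN : N.Nontrivial c) (k : TFRKind)
    {f g : Rn d → ℂ} (hf : MemLp f 2) (hg : MemLp g 2) (h : TFR k f g ∈ GS₂ c d M N N M) :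
    tfrDual hM hN k (l2Dual hM hN hf) (l2Dual hM hN hg) = toDual ⟨TFR k f g, h⟩ := by
  refine Dual.ext fun Φ => ?_
  have hT := tfrTranspose_mem hM hN k Φ.2
  have rT := rapid_of_mem (compat_GS₂ M N) hM hN hT
  have rΦ := rapid_of_mem (compat_mix M N) hM hN Φ.2
  have rF := rapid_of_mem (compat_mix M N) hM hN h
  set L := tfrEquiv d k with hL
  set r := (exists_integral_comp L).choose with hr
  have hint := (exists_integral_comp L).choose_spec.2
  -- the left-hand side as an integral over the product space
  have e1 : (tfrDual hM hN k (l2Dual hM hN hf) (l2Dual hM hN hg)).lin Φ =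
      ∫ z, tensor f (cj g) z * tfrTranspose k Φ z := by
    rw [tfrDual_lin, l2Dual_ev hM hN hf (pair_mem hM hN _ hT), Measure.volume_eq_prod,
      integral_prod _ (integrable_tensor_mul hf hg rT)]
    refine integral_congr_ae (Eventually.of_forall fun x => ?_)
    have hs := slice_mem hM hN hT x
    change f x * (cjDual hM hN (l2Dual hM hN hg)).ev _ = _
    rw [cjDual_ev hM hN _ hs, l2Dual_ev hM hN hg (cj_mem hM hN hs), ← integral_conj,
      ← integral_const_mul]
    refine integral_congr_ae (Eventually.of_forall fun y => ?_)
    simp only [cj, tensor, map_mul, Complex.conj_conj]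
    ring
  have e2 : ∫ z, tensor f (cj g) z * tfrTranspose k Φ z =
      tfrConst d k * ∫ z, (tensor f (cj g) ∘ L) z * pFT Φ z := by
    have h1 := hint fun z => tensor f (cj g) z * pFT Φ (L.symm z)
    simp only [ContinuousLinearEquiv.symm_apply_apply] at h1
    simp only [Function.comp_apply]
    rw [h1, ← hr, ← mul_assoc, ← integral_const_mul]
    refine integral_congr_ae (Eventually.of_forall fun z => ?_)
    simp only [tfrTranspose, tfrFactor, Pi.smul_apply, Function.comp_apply, smul_eq_mul, ← hL, ← hr]
    ring
  have i1 : Integrable fun z => (tensor f (cj g) ∘ L) z * pFT Φ z := by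
    have h1 := integrable_comp_equiv L (integrable_tensor_mul hf hg rT)
    refine (h1.const_mul (tfrFactor d k)⁻¹).congr (Eventually.of_forall fun z => ?_)
    have := tfrFactor_ne d k
    simp only [tfrTranspose, Pi.smul_apply, Function.comp_apply, smul_eq_mul, ← hL,
      ContinuousLinearEquiv.symm_apply_apply]
    field_simp
  obtain ⟨C, hC⟩ := rΦ.2 []
  have i2 : Integrable fun z => TFR k f g z * (Φ : Rn d × Rn d → ℂ) z :=
    rF.integrable₂.mul_bdd (c := C) rΦ.1.continuous.aestronglyMeasurable (Eventually.of_forall hC)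
  rw [e1, e2]
  change _ = ∫ z, TFR k f g z * (Φ : Rn d × Rn d → ℂ) z
  rw [Measure.volume_eq_prod] at i1 i2 ⊢
  rw [integral_prod _ i1, integral_prod _ i2, ← integral_const_mul]
  refine integral_congr_ae (Eventually.of_forall fun x => ?_)
  have h2 := integral_fourier_mul (integrable_tensor_slice hf hg k x) (rΦ.integrable_slice x)
  simp only [TFR_eq k f g, Pi.smul_apply, smul_eq_mul, mul_assoc, integral_const_mul]
  congr 1
  exact h2.symm

/-! ### The converse -/

lemma exists_ev_ne_zero {u : GSDual c d M N} (hu : u ≠ 0) :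
    ∃ φ : GS c d M N, u.ev φ ≠ 0 := by
  by_contra! h
  exact hu (Dual.ext fun φ => by rw [← Dual.ev_coe, h φ]; rfl)

/-- If the representation of a pair of functionals is a test function, then the tensor product of
the functionals is one. -/
lemma exists_tensor_eq (hM : M.Nontrivial c) (hN : N.Nontrivial c) (k : TFRKind)
    {f g : GSDual c d M N} (F : GS₂ c d M N N M) (h : tfrDual hM hN k f g = toDual F) :
    ∃ G ∈ GS₂ c d M M N N, ∀ φ ∈ GS c d M N, ∀ ψ ∈ GS c d M N,
      f.ev φ * (cjDual hM hN g).ev ψ = ∫ z, G z * tensor φ ψ z := by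
  set L := tfrEquiv d k with hL
  -- the partial Fourier transform applied twice is the reflection in the second variable
  let σ : (Rn d × Rn d) ≃L[ℝ] Rn d × Rn d := blockEquiv 1 0 0 (-1) (by norm_num)
  let L' := σ.trans L
  have hσ : ∀ z, σ z = (z.1, -z.2) := fun z => by simp [σ, blockEquiv_apply]
  obtain ⟨r, -, hr⟩ := exists_integral_comp L'
  set a := tfrFactor d k with ha
  have ha0 : a ≠ 0 := tfrFactor_ne d k
  have hF' := pFT_mem_unmix hM hN F.2
  refine ⟨(a⁻¹ * r) • (pFT F ∘ L'.symm), Submodule.smul_mem _ _ (comp_linear_mem hM hN hF' _),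
    fun φ hφ ψ hψ => ?_⟩
  have hΨ := tensor_mem hM hN hφ hψ
  have hΨ' := comp_linear_mem hM hN hΨ L'
  have hΦ := pFT_mem_mix hM hN hΨ'
  have rΨ' := rapid_of_mem (compat_GS₂ M N) hM hN hΨ'
  have rΦ := rapid_of_mem (compat_mix M N) hM hN hΦ
  have hΦ' : a⁻¹ • pFT (tensor φ ψ ∘ L') ∈ GS₂ c d M N N M := Submodule.smul_mem _ _ hΦ
  have e1 : tfrTranspose k (a⁻¹ • pFT (tensor φ ψ ∘ L')) = tensor φ ψ := by
    funext z
    simp only [tfrTranspose, pFT_smul, Pi.smul_apply, Function.comp_apply, smul_eq_mul, ← ha, ← hL]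
    rw [pFT_pFT rΨ' rΦ, mul_inv_cancel_left₀ ha0]
    change tensor φ ψ (L (σ _)) = _
    rw [hσ]
    simp
  have e2 : (tfrDual hM hN k f g).lin ⟨_, hΦ'⟩ = f.ev φ * (cjDual hM hN g).ev ψ := by
    rw [tfrDual_lin, e1, pair_tensor _ hψ, Dual.ev_smul _ hφ, mul_comm]
  have e3 : (toDual F).lin ⟨_, hΦ'⟩ = ∫ z, (F : Rn d × Rn d → ℂ) z *
      (a⁻¹ • pFT (tensor φ ψ ∘ L')) z := rfl
  rw [← e2, h, e3]
  have e4 := integral_pFT_mul (rapid_of_mem (compat_mix M N) hM hN F.2)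
    (rapid_of_mem (compat_GS₂ M N) hM hN hF') rΨ' rΦ
  have e5 := hr fun z => pFT F (L'.symm z) * tensor φ ψ z
  simp only [ContinuousLinearEquiv.symm_apply_apply] at e5
  simp only [Pi.smul_apply, smul_eq_mul, mul_left_comm _ a⁻¹, integral_const_mul, mul_assoc,
    Function.comp_apply] at e4 ⊢
  rw [← e4, e5]

/-- If the tensor product of `u` with a functional that does not vanish at `ψ` is given by a test
function, so is `u`. -/
lemma eq_toDual_of_tensor (hM : M.Nontrivial c) (hN : N.Nontrivial c) {u : GSDual c d M N}
    {G : Rn d × Rn d → ℂ} (hG : G ∈ GS₂ c d M M N N) {ψ : GS c d M N} {β : ℂ} (hβ : β ≠ 0)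
    (h : ∀ φ ∈ GS c d M N, u.ev φ * β = ∫ z, G z * tensor φ ψ z) :
    ∃ f₀ : GS c d M N, u = toDual f₀ := by
  have hp := pair_mem hM hN (toDual ψ) hG
  refine ⟨⟨β⁻¹ • pair (toDual ψ) G, Submodule.smul_mem _ _ hp⟩, Dual.ext fun φ => ?_⟩
  have h1 := h φ φ.2
  have rG := rapid_of_mem (compat_GS₂ M N) hM hN hG
  obtain ⟨C, hC⟩ := (rapid_of_mem (compat_GS₂ M N) hM hN (tensor_mem hM hN φ.2 ψ.2)).2 []
  have i1 : Integrable fun z => G z * tensor φ ψ z :=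
    rG.integrable₂.mul_bdd (c := C) (contDiff_tensor
      (rapid_of_mem (compat_GS M N) hM hN φ.2).1
      (rapid_of_mem (compat_GS M N) hM hN ψ.2).1).continuous.aestronglyMeasurable
      (Eventually.of_forall hC)
  rw [Measure.volume_eq_prod] at i1 h1
  rw [integral_prod _ i1] at h1
  change _ = ∫ x, (β⁻¹ • pair (toDual ψ) G) x * (φ : Rn d → ℂ) x
  rw [← Dual.ev_coe, eq_div_of_mul_eq hβ h1, div_eq_inv_mul, ← integral_const_mul]
  refine integral_congr_ae (Eventually.of_forall fun x => ?_)
  have e : pair (toDual ψ) G x = ∫ y, (ψ : Rn d → ℂ) y * G (x, y) := by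
    rw [pair, Dual.ev_of_mem (slice_mem hM hN hG x)]; rfl
  simp only [Pi.smul_apply, smul_eq_mul, e, tensor]
  rw [mul_assoc, ← integral_mul_const]
  congr 2
  funext y
  ring

lemma cjDual_toDual (hM : M.Nontrivial c) (hN : N.Nontrivial c) (h₀ : GS c d M N) :
    cjDual hM hN (toDual h₀) = toDual ⟨cj h₀, cj_mem hM hN h₀.2⟩ := by
  refine Dual.ext fun φ => ?_
  rw [cjDual_lin, toDual_eq_l2Dual hM hN, l2Dual_ev hM hN _ (cj_mem hM hN φ.2), ← integral_conj]
  refine integral_congr_ae (Eventually.of_forall fun x => ?_)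
  simp [cj]

lemma cjDual_ne_zero (hM : M.Nontrivial c) (hN : N.Nontrivial c) {g : GSDual c d M N}
    (hg : g ≠ 0) : cjDual hM hN g ≠ 0 := by
  intro h0
  have h1 := cjDual_smul hM hN 0 (0 : GSDual c d M N)
  rw [map_zero, zero_smul, zero_smul] at h1
  exact hg (by rw [← cjDual_cjDual hM hN g, h0, h1])

lemma integral_mul_tensor_swap (G : Rn d × Rn d → ℂ) (φ ψ : Rn d → ℂ)
    (s : (Rn d × Rn d) ≃L[ℝ] Rn d × Rn d) (hs : ∀ z, s z = (z.2, z.1)) :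
    ∫ z, G z * tensor φ ψ z = ∫ z, (G ∘ s) z * tensor ψ φ z := by
  rw [Measure.volume_eq_prod, ← integral_prod_swap (fun z => G z * tensor φ ψ z)]
  refine integral_congr_ae (Eventually.of_forall fun z => ?_)
  simp only [Function.comp_apply, hs, tensor, Prod.swap]
  ring

/-- If the representation of a pair of nonzero functionals is a test function, so are both
functionals. -/
theorem exists_eq_toDual (hM : M.Nontrivial c) (hN : N.Nontrivial c) (k : TFRKind)
    {f g : GSDual c d M N} (hf : f ≠ 0) (hg : g ≠ 0) (F : GS₂ c d M N N M)
    (h : tfrDual hM hN k f g = toDual F) :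
    (∃ f₀ : GS c d M N, f = toDual f₀) ∧ ∃ g₀ : GS c d M N, g = toDual g₀ := by
  obtain ⟨G, hG, hfg⟩ := exists_tensor_eq hM hN k F h
  obtain ⟨ψ, hψ⟩ := exists_ev_ne_zero (cjDual_ne_zero hM hN hg)
  obtain ⟨φ, hφ⟩ := exists_ev_ne_zero hf
  have h1 : ∃ f₀ : GS c d M N, f = toDual f₀ :=
    eq_toDual_of_tensor hM hN hG hψ fun φ hφ => hfg φ hφ ψ ψ.2
  obtain ⟨s, hs⟩ : ∃ s : (Rn d × Rn d) ≃L[ℝ] Rn d × Rn d, ∀ z, s z = (z.2, z.1) :=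
    ⟨ContinuousLinearEquiv.prodComm ℝ (Rn d) (Rn d), fun _ => rfl⟩
  have h2 : ∀ ψ ∈ GS c d M N, (cjDual hM hN g).ev ψ * f.ev φ =
      ∫ z, (G ∘ s) z * tensor ψ φ z := fun ψ hψ => by
    rw [mul_comm, hfg φ φ.2 ψ hψ, integral_mul_tensor_swap G φ ψ s hs]
  obtain ⟨h₀, hh₀⟩ := eq_toDual_of_tensor hM hN (comp_linear_mem hM hN hG s) hφ h2
  have h3 : g = toDual ⟨cj h₀, cj_mem hM hN h₀.2⟩ :=
    (cjDual_cjDual hM hN g).symm.trans ((congrArg (cjDual hM hN) hh₀).trans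
      (cjDual_toDual hM hN h₀))
  exact ⟨h1, ⟨_, h3⟩⟩

lemma l2Dual_ne_zero (hM : M.Nontrivial c) (hN : N.Nontrivial c) {f : Rn d → ℂ}
    (hf : MemLp f 2) (hf0 : ¬ f =ᵐ[volume] 0) : l2Dual hM hN hf ≠ 0 := by
  intro h0
  refine hf0 (ae_eq_zero_of_forall_mem hM hN hf fun φ hφ => ?_)
  have h1 : (0 : GSDual c d M N).ev φ = 0 := by rw [Dual.ev_of_mem hφ]; rfl
  rw [← l2Dual_ev hM hN hf hφ, h0, h1]

lemma ae_eq_of_l2Dual_eq (hM : M.Nontrivial c) (hN : N.Nontrivial c) {f : Rn d → ℂ}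
    (hf : MemLp f 2) (h : ∃ f₀ : GS c d M N, l2Dual hM hN hf = toDual f₀) :
    ∃ f₀ ∈ GS c d M N, f =ᵐ[volume] f₀ := by
  obtain ⟨f₀, h0⟩ := h
  have h2 := memLp_of_mem hM hN f₀.2
  rw [toDual_eq_l2Dual hM hN] at h0
  have h1 : (f - (f₀ : Rn d → ℂ)) =ᵐ[volume] 0 := by
    refine ae_eq_zero_of_forall_mem hM hN (hf.sub h2) fun φ hφ => ?_
    have e : (l2Dual hM hN hf).ev φ = (l2Dual hM hN h2).ev φ := by rw [h0]
    rw [l2Dual_ev hM hN hf hφ, l2Dual_ev hM hN h2 hφ] at e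
    simp only [Pi.sub_apply, sub_mul]
    rw [integral_sub (integrable_mul_mem hM hN hf hφ) (integrable_mul_mem hM hN h2 hφ), e,
      sub_self]
  refine ⟨f₀, f₀.2, ?_⟩
  filter_upwards [h1] with x hx
  exact sub_eq_zero.1 hx

/-- The converse for square integrable functions. -/
theorem exists_ae_eq (hM : M.Nontrivial c) (hN : N.Nontrivial c) (k : TFRKind)
    {f g : Rn d → ℂ} (hf : MemLp f 2) (hg : MemLp g 2) (hf0 : ¬ f =ᵐ[volume] 0)
    (hg0 : ¬ g =ᵐ[volume] 0) (h : TFR k f g ∈ GS₂ c d M N N M) :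
    (∃ f₀ ∈ GS c d M N, f =ᵐ[volume] f₀) ∧ ∃ g₀ ∈ GS c d M N, g =ᵐ[volume] g₀ := by
  have h1 := exists_eq_toDual hM hN k (l2Dual_ne_zero hM hN hf hf0) (l2Dual_ne_zero hM hN hg hg0) _
    (tfrDual_l2Dual hM hN k hf hg h)
  exact ⟨ae_eq_of_l2Dual_eq hM hN hf h1.1, ae_eq_of_l2Dual_eq hM hN hg h1.2⟩

end

section

variable {d : ℕ} {M N : WeightSeq} {c : GSType}

/-! ### Continuity -/

section Topology

variable {ι : Type} [Fintype ι] [DecidableEq ι] {E : Type} [NormedAddCommGroup E] [NormedSpace ℝ E]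
  {b : Module.Basis ι ℝ E} {m n : MultiWeight ι} {τ : ι ⊕ ι → Bool}

/-- The evaluation of functionals at a test function. -/
def evalLin (φ : Space c b m n) : Dual c b m n →ₗ[ℂ] ℂ where
  toFun u := u.lin φ
  map_add' _ _ := rfl
  map_smul' _ _ := rfl

/-- The absolute value of the evaluation at a test function. -/
def evalSeminorm (φ : Space c b m n) : Seminorm ℂ (Dual c b m n) :=
  (normSeminorm ℂ ℂ).comp (evalLin φ)

lemma evalSeminorm_apply (φ : Space c b m n) (u : Dual c b m n) :
    evalSeminorm φ u = ‖u.lin φ‖ := rfl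

lemma isDualSeminorm_eval (hτ : Compat τ m n M N) (hM : M.Nontrivial c) (hN : N.Nontrivial c)
    (φ : Space c b m n) : IsDualSeminorm (evalSeminorm φ) :=
  (isDualSeminorm_iff hτ hM hN).2 (((mem_space_iff hτ hM hN).1 φ.2).imp fun A _ ⟨C, hC⟩ =>
    ⟨C, hC.nonneg, fun u hu => by
      rw [evalSeminorm_apply]
      simpa using hu φ C hC⟩)

lemma tendsto_lin (hτ : Compat τ m n M N) (hM : M.Nontrivial c) (hN : N.Nontrivial c)
    {X : Type*} {l : Filter X} {s : X → Dual c b m n} {u : Dual c b m n} (h : Tendsto s l (𝓝 u))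
    (φ : Space c b m n) : Tendsto (fun x => (s x).lin φ) l (𝓝 (u.lin φ)) := by
  rw [Metric.tendsto_nhds]
  intro ε hε
  have h1 := ((withSeminorms_dual c).tendsto_nhds s u).1 h
    ⟨evalSeminorm φ, isDualSeminorm_eval hτ hM hN φ⟩ ε hε
  filter_upwards [h1] with x hx
  rw [dist_eq_norm]
  exact hx

lemma dual_tendsto_unique (hτ : Compat τ m n M N) (hM : M.Nontrivial c) (hN : N.Nontrivial c)
    {s : ℕ → Dual c b m n} {u v : Dual c b m n} (hu : Tendsto s atTop (𝓝 u))
    (hv : Tendsto s atTop (𝓝 v)) : u = v :=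
  Dual.ext fun φ => tendsto_nhds_unique (tendsto_lin hτ hM hN hu φ) (tendsto_lin hτ hM hN hv φ)

end Topology

section Continuity

variable (hM : M.Nontrivial c) (hN : N.Nontrivial c) (k : TFRKind)

/-- The representation as a linear map of the first functional. -/
def tfrLeft (g : GSDual c d M N) : GSDual c d M N →ₗ[ℂ] GSDual₂ c d M N N M where
  toFun f := tfrDual hM hN k f g
  map_add' f f' := tfrDual_add_left hM hN k f f' g
  map_smul' a f := tfrDual_smul_left hM hN k a f g

/-- The representation as a conjugate-linear map of the second functional. -/
def tfrRight (f : GSDual c d M N) :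
    GSDual c d M N →ₛₗ[starRingEnd ℂ] GSDual₂ c d M N N M where
  toFun g := tfrDual hM hN k f g
  map_add' g g' := tfrDual_add_right hM hN k f g g'
  map_smul' a g := tfrDual_smul_right hM hN k a f g

variable (q : Seminorm ℂ (GSDual₂ c d M N N M))

lemma comp_tfrRight_apply (f g : GSDual c d M N) :
    (q.comp (tfrRight hM hN k f)) g = q (tfrDual hM hN k f g) := rfl

lemma seminorm_tfrDual_smul (t : ℝ) (ht : 0 ≤ t) (f g : GSDual c d M N) :
    q (tfrDual hM hN k f ((t : ℂ) • g)) = t * q (tfrDual hM hN k f g) := by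
  rw [tfrDual_smul_right, map_smul_eq_mul, RCLike.norm_conj, Complex.norm_real,
    Real.norm_of_nonneg ht]

variable {q}

/-- The bound for the representation on products of balls of equal parameter. -/
lemma quant_seminorm_tfrDual (hq : IsDualSeminorm q) : c.quant₁ fun A => ∃ K : ℝ, 0 ≤ K ∧
    ∀ f g : GSDual c d M N, WDual Sum.isLeft M N f.lin A 1 → WDual Sum.isLeft M N g.lin A 1 →
      q (tfrDual hM hN k f g) ≤ K := by
  obtain ⟨κ, hκ, h⟩ := exists_wdual_tfrLin d hM hN k
  refine (GSType.tame_of_linear (R := fun A A' => A' = κ * A) hκ fun A _ => rfl).quant₁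
    ((isDualSeminorm_iff (compat_mix M N) hM hN).1 hq) ?_
  rintro A _ hA - rfl ⟨K, hK, hq⟩
  obtain ⟨L, hL, h⟩ := h A hA
  refine ⟨K * L, by positivity, fun f g hf hg => seminorm_le_mul hq hL ?_⟩
  have := h f g 1 1 zero_le_one hf hg
  rwa [one_mul, one_mul] at this

/-- There is a set that absorbs the balls of functionals and on which the representation is bounded
in terms of the other functional. In the Roumieu case this is a single ball, and in the Beurling
case a union of multiples of balls of decreasing parameter. -/
lemma exists_absorbing_set (hq : IsDualSeminorm q) : ∃ G : Set (GSDual c d M N),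
    (c.quant₁ fun A => ∃ K : ℝ, 0 ≤ K ∧ ∀ f : GSDual c d M N, WDual Sum.isLeft M N f.lin A 1 →
      ∀ g ∈ G, q (tfrDual hM hN k f g) ≤ K) ∧
    c.quant₁ fun A => ∃ t : ℝ, 0 < t ∧ ∀ g : GSDual c d M N, WDual Sum.isLeft M N g.lin A 1 →
      (t : ℂ) • g ∈ G := by
  have h := quant_seminorm_tfrDual hM hN k hq
  cases c
  · obtain ⟨A, hA, K, hK, h⟩ := h
    exact ⟨{g | WDual Sum.isLeft M N g.lin A 1}, ⟨A, hA, K, hK, fun f hf g hg => h f g hf hg⟩,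
      A, hA, 1, one_pos, fun g hg => by simpa using hg⟩
  · have hpos : ∀ j : ℕ, 0 < 1 / ((j : ℝ) + 1) := fun j => by positivity
    choose K hK h using fun j : ℕ => h (1 / ((j : ℝ) + 1)) (hpos j)
    have hsmall : ∀ A : ℝ, 0 < A → ∃ j : ℕ, 1 / ((j : ℝ) + 1) ≤ A := fun A hA =>
      (exists_nat_one_div_lt hA).imp fun _ hj => hj.le
    have hle : ∀ i j : ℕ, i ≤ j → 1 / ((j : ℝ) + 1) ≤ 1 / ((i : ℝ) + 1) := fun i j hij =>
      Nat.one_div_le_one_div hij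
    -- the ball with parameter `1 / (j + 1)` is scaled by the bound `K j` that holds on it
    refine ⟨{g | ∃ (j : ℕ) (g₀ : GSDual .beurling d M N),
      WDual Sum.isLeft M N g₀.lin (1 / ((j : ℝ) + 1)) 1 ∧ g = (((K j + 1)⁻¹ : ℝ) : ℂ) • g₀},
      fun A hA => ?_, fun A hA => ?_⟩
    · obtain ⟨i, hi⟩ := hsmall A hA
      refine ⟨K i + 1, by linarith [hK i], ?_⟩
      rintro f hf _ ⟨j, g, hg, rfl⟩
      have hKj := hK j
      rw [seminorm_tfrDual_smul hM hN k q _ (by positivity), inv_mul_le_iff₀ (by positivity)]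
      rcases le_total i j with hij | hij
      · have h1 := h j f g (hf.mono (hpos j) ((hle i j hij).trans hi) le_rfl) hg
        nlinarith [hK i]
      · have h1 := h i f g (hf.mono (hpos i) hi le_rfl) (hg.mono (hpos i) (hle j i hij) le_rfl)
        nlinarith [hK i]
    · obtain ⟨i, hi⟩ := hsmall A hA
      have := hK i
      exact ⟨(K i + 1)⁻¹, by positivity, fun g hg => ⟨i, g, hg.mono (hpos i) hi le_rfl, rfl⟩⟩

/-- A seminorm that is bounded on balls has a finite supremum over a family of seminorms. -/
lemma exists_le_of_quant (hM : M.Nontrivial c) (hN : N.Nontrivial c) {X : Type}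
    {s : X → Seminorm ℂ (GSDual c d M N)}
    (h : c.quant₁ fun A => ∃ K : ℝ, 0 ≤ K ∧ ∀ f : GSDual c d M N,
      WDual Sum.isLeft M N f.lin A 1 → ∀ x, s x f ≤ K) :
    BddAbove (Set.range s) ∧ IsDualSeminorm (⨆ x, s x) := by
  have hb : BddAbove (Set.range s) := by
    refine Seminorm.bddAbove_range_iff.2 fun f => ?_
    obtain ⟨A, hA, ⟨K, hK, h⟩, L, hL, hf⟩ := h.and_coquant₁
      ((mem_dual_iff (compat_GS M N) hM hN).1 f.2)
    refine ⟨K * L, ?_⟩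
    rintro _ ⟨x, rfl⟩
    exact seminorm_le_mul (fun f hf => h f hf x) hL hf
  refine ⟨hb, (isDualSeminorm_iff (compat_GS M N) hM hN).2 (h.imp fun A _ ⟨K, hK, h⟩ =>
    ⟨K, hK, fun f hf => ?_⟩)⟩
  rw [Seminorm.iSup_apply hb]
  exact Real.iSup_le (h f hf) hK

/-- The representation is dominated by a product of continuous seminorms. -/
lemma exists_seminorm_mul_le (hq : IsDualSeminorm q) : ∃ p r : Seminorm ℂ (GSDual c d M N),
    IsDualSeminorm p ∧ IsDualSeminorm r ∧ ∀ f g, q (tfrDual hM hN k f g) ≤ p f * r g := by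
  obtain ⟨G, h1, h2⟩ := exists_absorbing_set hM hN k hq
  obtain ⟨bp, hp⟩ := exists_le_of_quant hM hN (s := fun g : G => q.comp (tfrLeft hM hN k g.1))
    (h1.imp fun A _ ⟨K, hK, h⟩ => ⟨K, hK, fun f hf g => h f hf g.1 g.2⟩)
  -- `p f` is the supremum over the absorbing set, and the second seminorm is the supremum over the
  -- unit ball of `p`
  set p : Seminorm ℂ (GSDual c d M N) := ⨆ g : G, q.comp (tfrLeft hM hN k g.1) with hpdef
  have hpG : ∀ f, ∀ g ∈ G, q (tfrDual hM hN k f g) ≤ p f := fun f g hg => by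
    rw [hpdef, Seminorm.iSup_apply bp]
    exact le_ciSup (Seminorm.bddAbove_range_iff.1 bp f) (⟨g, hg⟩ : G)
  obtain ⟨br, hr⟩ := exists_le_of_quant hM hN
    (s := fun f : {f : GSDual c d M N // p f ≤ 1} => q.comp (tfrRight hM hN k f.1))
    (h2.imp fun A _ ⟨t, ht, h⟩ => ⟨t⁻¹, by positivity, fun g hg f => by
      have h3 := (hpG f.1 _ (h g hg)).trans f.2
      rw [seminorm_tfrDual_smul hM hN k q t ht.le] at h3
      rw [comp_tfrRight_apply, ← one_div, le_div_iff₀ ht]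
      linarith⟩)
  refine ⟨p, _, hp, hr, fun f g => ?_⟩
  rw [mul_comm]
  refine le_mul_of_forall_pos (apply_nonneg p f) fun D hD hfD => ?_
  -- `f` is scaled by every `D ≥ p f` with `D > 0`, as `p f` may vanish
  have hf : p ((D : ℂ)⁻¹ • f) ≤ 1 := by
    rw [map_smul_eq_mul, norm_inv, Complex.norm_real, Real.norm_of_nonneg hD.le,
      inv_mul_le_iff₀ hD]
    linarith
  have h3 := le_ciSup (Seminorm.bddAbove_range_iff.1 br g)
    (⟨(D : ℂ)⁻¹ • f, hf⟩ : {f : GSDual c d M N // p f ≤ 1})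
  rw [Seminorm.iSup_apply br]
  simp only [comp_tfrRight_apply] at h3 ⊢
  rw [tfrDual_smul_left, map_smul_eq_mul, norm_inv, Complex.norm_real,
    Real.norm_of_nonneg hD.le, inv_mul_le_iff₀ hD] at h3
  linarith

/-- Joint continuity: the difference of two values is a sum of two terms, one for each argument, to
which the domination by a product of seminorms applies. -/
theorem continuous_tfrDual :
    Continuous fun x : GSDual c d M N × GSDual c d M N => tfrDual hM hN k x.1 x.2 := by
  refine continuous_iff_continuousAt.2 fun ⟨f, g⟩ =>
    ((withSeminorms_dual c).tendsto_nhds _ _).2 fun q ε hε => ?_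
  obtain ⟨p, r, hp, hr, h⟩ := exists_seminorm_mul_le hM hN k q.2
  have h0 : 0 ≤ p f := apply_nonneg p f
  have h1 : 0 ≤ r g := apply_nonneg r g
  -- `δ (r g + 1) + p f δ < ε` for the two terms below
  set δ := min 1 (ε / (p f + r g + 2)) with hδ
  have hδ0 : 0 < δ := lt_min one_pos (by positivity)
  have hδ1 : δ ≤ 1 := min_le_left _ _
  have hδ2 : δ * (p f + r g + 2) ≤ ε := (le_div_iff₀ (by positivity)).1 (min_le_right _ _)
  have hf := ((withSeminorms_dual c).tendsto_nhds
    (fun x : GSDual c d M N × GSDual c d M N => x.1) f).1 (continuous_fst.tendsto (f, g))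
    ⟨p, hp⟩ δ hδ0
  have hg := ((withSeminorms_dual c).tendsto_nhds
    (fun x : GSDual c d M N × GSDual c d M N => x.2) g).1 (continuous_snd.tendsto (f, g))
    ⟨r, hr⟩ δ hδ0
  filter_upwards [hf, hg] with x hx hy
  change p (x.1 - f) < δ at hx
  change r (x.2 - g) < δ at hy
  change q.1 (tfrDual hM hN k x.1 x.2 - tfrDual hM hN k f g) < ε
  have e : tfrDual hM hN k x.1 x.2 - tfrDual hM hN k f g =
      tfrDual hM hN k (x.1 - f) x.2 + tfrDual hM hN k f (x.2 - g) := by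
    have e1 := tfrDual_add_left hM hN k (x.1 - f) f x.2
    have e2 := tfrDual_add_right hM hN k f (x.2 - g) g
    rw [sub_add_cancel] at e1 e2
    rw [e1, e2]; abel
  have h2 : r x.2 ≤ r (x.2 - g) + r g := by
    have := map_add_le_add r (x.2 - g) g
    rwa [sub_add_cancel] at this
  rw [e]
  refine (map_add_le_add q.1 _ _).trans_lt ((add_le_add (h _ _) (h _ _)).trans_lt ?_)
  have h3 : p (x.1 - f) * r x.2 ≤ δ * (1 + r g) :=
    mul_le_mul hx.le (h2.trans (by linarith)) (apply_nonneg r _) hδ0.le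
  have h4 : p f * r (x.2 - g) ≤ p f * δ := mul_le_mul_of_nonneg_left hy.le h0
  nlinarith

lemma extends_tfrDual : Extends c d M N k fun x => tfrDual hM hN k x.1 x.2 := fun f g =>
  ⟨⟨_, TFR_mem hM hN k f.2 g.2⟩, rfl, tfrDual_l2Dual hM hN k (memLp_of_mem hM hN f.2)
    (memLp_of_mem hM hN g.2) (TFR_mem hM hN k f.2 g.2)⟩

/-- Continuous extensions to the duals agree because test functions are dense. -/
lemma eq_of_extends (hM : M.Nontrivial c) (hN : N.Nontrivial c) (k : TFRKind)
    {T T' : GSDual c d M N × GSDual c d M N → GSDual₂ c d M N N M}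
    (hT : Continuous T) (hT' : Continuous T') (h : Extends c d M N k T)
    (h' : Extends c d M N k T') : T' = T := by
  funext ⟨f, g⟩
  obtain ⟨u, hu⟩ := exists_tendsto_toDual hM hN f
  obtain ⟨v, hv⟩ := exists_tendsto_toDual hM hN g
  have huv := hu.prodMk_nhds hv
  have e : ∀ n, T' (toDual (u n), toDual (v n)) = T (toDual (u n), toDual (v n)) := fun n => by
    obtain ⟨F, hF, h1⟩ := h (u n) (v n)
    obtain ⟨F', hF', h2⟩ := h' (u n) (v n)
    rw [h1, h2, Subtype.ext (hF'.trans hF.symm)]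
  have h2 := (hT'.tendsto (f, g)).comp huv
  have h1 := (hT.tendsto (f, g)).comp huv
  exact dual_tendsto_unique (compat_mix M N) hM hN (h2.congr e) h1

end Continuity

end

end GelfandShilov

end

open GelfandShilov in
theorem theorem3p3 (c : GSType) (d : ℕ) (M N : WeightSeq)
    (hM : M.Nontrivial c) (hN : N.Nontrivial c) (k : TFRKind) :
    -- the representation of test functions is a test function
    (∀ f ∈ GS c d M N, ∀ g ∈ GS c d M N, TFR k f g ∈ GS₂ c d M N N M) ∧
    -- unique continuous extension to ultradistributions, and the converse for ultradistributions
    (∃ T : GSDual c d M N × GSDual c d M N → GSDual₂ c d M N N M,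
      (Continuous T ∧ Extends c d M N k T) ∧
      (∀ T' : GSDual c d M N × GSDual c d M N → GSDual₂ c d M N N M,
        Continuous T' → Extends c d M N k T' → T' = T) ∧
      (∀ f g : GSDual c d M N, f ≠ 0 → g ≠ 0 →
        (∃ F : GS₂ c d M N N M, T (f, g) = toDual F) →
        (∃ f₀ : GS c d M N, f = toDual f₀) ∧ (∃ g₀ : GS c d M N, g = toDual g₀))) ∧
    -- the converse for square integrable functions
    (∀ f g : Rn d → ℂ, MemLp f 2 volume → MemLp g 2 volume →
      ¬ f =ᵐ[volume] 0 → ¬ g =ᵐ[volume] 0 → TFR k f g ∈ GS₂ c d M N N M →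
      (∃ f₀ ∈ GS c d M N, f =ᵐ[volume] f₀) ∧ (∃ g₀ ∈ GS c d M N, g =ᵐ[volume] g₀)) := by
  refine ⟨fun f hf g hg => TFR_mem hM hN k hf hg,
    ⟨fun x => tfrDual hM hN k x.1 x.2,
      ⟨continuous_tfrDual hM hN k, extends_tfrDual hM hN k⟩,
      fun T' hT' h' => eq_of_extends hM hN k (continuous_tfrDual hM hN k) hT'
        (extends_tfrDual hM hN k) h',
      fun f g hf hg ⟨F, hF⟩ => exists_eq_toDual hM hN k hf hg F hF⟩,
    fun f g hf hg hf0 hg0 h => exists_ae_eq hM hN k hf hg hf0 hg0 h⟩
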